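/- \textbf{Setting.} \emph{Lattice derivatives.} Let $\hat e=\{(1,0),(0,1),(-1,0),(0,-1)\}$ and $\partial^\mu f(x)=f(x+\mu)-f(x)$ for $\mu\in\hat e$. On a square lattice put $|x|=\max\{|x_0|,|x_1|\}$ (on the periodic lattice: for the representative closest to $0$). \emph{Covariances.} Let $\gamma\ge 3$ be odd and let $(C_h)_{h\ge 0}$ be a finite range decomposition of the two-dimensional lattice Coulomb potential on the scales $\gamma^h$: each $C_h:\mathbb Z^2\to\mathbb R$ is even and positive-definite, $C_h(x)=0$ if $|x|\ge\gamma^{h+1}/2$; for every $n\ge1$ there is $c_n$ with $|\partial^{\mu_1}\cdots\partial^{\mu_n}C_h(x)|\le c_n\gamma^{-nh}$ for all $h,x,\mu_i\in\hat e$; and $$\sum_{h\ge0}\big(C_h(x)-C_h(0)\big)=\int_{[-\pi,\pi]^2}\frac{d^2p}{(2\pi)^2}\,\frac{\cos(p\cdot x)-1}{2\sum_{i=0,1}(1-\cos p_i)}\qquad(x\in\mathbb Z^2).$$ For $L=\gamma^M$ let $\Gamma_j=\sum_{jM\le h<(j+1)M}C_h$. On the periodic lattice $\Lambda=(\mathbb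 Z/L^R\mathbb Z)^2$, for $0\le j<R$, let $\mathbb E_j$ be the expectation over the centred Gaussian field $\zeta=(\zeta_x)_{x\in\Lambda}$ with covariance $\Gamma_j(x-y)$ (with $\Gamma_j$ evaluated at the representative of $x-y$ closest to $0$). \emph{Polymers.} A $j$-block is a translate of $\{x\in\Lambda:|x|\le L^j/2\}$ by an element of $L^j\mathbb Z^2$; a $j$-polymer is a union of $j$-blocks; $|X|_j$ is the number of $j$-blocks in $X$. Two blocks touch if they contain points at distance $|x-y|=1$; this defines connected ($j$-)polymers, which are non-empty by convention. $\mathcal S_j$ is the set of small polymers, i.e. connected with $|X|_j\le4$. $X^*=\bigcup\{Y\in\mathcal S_j:Y\cap X\ne\emptyset\}$; $\bar X$ is the smallest $(j+1)$-polymer containing $X\in\mathcal S_j$; $\partial X$ is the set of sites of $X$ with a nearest neighbour outside $X$. \emph{Norms.} For a field $f$ on $\Lambda$ and $Y\subset\Lambda$ let $\|\nabla_k^nf\|_{L^\infty(Y)}=\max_{x\in Y,\,\mu_i\in\hat e}L^{nk}|\partial^{\mu_1}\cdots\partial^{\mu_n}f(x)|$. For $X\in\mathcal{S}_j$ (or,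 more generally, a connected $j$-polymer $X$) and $k\in\{j,j+1\}$ let $\|f\|_{\mathcal C^2_k(X)}=\max_{n=0,1,2}\|\nabla_k^nf\|_{L^\infty(X^*)}$. For smooth $F:\mathbb R^\Lambda\to\mathbb C$, real $\varphi$ and $h>1$ let $$\|F\|_{h,T_k(\varphi,X)}=\sum_{n\ge0}\frac{h^n}{n!}\ \sup_{\|f_i\|_{\mathcal C^2_k(X)}\le1}\Big|\sum_{x_1,\dots,x_n\in X^*}f_1(x_1)\cdots f_n(x_n)\frac{\partial^nF}{\partial\varphi_{x_1}\cdots\partial\varphi_{x_n}}(\varphi)\Big|,$$ the supremum being over complex $f_1,\dots,f_n:\Lambda\to\mathbb C$. For constants $c_1,c_3,c>0$ and $\kappa_L=c/\ln L$ the field regulator of a $j$-polymer $X$ is $$\ln G_j(\varphi,X)=c_1\kappa_L\sum_{x\in X}\tfrac12\sum_{\mu\in\hat e}|\partial^\mu\varphi_x|^2+c_3\kappa_LL^{j}\sum_{x\in\partial X}\tfrac12\sum_{\mu\in\hat e}|\partial^\mu\varphi_x|^2+c_1\kappa_L\sum_{B\subset X}\|\nabla_j^2\varphi\|^2_{L^\infty(B^*)},$$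 the last sum being over the $j$-blocks $B$ of $X$; for the $(j+1)$-polymer $\bar X$, $G_{j+1}(\varphi,\bar X)$ is defined in the same way with $j+1$ for $j$ throughout. For $A>1$ let $\|K\|_{h,T_j}=\sup_X A^{|X|_j}\sup_\varphi\|K(\cdot,X)\|_{h,T_j(\varphi,X)}/G_j(\varphi,X)$, over connected $j$-polymers $X$ and real fields $\varphi$. \emph{Activities and charges.} Let $\alpha>0$. A polymer activity $K_j$ on scale $j$ assigns to each connected $j$-polymer $X$ a $C^\infty$ function $K_j(\varphi,X)\in\mathbb C$ of $\varphi\in\mathbb R^\Lambda$ that depends only on $(\varphi_x)_{x\in X^*}$ and is invariant under $\varphi\mapsto\varphi+\frac{2\pi m}{\alpha}$ for each $m\in\mathbb Z$. Its component of charge $q$ is $\hat K_j(q,\varphi,X)=\frac\alpha{2\pi}\int_0^{2\pi/\alpha}K_j(\varphi+s,X)e^{-iq\alpha s}\,ds$. For $x_0\in X$ and $(\delta\varphi')_x=\varphi'_x-\varphi'_{x_0}$ one has $\mathbb E_j[\hat K_j(q,\varphi'+\zeta,X)]=e^{iq\alpha\varphi'_{x_0}}\mathbb E_j[\hat K_j(q,\delta\varphi'+\zeta,X)]$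 whenever these expectations exist, and the zeroth-order Taylor remainder in $\delta\varphi'$ is $$R^{x_0}_{q,X}(\varphi')=e^{iq\alpha\varphi'_{x_0}}\Big(\mathbb E_j[\hat K_j(q,\delta\varphi'+\zeta,X)]-\mathbb E_j[\hat K_j(q,\zeta,X)]\Big).$$ \textbf{Theorem.} There is $\vartheta>0$ such that the following holds. Let $\gamma$, $(C_h)$ and $c_1,c_3,c>0$ be as above, and let $\alpha>0$ satisfy $\alpha^2\ge8\pi$. Let $C_0$ satisfy $\|\Gamma_j(\cdot)-\Gamma_j(0)\|_{\mathcal C^2_j(X)}\le C_0$ for all $L=\gamma^M$ ($M\ge1$), all $0\le j<R$ and all $X\in\mathcal S_j$ containing $0$, and let $h>1$, $h\ge2\alpha C_0$. Then there is $L_0$ such that for all $L=\gamma^M\ge L_0$, all $0\le j<R$, all $A>1$, all polymer activities $K_j$ on scale $j$, all $q\in\{1,-1\}$ and all $X\in\mathcal S_j$: (a) if $\|K_j\|_{h,T_j}<\infty$, then $\hat K_j(q,\varphi'+\zeta,X)$ is integrable for every real field $\varphi'$, and $\varphi'\mapsto\mathbb E_j[\hat K_j(q,\varphi'+\zeta,X)]$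 is $C^\infty$; (b) for every $x_0\in X$ and every real field $\varphi'$, $$\|R^{x_0}_{q,X}\|_{h,T_{j+1}(\varphi',X)}\le L^{-(2+\vartheta)}\,\|K_j\|_{h,T_j}\Big(\frac A2\Big)^{-|X|_j}G_{j+1}(\varphi',\bar X)$$ (a trivial bound if $\|K_j\|_{h,T_j}=\infty$); (c) the same bound holds for the average $\frac1{|X|}\sum_{x_0\in X}R^{x_0}_{q,X}$, where $|X|$ is the number of sites of $X$. -/

import Mathlib

open scoped ContDiff NNReal ENNReal

namespace CoulombGas

noncomputable section

/-! ### Lattice derivatives -/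

/-- The four lattice directions `(1,0), (0,1), (-1,0), (0,-1)`, for the lattice `A × A`
(`A = ℤ` for the infinite lattice, `A = ZMod N` for the periodic one). -/
def unitVec (A : Type*) [Ring A] : Fin 4 → A × A :=
  ![(1, 0), (0, 1), (-1, 0), (0, -1)]

/-- `latticeDeriv [μ₁, …, μₙ] φ = ∂^{μ₁} ⋯ ∂^{μₙ} φ`, where
`(∂^μ φ)(x) = φ (x + μ) - φ x`. -/
def latticeDeriv {A E : Type*} [Ring A] [AddCommGroup E] :
    List (Fin 4) → (A × A → E) → A × A → E
  | [], φ => φ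
  | μ :: l, φ => fun x => latticeDeriv l φ (x + unitVec A μ) - latticeDeriv l φ x

/-! ### The covariance -/

/-- The normalized lattice Coulomb potential on `ℤ²`,
`W(x|0) = ∫_{[-π,π]²} d²p/(2π)² (e^{ip·x} - 1)/(-Δ̂(p))` with
`-Δ̂(p) = 2 (1 - cos p₀) + 2 (1 - cos p₁)`. -/
def coulombPotential (x : ℤ × ℤ) : ℝ :=
  (1 / (2 * Real.pi) ^ 2) *
    ∫ p in (Set.Icc (-Real.pi) Real.pi ×ˢ Set.Icc (-Real.pi) Real.pi : Set (ℝ × ℝ)),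
      (Real.cos (p.1 * x.1 + p.2 * x.2) - 1) /
        (2 * (1 - Real.cos p.1) + 2 * (1 - Real.cos p.2))

/-- `C 0, C 1, C 2, …` is a finite range decomposition, on the scales `γ^h`, of the
two-dimensional lattice Coulomb potential. -/
structure IsFiniteRangeDecomposition (γ : ℕ) (C : ℕ → ℤ × ℤ → ℝ) : Prop where
  even : ∀ h x, C h (-x) = C h x
  posDef : ∀ h (s : Finset (ℤ × ℤ)) (f : ℤ × ℤ → ℝ),
    0 ≤ ∑ x ∈ s, ∑ y ∈ s, f x * f y * C h (x - y)
  finiteRange : ∀ h (x : ℤ × ℤ),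
    γ ^ (h + 1) ≤ 2 * max x.1.natAbs x.2.natAbs → C h x = 0
  derivBound : ∀ n : ℕ, 1 ≤ n → ∃ c : ℝ, ∀ h (μ : Fin n → Fin 4) (x : ℤ × ℤ),
    |latticeDeriv (List.ofFn μ) (C h) x| ≤ c * ((γ : ℝ) ^ (n * h))⁻¹
  hasSum_coulomb : ∀ x, HasSum (fun h => C h x - C h 0) (coulombPotential x)

/-- `Γ_j`, the sum of the covariances `C h` on the scales `L^j ≤ γ^h < L^{j+1}`, for `L = γ^M`. -/
def scaleCov (C : ℕ → ℤ × ℤ → ℝ) (M j : ℕ) (x : ℤ × ℤ) : ℝ :=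
  ∑ h ∈ Finset.Ico (j * M) ((j + 1) * M), C h x

/-! ### The periodic lattice, blocks and polymers -/

/-- The periodic square lattice `Λ` of side `L^R`. -/
abbrev Site (L R : ℕ) : Type := ZMod (L ^ R) × ZMod (L ^ R)

variable {L R : ℕ}

/-- `|x| = max {|x₀|, |x₁|}` on the periodic lattice. -/
def siteAbs (x : Site L R) : ℕ := max x.1.valMinAbs.natAbs x.2.valMinAbs.natAbs

/-- The function `Γ_j` on the periodic lattice: evaluation at the representative of `x`
closest to the origin. -/
def torusCov (C : ℕ → ℤ × ℤ → ℝ) (M j : ℕ) (x : Site L R) : ℝ :=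
  scaleCov C M j (x.1.valMinAbs, x.2.valMinAbs)

variable [NeZero L]

/-- The square of side `L^j` centred at `c`. -/
def block (j : ℕ) (c : Site L R) : Finset (Site L R) :=
  Finset.univ.filter fun x => 2 * siteAbs (x - c) ≤ L ^ j

/-- The set of all `j`-blocks: the translates of the central square by vectors in `L^j ℤ²`. -/
def blocks (j : ℕ) : Finset (Finset (Site L R)) :=
  Finset.univ.image fun v : Site L R => block j ((L ^ j) • v)

/-- `j`-polymers: unions of `j`-blocks (the empty set included). -/
def IsPolymer (j : ℕ) (X : Finset (Site L R)) : Prop :=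
  ∃ S : Finset (Finset (Site L R)), S ⊆ blocks j ∧ X = S.biUnion id

/-- The `j`-blocks contained in `X`; their number is `|X|_j`. -/
def blocksOf (j : ℕ) (X : Finset (Site L R)) : Finset (Finset (Site L R)) :=
  (blocks j).filter (· ⊆ X)

/-- Two blocks touch if they have points at distance one. -/
def Touch (B D : Finset (Site L R)) : Prop :=
  ∃ x ∈ B, ∃ y ∈ D, siteAbs (x - y) = 1

/-- Connected (non-empty) `j`-polymers. -/
def IsConnectedPolymer (j : ℕ) (X : Finset (Site L R)) : Prop :=
  IsPolymer j X ∧ X.Nonempty ∧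
    ∀ B ∈ blocksOf j X, ∀ D ∈ blocksOf j X,
      Relation.ReflTransGen (fun P Q => Q ∈ blocksOf j X ∧ Touch P Q) B D

/-- Small `j`-polymers: connected, with at most four `j`-blocks. -/
def IsSmall (j : ℕ) (X : Finset (Site L R)) : Prop :=
  IsConnectedPolymer j X ∧ (blocksOf j X).card ≤ 4

open Classical in
/-- The small set neighbourhood `X^*` of a `j`-polymer `X`. -/
def smallNbhd (j : ℕ) (X : Finset (Site L R)) : Finset (Site L R) :=
  Finset.univ.filter fun x => ∃ Y, IsSmall j Y ∧ (Y ∩ X).Nonempty ∧ x ∈ Y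

/-- `reblock (j + 1) X` is the smallest `(j + 1)`-polymer that contains `X`. -/
def reblock (k : ℕ) (X : Finset (Site L R)) : Finset (Site L R) :=
  ((blocks k).filter fun D => (D ∩ X).Nonempty).biUnion id

/-- The sites of `X` with a nearest neighbour outside `X`. -/
def boundary (X : Finset (Site L R)) : Finset (Site L R) :=
  X.filter fun x => ∃ μ, x + unitVec (ZMod (L ^ R)) μ ∉ X

/-! ### Norms of the fields and the field regulator -/

/-- `‖∇ⱼⁿ φ‖_{L^∞(Y)} = max_{μ₁ … μₙ} max_{x ∈ Y} L^{nj} |∂^{μ₁} ⋯ ∂^{μₙ} φ_x|`. -/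
def gradSup {E : Type*} [NormedAddCommGroup E] (j n : ℕ) (Y : Finset (Site L R))
    (φ : Site L R → E) : ℝ≥0 :=
  Finset.univ.sup fun μ : Fin n → Fin 4 =>
    Y.sup fun x => (L : ℝ≥0) ^ (n * j) * ‖latticeDeriv (List.ofFn μ) φ x‖₊

/-- `max_{n = 0,1,2} ‖∇ⱼⁿ φ‖_{L^∞(Y)}`; this is `‖φ‖_{𝒞ⱼ²(X)}` for `Y = X^*`. -/
def c2Norm {E : Type*} [NormedAddCommGroup E] (j : ℕ) (Y : Finset (Site L R))
    (φ : Site L R → E) : ℝ≥0 :=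
  (Finset.range 3).sup fun n => gradSup j n Y φ

/-- `∑_{x ∈ Y} ∑_{μ} |∂^μ φ_x|²`, where the sum over the directions `±e₀, ±e₁` carries a
factor `1/2`. -/
def gradSqSum (Y : Finset (Site L R)) (φ : Site L R → ℝ) : ℝ :=
  ∑ x ∈ Y, (1 / 2) * ∑ μ : Fin 4, |latticeDeriv [μ] φ x| ^ 2

/-- The field regulator
`G_j(φ,X) = exp (c₁κ ‖∇ⱼφ‖²_{L²ⱼ(X)} + c₃κ ‖∇ⱼφ‖²_{L²ⱼ(∂X)} + c₁κ ∑_B ‖∇ⱼ²φ‖²_{L^∞(B^*)})`,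
the sum being over the `j`-blocks `B` of `X`; here
`‖∇ⱼφ‖²_{L²ⱼ(X)} = L^{-2j} ∑_{x ∈ X} ∑_μ L^{2j} |∂^μ φ_x|²` and
`‖∇ⱼφ‖²_{L²ⱼ(∂X)} = L^{-j} ∑_{x ∈ ∂X} ∑_μ L^{2j} |∂^μ φ_x|²`. -/
def regulator (c₁ c₃ κ : ℝ) (j : ℕ) (φ : Site L R → ℝ) (X : Finset (Site L R)) : ℝ :=
  Real.exp
    (c₁ * κ * (((L : ℝ) ^ (2 * j))⁻¹ * ((L : ℝ) ^ (2 * j) * gradSqSum X φ))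
      + c₃ * κ * (((L : ℝ) ^ j)⁻¹ * ((L : ℝ) ^ (2 * j) * gradSqSum (boundary X) φ))
      + c₁ * κ * ∑ B ∈ blocksOf j X, (gradSup j 2 (smallNbhd j B) φ : ℝ) ^ 2)

/-! ### Norms of the polymer activities -/

/-- `Dⁿ_φ F · (f₁, …, fₙ) = ∑_{x₁, …, xₙ ∈ Y} f₁(x₁) ⋯ fₙ(xₙ) ∂ⁿF/∂φ_{x₁} ⋯ ∂φ_{xₙ} (φ)`. -/
def dirDeriv (Y : Finset (Site L R)) (n : ℕ) (F : (Site L R → ℝ) → ℂ) (φ : Site L R → ℝ)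
    (f : Fin n → Site L R → ℂ) : ℂ :=
  ∑ x ∈ Fintype.piFinset (fun _ : Fin n => Y),
    (∏ i, f i (x i)) * iteratedFDeriv ℝ n F φ (fun i => Pi.single (x i) 1)

/-- `‖F‖_{Tⁿ_k(φ,X)}` with `Y = X^*`. -/
def tnNorm (k : ℕ) (Y : Finset (Site L R)) (n : ℕ) (F : (Site L R → ℝ) → ℂ)
    (φ : Site L R → ℝ) : ℝ≥0∞ :=
  ⨆ (f : Fin n → Site L R → ℂ) (_ : ∀ i, c2Norm k Y (f i) ≤ 1), ‖dirDeriv Y n F φ f‖ₑ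

/-- `‖F‖_{h,T_k(φ,X)} = ∑ₙ hⁿ/n! ‖F‖_{Tⁿ_k(φ,X)}` with `Y = X^*`. -/
def tNorm (h : ℝ) (k : ℕ) (Y : Finset (Site L R)) (F : (Site L R → ℝ) → ℂ)
    (φ : Site L R → ℝ) : ℝ≥0∞ :=
  ∑' n : ℕ, ENNReal.ofReal (h ^ n / n.factorial) * tnNorm k Y n F φ

/-- `‖K‖_{h,T_j} = sup_X A^{|X|_j} sup_φ ‖K(φ,X)‖_{h,T_j(φ,X)} / G_j(φ,X)`, the supremum being
over connected `j`-polymers `X` and real fields `φ`. -/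
def activityNorm (c₁ c₃ κ h A : ℝ) (j : ℕ)
    (K : Finset (Site L R) → (Site L R → ℝ) → ℂ) : ℝ≥0∞ :=
  ⨆ (X : Finset (Site L R)) (_ : IsConnectedPolymer j X),
    ENNReal.ofReal (A ^ (blocksOf j X).card) *
      ⨆ φ : Site L R → ℝ,
        tNorm h j (smallNbhd j X) (K X) φ / ENNReal.ofReal (regulator c₁ c₃ κ j φ X)

/-- Polymer activities on scale `j`: for every connected `j`-polymer `X`, `K(·,X)` is a smooth
function of the field in `X^*`, invariant under `φ ↦ φ + 2πm/α`, `m ∈ ℤ`. -/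
structure IsActivity (α : ℝ) (j : ℕ) (K : Finset (Site L R) → (Site L R → ℝ) → ℂ) :
    Prop where
  smooth : ∀ X, IsConnectedPolymer j X → ContDiff ℝ ∞ (K X)
  support : ∀ X, IsConnectedPolymer j X → ∀ φ ψ : Site L R → ℝ,
    (∀ x ∈ smallNbhd j X, φ x = ψ x) → K X φ = K X ψ
  periodic : ∀ X, IsConnectedPolymer j X → ∀ (φ : Site L R → ℝ) (m : ℤ),
    K X (fun x => φ x + 2 * m * Real.pi / α) = K X φ

/-- The component of charge `q`,
`F̂(q,φ) = α/(2π) ∫_0^{2π/α} F(φ + s) e^{-iqαs} ds`. -/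
def chargeComponent (α : ℝ) (q : ℤ) (F : (Site L R → ℝ) → ℂ) (φ : Site L R → ℝ) : ℂ :=
  ((α / (2 * Real.pi) : ℝ) : ℂ) *
    ∫ s in (0 : ℝ)..(2 * Real.pi / α),
      F (fun x => φ x + s) * Complex.exp (-(Complex.I * q * α * s))

/-! ### Expectation and Taylor remainder -/

/-- The law of the fluctuation field on scale `j`: the centred Gaussian measure on `ℝ^Λ`
with covariance `Γ_j(x - y)`. -/
def fluctuationMeasure (L R : ℕ) [NeZero L] (C : ℕ → ℤ × ℤ → ℝ) (M j : ℕ) :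
    MeasureTheory.Measure (EuclideanSpace ℝ (Site L R)) :=
  ProbabilityTheory.multivariateGaussian 0
    (Matrix.of fun x y : Site L R => torusCov C M j (x - y))

/-- `φ' ↦ 𝔼_j[F(φ' + ζ)]`. -/
def fluctuationExp (C : ℕ → ℤ × ℤ → ℝ) (M j : ℕ) (F : (Site L R → ℝ) → ℂ)
    (φ' : Site L R → ℝ) : ℂ :=
  ∫ ζ, F (fun x => φ' x + ζ x) ∂(fluctuationMeasure L R C M j)

/-- Taylor polynomial of order `n` at `ξ = 0` of a function of `(ξ_x)_{x ∈ Y}`. -/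
def taylorPoly (Y : Finset (Site L R)) (n : ℕ) (F : (Site L R → ℝ) → ℂ) (ξ : Site L R → ℝ) : ℂ :=
  ∑ m ∈ Finset.range (n + 1),
    (1 / (m.factorial : ℂ)) * dirDeriv Y m F 0 (fun _ x => (ξ x : ℂ))

/-- Taylor remainder of order `n`. -/
def taylorRem (Y : Finset (Site L R)) (n : ℕ) (F : (Site L R → ℝ) → ℂ) (ξ : Site L R → ℝ) : ℂ :=
  F ξ - taylorPoly Y n F ξ

/-- The order-`n` Taylor remainder, in the field differences `(δφ')_x = φ'_x - φ'_{x₀}`, of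
`φ' ↦ 𝔼_j[F(φ' + ζ)] = e^{iqαφ'_{x₀}} 𝔼_j[F(δφ' + ζ)]`, where `F` has charge `q`. -/
def remExp (C : ℕ → ℤ × ℤ → ℝ) (M j : ℕ) (Y : Finset (Site L R)) (n : ℕ) (α : ℝ) (q : ℤ)
    (x₀ : Site L R) (F : (Site L R → ℝ) → ℂ) (φ' : Site L R → ℝ) : ℂ :=
  Complex.exp (Complex.I * q * α * φ' x₀) *
    taylorRem Y n (fluctuationExp C M j F) (fun x => φ' x - φ' x₀)

end

/-- `C₀` bounds `‖Γ_j(·) - Γ_j(0)‖_{𝒞ⱼ²(X)}` for all small `j`-polymers `X` containing the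
origin, uniformly in `L = γ^M`, `R` and `j < R`. -/
def IsPropagatorBound (γ : ℕ) (C : ℕ → ℤ × ℤ → ℝ) (C₀ : ℝ) : Prop :=
  ∀ (L M R j : ℕ) [NeZero L], 1 ≤ M → L = γ ^ M → j < R →
    ∀ X : Finset (Site L R), IsSmall j X → 0 ∈ X →
      (c2Norm j (smallNbhd j X) (fun x : Site L R => torusCov C M j x - torusCov C M j (0 : Site L R)) : ℝ) ≤ C₀

end CoulombGas

open CoulombGas

set_option linter.unusedSectionVars false

/-! The exponent 2 + 1/2 comes from three powers of L, half a power of which pays for constants and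
a factor √(log L).

Two powers come from the Gaussian integral. Put β = qα. A function H of charge β picks up the phase
e^{iβs} under a constant shift s. Translating ζ formally by iβΓ_j(· - y), with y the centre of a
block of X, turns the expectation of H into e^{-β²Γ_j(0)/2} times the expectation of e^{-iβζ_y} H,
with H translated by iβ(Γ_j(· - y) - Γ_j(0)). The last function has norm at most C₀, and h ≥ 2αC₀
lets the derivatives it creates be paid by lowering the radius from h to h/2. Since H is only
smooth, the translation is carried out as the Taylor series of an entire function of a parameter
(`enorm_integral_le_of_hasCharge`, `tNorm_expectation_le`). The Coulomb potential behaves like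
-(2π)⁻¹ log|x|, so Γ_j(0) ≥ (2π)⁻¹ log L - B (`IsFiniteRangeDecomposition.exists_scaleCov_zero_ge`),
and α² ≥ 8π turns the exponential into O(L⁻²).

The third power comes from subtracting the value at ζ. A test function f that is bounded on scale j
+ 1 splits into the constant f(x₀), which acts as multiplication by iβf(x₀) and costs in total the
factor e^{αh}, and f - f(x₀), of size O(L⁻¹) on scale j. Derivatives in directions vanishing at x₀
do not see the subtracted term, so orders m ≥ 1 gain L⁻¹. Order 0 gains it by the mean value
inequality along tδφ', because δφ' is O((N + 1)/L), N being the size of φ' on scale j + 1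
(`tNorm_chargeRemainder_le`, `IsSmall.exists_fieldSize`). The factor N + 1 is absorbed by the new
regulator at the price of √(log L), since κ = c/log L.

Two supporting facts are needed. The periodized covariance is positive semidefinite
(`posSemidef_torusCov`), so that the Gaussian law really has it as covariance. And the regulator has
bounded Gaussian moments (`expQuad_regSum`): its exponent is controlled by squares of Gaussian
variables of bounded total variance, through a discrete Sobolev inequality, while κ is small for
large L. -/

namespace CoulombGas

/-! ### Directional derivatives in complex directions; functions of given support and charge -/

section Calculus

variable {ι : Type*} [Fintype ι] [DecidableEq ι]

/-- The derivative of `F` in the complex direction `f`, restricted to the coordinates in `Y`. -/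
noncomputable def cdir (Y : Finset ι) (f : ι → ℂ) (F : (ι → ℝ) → ℂ) (φ : ι → ℝ) : ℂ :=
  ∑ x ∈ Y, f x * fderiv ℝ F φ (Pi.single x 1)

/-- Iterated derivatives in complex directions. -/
noncomputable def cdirs (Y : Finset ι) (l : List (ι → ℂ)) (F : (ι → ℝ) → ℂ) : (ι → ℝ) → ℂ :=
  l.foldr (cdir Y) F

@[simp] lemma cdirs_nil (Y : Finset ι) (F : (ι → ℝ) → ℂ) : cdirs Y [] F = F := rfl

@[simp] lemma cdirs_cons (Y : Finset ι) (f : ι → ℂ) (l : List (ι → ℂ)) (F : (ι → ℝ) → ℂ) :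
    cdirs Y (f :: l) F = cdir Y f (cdirs Y l F) := rfl

lemma cdirs_append (Y : Finset ι) (l l' : List (ι → ℂ)) (F : (ι → ℝ) → ℂ) :
    cdirs Y (l ++ l') F = cdirs Y l (cdirs Y l' F) := by
  simp [cdirs]

variable {Y : Finset ι} {F G : (ι → ℝ) → ℂ}

lemma contDiff_fderiv_apply_const (hF : ContDiff ℝ ∞ F) (v : ι → ℝ) :
    ContDiff ℝ ∞ fun φ => fderiv ℝ F φ v :=
  (hF.fderiv_right (m := ∞) (by simp)).clm_apply contDiff_const

lemma contDiff_cdir (hF : ContDiff ℝ ∞ F) (f : ι → ℂ) : ContDiff ℝ ∞ (cdir Y f F) := by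
  unfold cdir
  exact ContDiff.sum fun x _ => contDiff_const.mul (contDiff_fderiv_apply_const hF _)

lemma contDiff_cdirs (hF : ContDiff ℝ ∞ F) (l : List (ι → ℂ)) : ContDiff ℝ ∞ (cdirs Y l F) := by
  induction l with
  | nil => exact hF
  | cons f l ih => exact contDiff_cdir ih f

lemma fderiv_cdir_apply (hF : ContDiff ℝ ∞ F) (f : ι → ℂ) (φ v : ι → ℝ) :
    fderiv ℝ (cdir Y f F) φ v =
      ∑ x ∈ Y, f x * fderiv ℝ (fderiv ℝ F) φ v (Pi.single x 1) := by
  have hd : DifferentiableAt ℝ (fderiv ℝ F) φ :=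
    ((hF.fderiv_right (m := ∞) (by simp)).differentiable (by simp)) φ
  have h1 : ∀ x : ι, HasFDerivAt (fun φ => f x * fderiv ℝ F φ (Pi.single x 1))
      (f x • ((fderiv ℝ (fderiv ℝ F) φ).flip (Pi.single x 1))) φ := fun x =>
    by
    have h := ((ContinuousLinearMap.apply ℝ ℂ (Pi.single x (1 : ℝ) : ι → ℝ)).hasFDerivAt.comp φ
      hd.hasFDerivAt).const_mul (f x)
    refine h.congr_fderiv ?_
    ext v; simp
  have h2 : HasFDerivAt (cdir Y f F)
      (∑ x ∈ Y, f x • ((fderiv ℝ (fderiv ℝ F) φ).flip (Pi.single x 1))) φ := by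
    unfold cdir
    exact HasFDerivAt.fun_sum fun x _ => h1 x
  rw [h2.fderiv]
  simp

/-- Symmetry of the second derivative of the smooth function `F`, extended linearly to complex
directions. -/
lemma cdir_comm (hF : ContDiff ℝ ∞ F) (f g : ι → ℂ) :
    cdir Y f (cdir Y g F) = cdir Y g (cdir Y f F) := by
  ext φ
  have hs : ∀ v w, fderiv ℝ (fderiv ℝ F) φ v w = fderiv ℝ (fderiv ℝ F) φ w v := fun v w =>
    (hF.contDiffAt.isSymmSndFDerivAt (by simpa using WithTop.coe_le_coe.2 (le_top : (2 : ℕ∞) ≤ ⊤))) v w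
  change ∑ x ∈ Y, f x * fderiv ℝ (cdir Y g F) φ (Pi.single x 1) =
    ∑ x ∈ Y, g x * fderiv ℝ (cdir Y f F) φ (Pi.single x 1)
  simp_rw [fderiv_cdir_apply hF, Finset.mul_sum]
  rw [Finset.sum_comm]
  refine Finset.sum_congr rfl fun x _ => Finset.sum_congr rfl fun y _ => ?_
  rw [hs]; ring

lemma cdirs_cdir (hF : ContDiff ℝ ∞ F) (l : List (ι → ℂ)) (f : ι → ℂ) :
    cdirs Y l (cdir Y f F) = cdir Y f (cdirs Y l F) := by
  induction l with
  | nil => rfl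
  | cons g l ih => rw [cdirs_cons, ih, cdirs_cons, cdir_comm (contDiff_cdirs hF l)]

lemma cdir_add_dir (f g : ι → ℂ) : cdir Y (f + g) F = cdir Y f F + cdir Y g F := by
  ext φ; simp [cdir, add_mul, Finset.sum_add_distrib]

lemma cdir_smul_dir (a : ℂ) (f : ι → ℂ) : cdir Y (a • f) F = a • cdir Y f F := by
  ext φ; simp [cdir, Finset.mul_sum, mul_assoc]

lemma cdir_add (hF : ContDiff ℝ ∞ F) (hG : ContDiff ℝ ∞ G) (f : ι → ℂ) :
    cdir Y f (F + G) = cdir Y f F + cdir Y f G := by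
  ext φ
  simp only [cdir, Pi.add_apply, ← Finset.sum_add_distrib]
  refine Finset.sum_congr rfl fun x _ => ?_
  rw [fderiv_add (hF.differentiable (by simp) φ) (hG.differentiable (by simp) φ)]
  simp [mul_add]

lemma cdir_smul (hF : ContDiff ℝ ∞ F) (a : ℂ) (f : ι → ℂ) :
    cdir Y f (a • F) = a • cdir Y f F := by
  ext φ
  simp only [cdir, Pi.smul_apply, Finset.smul_sum]
  refine Finset.sum_congr rfl fun x _ => ?_
  rw [fderiv_const_smul (hF.differentiable (by simp) φ)]
  simp; ring

lemma cdirs_add (hF : ContDiff ℝ ∞ F) (hG : ContDiff ℝ ∞ G) (l : List (ι → ℂ)) :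
    cdirs Y l (F + G) = cdirs Y l F + cdirs Y l G := by
  induction l with
  | nil => rfl
  | cons f l ih => simp [ih, cdir_add (contDiff_cdirs hF l) (contDiff_cdirs hG l)]

lemma cdirs_smul (hF : ContDiff ℝ ∞ F) (a : ℂ) (l : List (ι → ℂ)) :
    cdirs Y l (a • F) = a • cdirs Y l F := by
  induction l with
  | nil => rfl
  | cons f l ih => simp [ih, cdir_smul (contDiff_cdirs hF l)]

/-- `F` is a function of the coordinates in `Y`. -/
def SupportedOn (Y : Finset ι) (F : (ι → ℝ) → ℂ) : Prop :=
  ∀ φ ψ : ι → ℝ, (∀ x ∈ Y, φ x = ψ x) → F φ = F ψ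

lemma SupportedOn.fderiv_congr (hF : SupportedOn Y F) {φ ψ : ι → ℝ} (h : ∀ x ∈ Y, φ x = ψ x) :
    fderiv ℝ F φ = fderiv ℝ F ψ := by
  have : (fun η => F (φ + η)) = fun η => F (ψ + η) := by
    ext η; exact hF _ _ fun x hx => by simp [h x hx]
  have h1 := fderiv_comp_add_left (𝕜 := ℝ) (f := F) (x := 0) φ
  have h2 := fderiv_comp_add_left (𝕜 := ℝ) (f := F) (x := 0) ψ
  rw [add_zero] at h1 h2
  rw [← h1, ← h2, this]

lemma SupportedOn.cdir (hF : SupportedOn Y F) (f : ι → ℂ) : SupportedOn Y (cdir Y f F) := by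
  intro φ ψ h
  simp only [CoulombGas.cdir, hF.fderiv_congr h]

lemma SupportedOn.cdirs (hF : SupportedOn Y F) (l : List (ι → ℂ)) :
    SupportedOn Y (cdirs Y l F) := by
  induction l with
  | nil => exact hF
  | cons f l ih => exact ih.cdir f

lemma SupportedOn.fderiv_eq_zero (hF : SupportedOn Y F) (hd : Differentiable ℝ F) (φ : ι → ℝ)
    {x : ι} (hx : x ∉ Y) : fderiv ℝ F φ (Pi.single x 1) = 0 := by
  have h1 : HasDerivAt (fun t : ℝ => F (φ + t • Pi.single x 1))
      (fderiv ℝ F φ (Pi.single x 1)) 0 := by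
    have h0 : HasDerivAt (fun t : ℝ => φ + t • (Pi.single x 1 : ι → ℝ)) (Pi.single x 1) 0 := by
      simpa using ((hasDerivAt_id (0 : ℝ)).smul_const (Pi.single x 1 : ι → ℝ)).const_add φ
    have hF' : HasFDerivAt F (fderiv ℝ F φ) (φ + (0 : ℝ) • (Pi.single x 1 : ι → ℝ)) := by
      simpa using (hd φ).hasFDerivAt
    exact hF'.comp_hasDerivAt 0 h0
  have h2 : (fun t : ℝ => F (φ + t • Pi.single x 1)) = fun _ => F φ := by
    ext t
    refine hF _ _ fun y hy => ?_
    have : y ≠ x := fun h => hx (h ▸ hy)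
    simp [this]
  rw [h2] at h1
  exact h1.unique (hasDerivAt_const _ _)

/-- Coordinates outside `Y` contribute nothing, so that a full derivative in a real direction is of
the form measured by the norms. -/
lemma SupportedOn.fderiv_apply (hF : SupportedOn Y F) (hd : Differentiable ℝ F) (φ v : ι → ℝ) :
    fderiv ℝ F φ v = CoulombGas.cdir Y (fun x => (v x : ℂ)) F φ := by
  have hv : v = ∑ x, v x • (Pi.single x (1 : ℝ) : ι → ℝ) := by
    ext y; simp [Finset.sum_apply, Pi.single_apply]
  conv_lhs => rw [hv]
  rw [map_sum, CoulombGas.cdir]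
  refine (Finset.sum_subset_zero_on_sdiff (Finset.subset_univ Y) (fun x hx => ?_)
    fun x _ => ?_).symm
  · rw [map_smul, hF.fderiv_eq_zero hd φ (by simpa using hx), smul_zero]
  · simp

/-- `F` has charge `β`: it picks up the phase `e^{iβs}` under `φ ↦ φ + s`. -/
def HasCharge (β : ℝ) (F : (ι → ℝ) → ℂ) : Prop :=
  ∀ (φ : ι → ℝ) (s : ℝ), F (fun x => φ x + s) = Complex.exp (Complex.I * β * s) * F φ

lemma HasCharge.cdir {β : ℝ} (hF : HasCharge β F) (hd : Differentiable ℝ F) (f : ι → ℂ) :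
    HasCharge β (cdir Y f F) := by
  intro φ s
  have h : ∀ v, fderiv ℝ F (fun x => φ x + s) v =
      Complex.exp (Complex.I * β * s) * fderiv ℝ F φ v := by
    intro v
    have h1 : fderiv ℝ (fun ψ => F (ψ + fun _ => s)) φ = fderiv ℝ F (φ + fun _ => s) :=
      fderiv_comp_add_right _
    have h2 : (fun ψ => F (ψ + fun _ => s)) = fun ψ => Complex.exp (Complex.I * β * s) • F ψ := by
      ext ψ; exact hF ψ s
    rw [h2, fderiv_fun_const_smul (hd φ)] at h1
    have := congrArg (fun A => A v) h1
    rw [smul_apply, smul_eq_mul] at this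
    exact this.symm
  simp only [CoulombGas.cdir, h, Finset.mul_sum]
  exact Finset.sum_congr rfl fun x _ => by ring

lemma HasCharge.cdirs {β : ℝ} (hF : HasCharge β F) (hd : ContDiff ℝ ∞ F) (l : List (ι → ℂ)) :
    HasCharge β (cdirs Y l F) := by
  induction l with
  | nil => exact hF
  | cons f l ih => exact ih.cdir ((contDiff_cdirs hd l).differentiable (by simp)) f

/-- Differentiating the charge law at s = 0. This is why the constant part of a test function is
harmless: it costs a factor |β| but needs no derivative of `F`. -/
lemma HasCharge.cdir_one {β : ℝ} (hF : HasCharge β F) (hs : SupportedOn Y F)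
    (hd : Differentiable ℝ F) (a : ℂ) :
    CoulombGas.cdir Y (fun _ => a) F = fun φ => a * (Complex.I * β) * F φ := by
  ext φ
  have h1 : HasDerivAt (fun t : ℝ => F (φ + t • (1 : ι → ℝ))) (fderiv ℝ F φ 1) 0 := by
    have h0 : HasDerivAt (fun t : ℝ => φ + t • (1 : ι → ℝ)) 1 0 := by
      simpa using ((hasDerivAt_id (0 : ℝ)).smul_const (1 : ι → ℝ)).const_add φ
    have hF' : HasFDerivAt F (fderiv ℝ F φ) (φ + (0 : ℝ) • (1 : ι → ℝ)) := by
      simpa using (hd φ).hasFDerivAt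
    exact hF'.comp_hasDerivAt 0 h0
  have h2 : (fun t : ℝ => F (φ + t • (1 : ι → ℝ))) =
      fun t : ℝ => Complex.exp (Complex.I * β * t) * F φ := by
    ext t
    rw [← hF]
    congr 1
    ext x; simp
  rw [h2] at h1
  have h3 : HasDerivAt (fun t : ℝ => Complex.exp (Complex.I * β * t) * F φ)
      (Complex.I * β * F φ) 0 := by
    have := ((((hasDerivAt_id (0 : ℝ)).ofReal_comp).const_mul (Complex.I * β)).cexp).mul_const (F φ)
    simpa using this
  have h4 := h1.unique h3
  rw [hs.fderiv_apply hd] at h4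
  have : (fun _ : ι => a) = a • fun x : ι => (((1 : ι → ℝ) x : ℝ) : ℂ) := by ext; simp
  rw [this, cdir_smul_dir, Pi.smul_apply, h4, smul_eq_mul]
  ring

end Calculus

/-! ### Averages over shifts of the field, and differentiation under the integral -/

section Averages

open MeasureTheory

variable {ι : Type*} [Fintype ι] [DecidableEq ι] {Y : Finset ι} {F : (ι → ℝ) → ℂ}

/-- Smooth functions of the coordinates in `Y` all of whose derivatives are dominated by `g`. -/
structure IsDominated (Y : Finset ι) (g : (ι → ℝ) → ℝ) (F : (ι → ℝ) → ℂ) : Prop where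
  smooth : ContDiff ℝ ∞ F
  supported : SupportedOn Y F
  bound : ∀ l : List (ι → ℂ), ∃ B : ℝ, 0 ≤ B ∧ ∀ φ, ‖cdirs Y l F φ‖ ≤ B * g φ

variable {g : (ι → ℝ) → ℝ}

lemma IsDominated.cdir (hF : IsDominated Y g F) (f : ι → ℂ) :
    IsDominated Y g (cdir Y f F) where
  smooth := contDiff_cdir hF.smooth f
  supported := hF.supported.cdir f
  bound l := by
    obtain ⟨B, hB0, hB⟩ := hF.bound (l ++ [f])
    exact ⟨B, hB0, fun φ => by simpa [cdirs_append] using hB φ⟩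

lemma IsDominated.cdirs (hF : IsDominated Y g F) (l : List (ι → ℂ)) :
    IsDominated Y g (cdirs Y l F) := by
  induction l with
  | nil => exact hF
  | cons f l ih => exact ih.cdir f

/-- Expand the direction in coordinates: only those in `Y` matter, and the derivative in each of
them is dominated by hypothesis. -/
lemma IsDominated.norm_fderiv_le (hF : IsDominated Y g F) :
    ∃ B : ℝ, 0 ≤ B ∧ ∀ φ, ‖fderiv ℝ F φ‖ ≤ B * g φ := by
  choose B hB0 hB using fun x : ι => hF.bound [fun y => if y = x then 1 else 0]
  refine ⟨∑ x ∈ Y, B x, Finset.sum_nonneg fun x _ => hB0 x, fun φ => ?_⟩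
  have hx : ∀ x ∈ Y, ‖fderiv ℝ F φ (Pi.single x 1)‖ ≤ B x * g φ := fun x hx => by
    have := hB x φ
    simpa [CoulombGas.cdir, hx] using this
  have h0 : 0 ≤ ∑ x ∈ Y, B x * g φ := Finset.sum_nonneg fun x h => (norm_nonneg _).trans (hx x h)
  rw [Finset.sum_mul]
  refine ContinuousLinearMap.opNorm_le_bound _ h0 fun v => ?_
  rw [hF.supported.fderiv_apply (hF.smooth.differentiable (by simp)), CoulombGas.cdir,
    Finset.sum_mul]
  refine norm_sum_le_of_le _ fun x h => ?_
  rw [norm_mul, mul_comm]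
  refine mul_le_mul (hx x h) ?_ (norm_nonneg _) ((norm_nonneg _).trans (hx x h))
  simpa using norm_le_pi_norm v x

variable {T : Type*} [MeasurableSpace T]

/-- `φ ↦ ∫ c(t) F(φ + u(t)) dν(t)`. -/
noncomputable def shiftAvg (ν : Measure T) (c : T → ℂ) (u : T → ι → ℝ) (F : (ι → ℝ) → ℂ)
    (φ : ι → ℝ) : ℂ :=
  ∫ t, c t * F (fun x => φ x + u t x) ∂ν

/-- The conditions under which `shiftAvg ν c u` acts on functions dominated by `g`. -/
structure IsShiftBound (ν : Measure T) (c : T → ℂ) (u : T → ι → ℝ) (g g₂ : (ι → ℝ) → ℝ)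
    (W : T → ℝ) : Prop where
  measurable_coeff : AEStronglyMeasurable c ν
  norm_coeff_le : ∀ t, ‖c t‖ ≤ 1
  measurable_shift : Measurable u
  integrable_weight : Integrable W ν
  weight_nonneg : ∀ t, 0 ≤ W t
  bound : ∀ φ t, g (fun x => φ x + u t x) ≤ g₂ φ * W t
  locally_bounded : ∀ φ, ∃ C, ∀ ψ ∈ Metric.ball φ 1, g₂ ψ ≤ C

variable {ν : Measure T} {c : T → ℂ} {u : T → ι → ℝ} {g₂ : (ι → ℝ) → ℝ} {W : T → ℝ}

lemma IsShiftBound.aestronglyMeasurable (hT : IsShiftBound ν c u g g₂ W) {E : Type*}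
    [NormedAddCommGroup E] {H : (ι → ℝ) → E} (hH : Continuous H)
    [NormedSpace ℂ E] (φ : ι → ℝ) :
    AEStronglyMeasurable (fun t => c t • H (fun x => φ x + u t x)) ν := by
  refine hT.measurable_coeff.smul ?_
  have hm : Measurable fun t => (fun x => φ x + u t x) :=
    measurable_pi_lambda _ fun x => ((measurable_pi_apply x).comp hT.measurable_shift).const_add _
  exact (hH.stronglyMeasurable.comp_measurable hm).aestronglyMeasurable

lemma IsShiftBound.integrable_of_le (hT : IsShiftBound ν c u g g₂ W) {E : Type*}
    [NormedAddCommGroup E] [NormedSpace ℂ E] {H : (ι → ℝ) → E} (hH : Continuous H)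
    {B : ℝ} (hB0 : 0 ≤ B) (hB : ∀ φ, ‖H φ‖ ≤ B * g φ) (φ : ι → ℝ) :
    Integrable (fun t => c t • H (fun x => φ x + u t x)) ν := by
  refine Integrable.mono' (hT.integrable_weight.const_mul (B * g₂ φ))
    (hT.aestronglyMeasurable hH φ) (ae_of_all _ fun t => ?_)
  rw [norm_smul]
  calc ‖c t‖ * ‖H fun x => φ x + u t x‖ ≤ 1 * (B * g fun x => φ x + u t x) := by
        gcongr
        · exact hT.norm_coeff_le t
        · exact hB _
    _ ≤ B * (g₂ φ * W t) := by rw [one_mul]; gcongr; exact hT.bound φ t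
    _ = B * g₂ φ * W t := by ring

lemma IsShiftBound.integrable (hT : IsShiftBound ν c u g g₂ W) (hF : IsDominated Y g F)
    (φ : ι → ℝ) : Integrable (fun t => c t * F (fun x => φ x + u t x)) ν := by
  obtain ⟨B, hB0, hB⟩ := hF.bound []
  exact hT.integrable_of_le hF.smooth.continuous hB0 hB φ

lemma IsShiftBound.integrable_fderiv (hT : IsShiftBound ν c u g g₂ W) (hF : IsDominated Y g F)
    (φ : ι → ℝ) : Integrable (fun t => c t • fderiv ℝ F (fun x => φ x + u t x)) ν := by
  obtain ⟨B, hB0, hB⟩ := hF.norm_fderiv_le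
  exact hT.integrable_of_le (hF.smooth.continuous_fderiv (by simp)) hB0 hB φ

lemma IsShiftBound.hasFDerivAt (hT : IsShiftBound ν c u g g₂ W) (hF : IsDominated Y g F)
    (φ : ι → ℝ) :
    HasFDerivAt (shiftAvg ν c u F) (∫ t, c t • fderiv ℝ F (fun x => φ x + u t x) ∂ν) φ := by
  obtain ⟨B, hB0, hB⟩ := hF.norm_fderiv_le
  obtain ⟨C, hC⟩ := hT.locally_bounded φ
  -- An integrable dominating function that is uniform on the unit ball around φ: `g₂` is bounded
  -- there and the dependence on t sits in the weight `W`.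
  have h1 : ∀ᵐ t ∂ν, ∀ ψ ∈ Metric.ball φ 1,
      ‖c t • fderiv ℝ F (fun x => ψ x + u t x)‖ ≤ B * C * W t := by
    refine ae_of_all _ fun t ψ hψ => ?_
    rw [norm_smul]
    calc ‖c t‖ * ‖fderiv ℝ F fun x => ψ x + u t x‖ ≤ 1 * (B * g fun x => ψ x + u t x) := by
          gcongr
          · exact hT.norm_coeff_le t
          · exact hB _
      _ ≤ B * (g₂ ψ * W t) := by rw [one_mul]; gcongr; exact hT.bound ψ t
      _ ≤ B * (C * W t) := by
          have := hT.weight_nonneg t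
          gcongr; exact hC ψ hψ
      _ = B * C * W t := by ring
  have h2 : ∀ᵐ t ∂ν, ∀ ψ ∈ Metric.ball φ 1,
      HasFDerivAt (fun ψ : ι → ℝ => c t * F (fun x => ψ x + u t x))
        (c t • fderiv ℝ F (fun x => ψ x + u t x)) ψ := by
    refine ae_of_all _ fun t ψ _ => ?_
    have h1 : HasFDerivAt (fun ψ : ι → ℝ => F (fun x => ψ x + u t x))
        (fderiv ℝ F (fun x => ψ x + u t x)) ψ :=
      (hasFDerivAt_comp_add_right (u t)).2
        (hF.smooth.differentiable (by simp) (ψ + u t)).hasFDerivAt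
    exact h1.const_mul (c t)
  have h3 : ∀ᶠ ψ in nhds φ, AEStronglyMeasurable (fun t => c t * F (fun x => ψ x + u t x)) ν :=
    Filter.Eventually.of_forall fun ψ => (hT.integrable hF ψ).aestronglyMeasurable
  have h4 := (hT.integrable_fderiv hF φ).aestronglyMeasurable
  have h5 := hT.integrable hF φ
  have h6 := hT.integrable_weight.const_mul (B * C)
  have h7 := Metric.ball_mem_nhds φ one_pos
  obtain ⟨Φ, hΦ⟩ : ∃ Φ : (ι → ℝ) → T → ℂ, Φ = fun ψ t => c t * F (fun x => ψ x + u t x) :=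
    ⟨_, rfl⟩
  obtain ⟨Φ', hΦ'⟩ : ∃ Φ' : (ι → ℝ) → T → (ι → ℝ) →L[ℝ] ℂ,
    Φ' = fun ψ t => c t • fderiv ℝ F (fun x => ψ x + u t x) := ⟨_, rfl⟩
  have g1 : ∀ᵐ t ∂ν, ∀ ψ ∈ Metric.ball φ 1, ‖Φ' ψ t‖ ≤ B * C * W t := by rw [hΦ']; exact h1
  have g2 : ∀ᵐ t ∂ν, ∀ ψ ∈ Metric.ball φ 1, HasFDerivAt (Φ · t) (Φ' ψ t) ψ := by
    rw [hΦ', hΦ]; exact h2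
  have g3 : ∀ᶠ ψ in nhds φ, AEStronglyMeasurable (Φ ψ) ν := by rw [hΦ]; exact h3
  have g4 : AEStronglyMeasurable (Φ' φ) ν := by rw [hΦ']; exact h4
  have g5 : Integrable (Φ φ) ν := by rw [hΦ]; exact h5
  have := hasFDerivAt_integral_of_dominated_of_fderiv_le (𝕜 := ℝ) h7 g3 g5 g4 g1 h6 g2
  rw [hΦ', hΦ] at this
  exact this

lemma IsShiftBound.cdir_shiftAvg (hT : IsShiftBound ν c u g g₂ W) (hF : IsDominated Y g F)
    (f : ι → ℂ) : cdir Y f (shiftAvg ν c u F) = shiftAvg ν c u (cdir Y f F) := by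
  ext φ
  have hi : ∀ v : ι → ℝ, Integrable (fun t => c t * fderiv ℝ F (fun x => φ x + u t x) v) ν :=
    fun v => by
      have := (hT.integrable_fderiv hF φ).apply_continuousLinearMap v
      simpa using this
  have h : ∀ v : ι → ℝ, fderiv ℝ (shiftAvg ν c u F) φ v =
      ∫ t, c t * fderiv ℝ F (fun x => φ x + u t x) v ∂ν := fun v => by
    rw [(hT.hasFDerivAt hF φ).fderiv,
      ContinuousLinearMap.integral_apply (hT.integrable_fderiv hF φ)]
    simp
  simp only [cdir, shiftAvg, h]
  simp_rw [Finset.mul_sum]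
  rw [integral_finsetSum]
  · refine Finset.sum_congr rfl fun x _ => ?_
    rw [← integral_const_mul]
    congr 1; ext t; ring
  · intro x _
    refine ((hi (Pi.single x 1)).const_mul (f x)).congr (ae_of_all _ fun t => ?_)
    simp only; ring

lemma IsShiftBound.cdirs_shiftAvg (hT : IsShiftBound ν c u g g₂ W) (hF : IsDominated Y g F)
    (l : List (ι → ℂ)) : cdirs Y l (shiftAvg ν c u F) = shiftAvg ν c u (cdirs Y l F) := by
  induction l with
  | nil => rfl
  | cons f l ih => rw [cdirs_cons, ih, hT.cdir_shiftAvg (hF.cdirs l), cdirs_cons]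

lemma IsShiftBound.supportedOn (hF : SupportedOn Y F) : SupportedOn Y (shiftAvg ν c u F) := by
  intro φ ψ h
  simp only [shiftAvg]
  congr 1; ext t
  rw [hF _ (fun x => ψ x + u t x) fun x hx => by rw [h x hx]]

/-- Induction on the order with `F` arbitrary: a directional derivative of the average is the
average of a directional derivative of `F`, which is dominated by the same `g`. -/
lemma IsShiftBound.contDiff (hT : IsShiftBound ν c u g g₂ W) (hF : IsDominated Y g F) :
    ContDiff ℝ ∞ (shiftAvg ν c u F) := by
  rw [contDiff_infty]
  intro n
  induction n generalizing F with
  | zero =>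
    exact contDiff_zero.2 (continuous_iff_continuousAt.2 fun φ =>
      (hT.hasFDerivAt hF φ).continuousAt)
  | succ n ih =>
    have hd : Differentiable ℝ (shiftAvg ν c u F) :=
      fun φ => (hT.hasFDerivAt hF φ).differentiableAt
    rw [Nat.cast_succ, contDiff_succ_iff_fderiv_apply]
    refine ⟨hd, fun h => absurd h (by simp), fun y => ?_⟩
    have : (fun φ => fderiv ℝ (shiftAvg ν c u F) φ y) =
        shiftAvg ν c u (CoulombGas.cdir Y (fun x => (y x : ℂ)) F) := by
      rw [← hT.cdir_shiftAvg hF]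
      ext φ
      exact (supportedOn hF.supported).fderiv_apply hd φ y
    rw [this]
    exact ih (hF.cdir _)

end Averages

/-! ### The norms on polymer activities and the splitting of test functions -/

section TestFunctionNorms

variable {L R : ℕ} [NeZero L] {Y : Finset (Site L R)} {F G : (Site L R → ℝ) → ℂ}

lemma sum_piFinset_succ {α M : Type*} [AddCommMonoid M] [DecidableEq α] (Y : Finset α) (n : ℕ)
    (f : (Fin (n + 1) → α) → M) :
    ∑ x ∈ Fintype.piFinset (fun _ : Fin (n + 1) => Y), f x =
      ∑ a ∈ Y, ∑ x ∈ Fintype.piFinset (fun _ : Fin n => Y), f (Fin.cons a x) := by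
  rw [← Finset.sum_product']
  refine Finset.sum_nbij' (fun x => (x 0, Fin.tail x)) (fun p => Fin.cons p.1 p.2) ?_ ?_ ?_ ?_ ?_
  · intro x hx
    rw [Fintype.mem_piFinset] at hx
    simpa [Fintype.mem_piFinset] using ⟨hx 0, fun i => hx i.succ⟩
  · intro p hp
    rw [Finset.mem_product, Fintype.mem_piFinset] at hp
    rw [Fintype.mem_piFinset]
    intro i
    refine Fin.cases ?_ (fun i => ?_) i
    · simpa using hp.1
    · simpa using hp.2 i
  · intro x _; simp
  · intro p _; simp
  · intro x _; simp

/-- Links the multilinear derivatives in the definition of the norm with iterated one-directional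
derivatives, for which commutation and splitting of directions are easy to express. -/
lemma dirDeriv_eq_cdirs (hF : ContDiff ℝ ∞ F) (n : ℕ) (f : Fin n → Site L R → ℂ)
    (φ : Site L R → ℝ) : dirDeriv Y n F φ f = cdirs Y (List.ofFn f) F φ := by
  induction n generalizing φ with
  | zero => simp [dirDeriv]
  | succ n ih =>
    rw [List.ofFn_succ, cdirs_cons]
    have hfun : cdirs Y (List.ofFn fun i => f i.succ) F =
        fun φ => dirDeriv Y n F φ fun i => f i.succ := by
      ext ψ; rw [ih]
    have hd : DifferentiableAt ℝ (iteratedFDeriv ℝ n F) φ :=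
      (hF.differentiable_iteratedFDeriv (m := n) (by exact_mod_cast WithTop.coe_lt_top _)) φ
    have hder : ∀ v, fderiv ℝ (fun φ => dirDeriv Y n F φ fun i => f i.succ) φ v =
        ∑ x ∈ Fintype.piFinset (fun _ : Fin n => Y), (∏ i, f i.succ (x i)) *
          (fderiv ℝ (iteratedFDeriv ℝ n F) φ v) (fun i => Pi.single (x i) 1) := by
      intro v
      have h1 : ∀ m : Fin n → Site L R → ℝ, HasFDerivAt (fun φ => iteratedFDeriv ℝ n F φ m)
          ((ContinuousMultilinearMap.apply ℝ (fun _ : Fin n => Site L R → ℝ) ℂ m).comp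
            (fderiv ℝ (iteratedFDeriv ℝ n F) φ)) φ := fun m =>
        (ContinuousMultilinearMap.apply ℝ (fun _ : Fin n => Site L R → ℝ) ℂ m).hasFDerivAt.comp φ
          hd.hasFDerivAt
      have h2 : HasFDerivAt (fun φ => dirDeriv Y n F φ fun i => f i.succ)
          (∑ x ∈ Fintype.piFinset (fun _ : Fin n => Y), (∏ i, f i.succ (x i)) •
            ((ContinuousMultilinearMap.apply ℝ (fun _ : Fin n => Site L R → ℝ) ℂ
              (fun i => Pi.single (x i) 1)).comp (fderiv ℝ (iteratedFDeriv ℝ n F) φ))) φ := by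
        unfold dirDeriv
        exact HasFDerivAt.fun_sum fun x _ => (h1 _).const_mul _
      rw [h2.fderiv]
      simp
    rw [hfun, cdir, dirDeriv, sum_piFinset_succ]
    refine Finset.sum_congr rfl fun a _ => ?_
    rw [hder, Finset.mul_sum]
    refine Finset.sum_congr rfl fun x _ => ?_
    rw [Fin.prod_univ_succ, iteratedFDeriv_succ_apply_left]
    simp only [Fin.cons_zero, Fin.cons_succ, mul_assoc]
    congr 1

lemma enorm_cdirs_le_tnNorm (hF : ContDiff ℝ ∞ F) {k : ℕ} {φ : Site L R → ℝ}
    {l : List (Site L R → ℂ)} (hl : ∀ f ∈ l, c2Norm k Y f ≤ 1) :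
    ‖cdirs Y l F φ‖ₑ ≤ tnNorm k Y l.length F φ := by
  have h := dirDeriv_eq_cdirs (Y := Y) hF l.length l.get φ
  rw [List.ofFn_get] at h
  rw [← h, tnNorm]
  exact le_iSup₂_of_le l.get (fun i => hl _ (List.get_mem l i)) le_rfl

lemma tnNorm_le (hF : ContDiff ℝ ∞ F) {k n : ℕ} {φ : Site L R → ℝ} {B : ℝ≥0∞}
    (h : ∀ l : List (Site L R → ℂ), l.length = n → (∀ f ∈ l, c2Norm k Y f ≤ 1) →
      ‖cdirs Y l F φ‖ₑ ≤ B) : tnNorm k Y n F φ ≤ B := by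
  refine iSup₂_le fun f hf => ?_
  rw [dirDeriv_eq_cdirs hF]
  refine h _ (by simp) fun g hg => ?_
  obtain ⟨i, rfl⟩ := List.mem_ofFn.1 hg
  exact hf i

lemma latticeDeriv_smul {A E 𝕜 : Type*} [Ring A] [AddCommGroup E] [Ring 𝕜] [Module 𝕜 E]
    (a : 𝕜) (l : List (Fin 4)) (f : A × A → E) :
    latticeDeriv l (a • f) = a • latticeDeriv l f := by
  induction l with
  | nil => rfl
  | cons μ l ih => ext x; simp [latticeDeriv, ih, smul_sub]

lemma gradSup_smul (a : ℂ) (k n : ℕ) (f : Site L R → ℂ) :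
    gradSup k n Y (a • f) = ‖a‖₊ * gradSup k n Y f := by
  simp only [gradSup, NNReal.mul_finset_sup, latticeDeriv_smul, Pi.smul_apply, nnnorm_smul]
  congr 1; ext μ : 1; congr 1; ext x; push_cast; ring

lemma c2Norm_smul (a : ℂ) (k : ℕ) (f : Site L R → ℂ) :
    c2Norm k Y (a • f) = ‖a‖₊ * c2Norm k Y f := by
  simp only [c2Norm, NNReal.mul_finset_sup, gradSup_smul]

/-- Rescale `f` to unit norm. The positive bound `ε` is used in place of the norm itself, which may
vanish. -/
lemma tnNorm_cdir_le (hF : ContDiff ℝ ∞ F) {k n : ℕ} {φ : Site L R → ℝ} {f : Site L R → ℂ}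
    {ε : ℝ≥0} (hε : ε ≠ 0) (hf : c2Norm k Y f ≤ ε) :
    tnNorm k Y n (cdir Y f F) φ ≤ ε * tnNorm k Y (n + 1) F φ := by
  refine tnNorm_le (contDiff_cdir hF f) fun l hl hl1 => ?_
  have hg : c2Norm k Y (((ε : ℝ) : ℂ)⁻¹ • f) ≤ 1 := by
    rw [c2Norm_smul, nnnorm_inv]
    calc _ = ε⁻¹ * c2Norm k Y f := by
          congr 2; ext; simp
      _ ≤ ε⁻¹ * ε := by gcongr
      _ = 1 := inv_mul_cancel₀ hε
  have hfe : f = ((ε : ℝ) : ℂ) • (((ε : ℝ) : ℂ)⁻¹ • f) := by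
    rw [smul_smul, mul_inv_cancel₀ (by exact_mod_cast hε), one_smul]
  have h1 : cdirs Y l (cdir Y f F) = ((ε : ℝ) : ℂ) •
      cdirs Y ((((ε : ℝ) : ℂ)⁻¹ • f) :: l) F := by
    rw [cdirs_cons, cdirs_cdir hF]
    conv_lhs => rw [hfe]
    rw [cdir_smul_dir]
  rw [h1, Pi.smul_apply, enorm_smul]
  have h2 : ‖((ε : ℝ) : ℂ)‖ₑ = ε := by
    rw [enorm_eq_nnnorm]; congr 1; ext; simp
  rw [h2]
  gcongr
  have := enorm_cdirs_le_tnNorm (Y := Y) (φ := φ) hF (k := k) (l := (((ε : ℝ) : ℂ)⁻¹ • f) :: l)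
    (by simpa using ⟨hg, hl1⟩)
  simpa [hl] using this

lemma tnNorm_cdirs_replicate_le (hF : ContDiff ℝ ∞ F) {k : ℕ} (n m : ℕ) {φ : Site L R → ℝ}
    {f : Site L R → ℂ} {ε : ℝ≥0} (hε : ε ≠ 0) (hf : c2Norm k Y f ≤ ε) :
    tnNorm k Y n (cdirs Y (List.replicate m f) F) φ ≤ ε ^ m * tnNorm k Y (n + m) F φ := by
  induction m generalizing n with
  | zero => simp
  | succ m ih =>
    rw [List.replicate_succ, cdirs_cons]
    refine (tnNorm_cdir_le (contDiff_cdirs hF _) hε hf).trans ?_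
    rw [pow_succ', mul_assoc]
    gcongr
    rw [show n + (m + 1) = n + 1 + m by ring]
    exact ih _

lemma tnNorm_zero (φ : Site L R → ℝ) (k : ℕ) (hF : ContDiff ℝ ∞ F) :
    tnNorm k Y 0 F φ = ‖F φ‖ₑ := by
  refine le_antisymm (tnNorm_le hF fun l hl _ => ?_) ?_
  · rw [List.length_eq_zero_iff.1 hl]; rfl
  · exact enorm_cdirs_le_tnNorm hF (l := []) (by simp)

lemma tNorm_add_le (hF : ContDiff ℝ ∞ F) (hG : ContDiff ℝ ∞ G) (h : ℝ) (k : ℕ)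
    (φ : Site L R → ℝ) : tNorm h k Y (F + G) φ ≤ tNorm h k Y F φ + tNorm h k Y G φ := by
  rw [tNorm, tNorm, tNorm, ← ENNReal.tsum_add]
  refine ENNReal.tsum_le_tsum fun n => ?_
  rw [← mul_add]
  gcongr
  refine tnNorm_le (F := F + G) (hF.add hG) fun l hl hl1 => ?_
  rw [cdirs_add hF hG, Pi.add_apply]
  refine (enorm_add_le _ _).trans (add_le_add ?_ ?_)
  · exact hl ▸ enorm_cdirs_le_tnNorm hF hl1
  · exact hl ▸ enorm_cdirs_le_tnNorm hG hl1

lemma tNorm_smul_le (hF : ContDiff ℝ ∞ F) (a : ℂ) (h : ℝ) (k : ℕ)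
    (φ : Site L R → ℝ) : tNorm h k Y (a • F) φ ≤ ‖a‖ₑ * tNorm h k Y F φ := by
  rw [tNorm, tNorm, ← ENNReal.tsum_mul_left]
  refine ENNReal.tsum_le_tsum fun n => ?_
  rw [mul_left_comm]
  gcongr
  refine tnNorm_le (F := a • F) (contDiff_const.smul hF) fun l hl hl1 => ?_
  rw [cdirs_smul hF, Pi.smul_apply, enorm_smul]
  gcongr
  exact hl ▸ enorm_cdirs_le_tnNorm hF hl1

lemma tNorm_sum_le {κ : Type*} (s : Finset κ) {F : κ → (Site L R → ℝ) → ℂ}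
    (hF : ∀ i ∈ s, ContDiff ℝ ∞ (F i)) (h : ℝ) (k : ℕ) (φ : Site L R → ℝ) :
    tNorm h k Y (∑ i ∈ s, F i) φ ≤ ∑ i ∈ s, tNorm h k Y (F i) φ := by
  classical
  induction s using Finset.induction_on with
  | empty =>
    have h0 : ContDiff ℝ ∞ (0 : (Site L R → ℝ) → ℂ) := contDiff_const
    simpa using tNorm_smul_le (Y := Y) h0 0 h k φ
  | insert a s ha ih =>
    rw [Finset.sum_insert ha, Finset.sum_insert ha]
    refine (tNorm_add_le (hF a (Finset.mem_insert_self a s)) ?_ h k φ).trans ?_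
    · have : (∑ i ∈ s, F i) = fun φ => ∑ i ∈ s, F i φ := by ext; simp
      rw [this]
      exact ContDiff.sum fun i hi => hF i (Finset.mem_insert_of_mem hi)
    · gcongr
      exact ih fun i hi => hF i (Finset.mem_insert_of_mem hi)

/-- Cauchy product; with values in `ℝ≥0∞` no summability is required. -/
lemma tsum_antidiagonal (f : ℕ → ℕ → ℝ≥0∞) :
    ∑' n, ∑ p ∈ Finset.HasAntidiagonal.antidiagonal n, f p.1 p.2 = ∑' i, ∑' m, f i m := by
  rw [← ENNReal.tsum_prod, ← Finset.HasAntidiagonal.sigmaAntidiagonalEquivProd.tsum_eq, ENNReal.tsum_sigma']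
  refine tsum_congr fun n => ?_
  rw [tsum_fintype, ← Finset.sum_coe_sort]
  rfl

/-- Splitting the test functions into their value at `x₀` and the remainder: the norm on a
coarser scale of a function of charge `β` is controlled by derivatives in directions that vanish
at `x₀`. -/
lemma tNorm_le_of_hasCharge (hF : ContDiff ℝ ∞ F) (hs : SupportedOn Y F) {β : ℝ}
    (hβ : HasCharge β F) {k k' : ℕ} {x₀ : Site L R} {ε : ℝ≥0} (hε : ε ≠ 0)
    (hδ : ∀ f : Site L R → ℂ, c2Norm k' Y f ≤ 1 →
      ‖f x₀‖ ≤ 1 ∧ c2Norm k Y (fun x => f x - f x₀) ≤ ε)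
    {h : ℝ} (hh : 0 ≤ h) (φ : Site L R → ℝ) (t : ℕ → ℝ≥0∞)
    (ht : ∀ l : List (Site L R → ℂ), (∀ f ∈ l, c2Norm k Y f ≤ 1 ∧ f x₀ = 0) →
      ‖cdirs Y l F φ‖ₑ ≤ t l.length) :
    tNorm h k' Y F φ ≤ ENNReal.ofReal (Real.exp (|β| * h)) *
      ∑' m : ℕ, ENNReal.ofReal ((h * ε) ^ m / m.factorial) * t m := by
  -- Induction over the test functions of the coarse scale. The list `l'` collects the directions
  -- vanishing at `x₀` that have been split off already; it has to be arbitrary because each step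
  -- may lengthen it.
  have key : ∀ (l : List (Site L R → ℂ)), (∀ f ∈ l, c2Norm k' Y f ≤ 1) →
      ∀ l' : List (Site L R → ℂ), (∀ f ∈ l', c2Norm k Y f ≤ 1 ∧ f x₀ = 0) →
      ‖cdirs Y l (cdirs Y l' F) φ‖ₑ ≤
        ∑ p ∈ Finset.HasAntidiagonal.antidiagonal l.length, (l.length.choose p.1 : ℝ≥0∞) *
          (ENNReal.ofReal |β| ^ p.1 * (ε ^ p.2 * t (p.2 + l'.length))) := by
    intro l
    induction l with
    | nil => intro _ l' hl'; simpa using ht l' hl'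
    | cons f l ih =>
      intro hl l' hl'
      have hl1 : ∀ g ∈ l, c2Norm k' Y g ≤ 1 := fun g hg => hl g (List.mem_cons_of_mem _ hg)
      obtain ⟨hf0, hfδ⟩ := hδ f (hl f List.mem_cons_self)
      have hc : ContDiff ℝ ∞ (cdirs Y l' F) := contDiff_cdirs hF l'
      set δ : Site L R → ℂ := fun x => f x - f x₀ with hδdef
      set η : Site L R → ℂ := ((ε : ℝ) : ℂ)⁻¹ • δ with hη
      have hηδ : δ = ((ε : ℝ) : ℂ) • η := by
        rw [hη, smul_smul, mul_inv_cancel₀ (by exact_mod_cast hε), one_smul]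
      have hη1 : c2Norm k Y η ≤ 1 := by
        rw [hη, c2Norm_smul, nnnorm_inv]
        calc _ = ε⁻¹ * c2Norm k Y δ := by congr 2; ext; simp
          _ ≤ ε⁻¹ * ε := by gcongr
          _ = 1 := inv_mul_cancel₀ hε
      -- Here f = f(x₀) + εη: the constant acts as the number f(x₀)iβ, and η, which vanishes at `x₀`
      -- and has norm at most one on the fine scale, joins `l'`. The two terms are the two branches
      -- of Pascal's rule.
      have hsplit : cdirs Y (f :: l) (cdirs Y l' F) =
          (fun φ => f x₀ * (Complex.I * β) * cdirs Y l (cdirs Y l' F) φ) +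
            ((ε : ℝ) : ℂ) • cdirs Y l (cdirs Y (η :: l') F) := by
        rw [cdirs_cons, cdirs_cons, cdirs_cdir hc, ← cdir_smul_dir, ← hηδ,
          ← ((hβ.cdirs hF l').cdirs hc l).cdir_one ((hs.cdirs l').cdirs l)
            ((contDiff_cdirs hc l).differentiable (by simp)), ← cdir_add_dir]
        congr 1
        ext x; simp [hδdef]
      have h1 := ih hl1 l' hl'
      have h2 := ih hl1 (η :: l') (by
        intro g hg
        rcases List.mem_cons.1 hg with rfl | hg
        · exact ⟨hη1, by simp [hη, hδdef]⟩
        · exact hl' g hg)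
      rw [hsplit, Pi.add_apply, Pi.smul_apply, List.length_cons]
      have hsum := Finset.sum_antidiagonal_choose_succ_mul
        (fun i m => ENNReal.ofReal |β| ^ i * ((ε : ℝ≥0∞) ^ m * t (m + l'.length))) l.length
      rw [hsum, add_comm]
      refine (enorm_add_le _ _).trans (add_le_add ?_ ?_)
      · rw [enorm_smul]
        have h3 : ‖((ε : ℝ) : ℂ)‖ₑ = ε := by
          rw [enorm_eq_nnnorm]; congr 1; ext; simp
        rw [h3]
        refine (mul_le_mul_right h2 _).trans (le_of_eq ?_)
        rw [Finset.mul_sum]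
        refine Finset.sum_congr rfl fun p hp => ?_
        rw [List.length_cons,
          show p.2 + (l'.length + 1) = p.2 + 1 + l'.length by ring]
        ring
      · rw [enorm_mul]
        have h3 : ‖f x₀ * (Complex.I * β)‖ₑ ≤ ENNReal.ofReal |β| := by
          rw [← ofReal_norm]
          refine ENNReal.ofReal_le_ofReal ?_
          rw [norm_mul, norm_mul, Complex.norm_I, one_mul, Complex.norm_real, Real.norm_eq_abs]
          exact mul_le_of_le_one_left (abs_nonneg _) hf0
        refine (mul_le_mul' h3 h1).trans (le_of_eq ?_)
        rw [Finset.mul_sum]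
        refine Finset.sum_congr rfl fun p hp => ?_
        rw [← Finset.HasAntidiagonal.mem_antidiagonal.1 hp, Nat.choose_symm_add]
        ring
  have hn : ∀ n, tnNorm k' Y n F φ ≤ ∑ p ∈ Finset.HasAntidiagonal.antidiagonal n, (n.choose p.1 : ℝ≥0∞) *
      (ENNReal.ofReal |β| ^ p.1 * (ε ^ p.2 * t p.2)) := fun n =>
    tnNorm_le hF fun l hl hl1 => by
      have := key l hl1 [] (by simp)
      simpa [hl] using this
  calc tNorm h k' Y F φ
      ≤ ∑' n : ℕ, ∑ p ∈ Finset.HasAntidiagonal.antidiagonal n,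
        ENNReal.ofReal ((|β| * h) ^ p.1 / p.1.factorial) *
          (ENNReal.ofReal ((h * ε) ^ p.2 / p.2.factorial) * t p.2) := by
        refine ENNReal.tsum_le_tsum fun n => ?_
        refine (mul_le_mul_right (hn n) _).trans (le_of_eq ?_)
        rw [Finset.mul_sum]
        refine Finset.sum_congr rfl fun p hp => ?_
        have hb := abs_nonneg β
        have e1 : (n.choose p.1 : ℝ≥0∞) = ENNReal.ofReal (n.choose p.1 : ℝ) := by simp
        have e2 : (ε : ℝ≥0∞) = ENNReal.ofReal ε := by simp
        rw [← mul_assoc, ← mul_assoc, ← mul_assoc, ← mul_assoc, e1, e2,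
          ← ENNReal.ofReal_pow hb, ← ENNReal.ofReal_pow (NNReal.coe_nonneg ε),
          ← ENNReal.ofReal_mul (by positivity), ← ENNReal.ofReal_mul (by positivity),
          ← ENNReal.ofReal_mul (by positivity), ← ENNReal.ofReal_mul (by positivity)]
        -- The weight hⁿ/n! times the binomial coefficient factors into (|β|h)^i/i! and (hε)^m/m!;
        -- the sum over i gives the exponential.
        congr 2
        rw [← Finset.HasAntidiagonal.mem_antidiagonal.1 hp, Nat.choose_symm_add, Nat.add_choose, Nat.cast_div
          (Nat.factorial_mul_factorial_dvd_factorial_add _ _) (by positivity)]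
        push_cast
        field_simp
        ring
    _ = (∑' i : ℕ, ENNReal.ofReal ((|β| * h) ^ i / i.factorial)) *
        ∑' m : ℕ, ENNReal.ofReal ((h * ε) ^ m / m.factorial) * t m := by
        rw [tsum_antidiagonal fun i m => ENNReal.ofReal ((|β| * h) ^ i / i.factorial) *
          (ENNReal.ofReal ((h * ε) ^ m / m.factorial) * t m)]
        simp_rw [ENNReal.tsum_mul_left, ENNReal.tsum_mul_right]
    _ = _ := by
        congr 1
        rw [← ENNReal.ofReal_tsum_of_nonneg (fun i => by positivity)
          (Real.summable_pow_div_factorial _)]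
        congr 1
        rw [Real.exp_eq_exp_ℝ, NormedSpace.exp_eq_tsum_div]

end TestFunctionNorms

/-! ### One-dimensional Gaussian integrals -/

section GaussianOneDim
open MeasureTheory ProbabilityTheory

/-- Gaussian integration by parts in one variable. -/
lemma integral_mul_gaussianReal {v : ℝ≥0} (hv : v ≠ 0) {k k' : ℝ → ℂ}
    (hk : ∀ s, HasDerivAt k (k' s) s)
    (h0 : Integrable k (gaussianReal 0 v))
    (h1 : Integrable (fun s : ℝ => (s : ℂ) * k s) (gaussianReal 0 v))
    (h2 : Integrable k' (gaussianReal 0 v)) :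
    ∫ s, (s : ℂ) * k s ∂(gaussianReal 0 v) = (v : ℂ) * ∫ s, k' s ∂(gaussianReal 0 v) := by
  have hv' : (v : ℝ) ≠ 0 := by exact_mod_cast hv
  have hint : ∀ {f : ℝ → ℂ}, Integrable f (gaussianReal 0 v) →
      Integrable (fun s => gaussianPDFReal 0 v s • f s) := by
    intro f hf
    rw [gaussianReal_of_var_ne_zero _ hv, integrable_withDensity_iff_integrable_smul'
      (measurable_gaussianPDF 0 v) (ae_of_all _ fun _ => gaussianPDF_lt_top)] at hf
    simpa [toReal_gaussianPDF] using hf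
  rw [integral_gaussianReal_eq_integral_smul hv, integral_gaussianReal_eq_integral_smul hv]
  have hpdf : ∀ s, HasDerivAt (gaussianPDFReal 0 v) (-(s / v) * gaussianPDFReal 0 v s) s := by
    intro s
    have h : HasDerivAt (fun x : ℝ => -(x - 0) ^ 2 / (2 * v)) (-(s / v)) s := by
      have := ((((hasDerivAt_id s).sub_const 0).pow 2).neg).div_const (2 * (v : ℝ))
      refine this.congr_deriv ?_
      simp; field_simp
    have h2 := (h.exp).const_mul (√(2 * Real.pi * v))⁻¹
    refine h2.congr_deriv ?_
    simp only [gaussianPDFReal_def]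
    ring
  have hd : ∀ s, HasDerivAt (fun s => gaussianPDFReal 0 v s • k s)
      (gaussianPDFReal 0 v s • k' s - (v : ℂ)⁻¹ * (gaussianPDFReal 0 v s • ((s : ℂ) * k s))) s := by
    intro s
    refine ((hpdf s).smul (hk s)).congr_deriv ?_
    simp only [Complex.real_smul]
    push_cast
    field_simp
    ring
  -- Density times `k` is integrable with integrable derivative, so the derivative integrates to
  -- zero.
  have hz := integral_eq_zero_of_hasDerivAt_of_integrable hd
    ((hint h2).sub ((hint h1).const_mul _)) (hint h0)
  rw [integral_sub (hint h2) ((hint h1).const_mul _), integral_const_mul, sub_eq_zero] at hz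
  rw [hz, mul_inv_cancel_left₀ (by exact_mod_cast hv')]

/-- The Gaussian exponential moment of a square. -/
lemma integrable_exp_sq_gaussianReal {v : ℝ≥0} {a : ℝ} (ha : 4 * (a * v) ≤ 1) :
    Integrable (fun s => Real.exp (a * s ^ 2)) (gaussianReal 0 v) ∧
      ∫ s, Real.exp (a * s ^ 2) ∂(gaussianReal 0 v) ≤ 2 := by
  by_cases hv : v = 0
  · subst hv
    rw [gaussianReal_zero_var]
    refine ⟨integrable_dirac (by simp), ?_⟩
    rw [integral_dirac]; simp
  have hv' : (0 : ℝ) < v := by positivity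
  -- The tilted integrand is Gaussian with rate `b`. The hypothesis leaves at least half of the
  -- original rate 1/(2v), so the integral is at most √2.
  set b : ℝ := 1 / (2 * v) - a with hb
  have hb0 : 1 / (4 * v) ≤ b := by
    rw [hb, le_sub_iff_add_le, ← sub_nonneg]
    have : 1 / (2 * (v : ℝ)) - (1 / (4 * v) + a) = (1 - 4 * (a * v)) / (4 * v) := by
      field_simp; ring
    rw [this]; apply div_nonneg <;> linarith
  have hbpos : 0 < b := lt_of_lt_of_le (by positivity) hb0
  have hprod : ∀ s, gaussianPDFReal 0 v s * Real.exp (a * s ^ 2) =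
      (√(2 * Real.pi * v))⁻¹ * Real.exp (-b * s ^ 2) := by
    intro s
    simp only [gaussianPDFReal_def]
    rw [mul_assoc, ← Real.exp_add]
    congr 2
    rw [hb]; field_simp; ring
  constructor
  · rw [gaussianReal_of_var_ne_zero _ hv, integrable_withDensity_iff_integrable_smul'
      (measurable_gaussianPDF 0 v) (ae_of_all _ fun _ => gaussianPDF_lt_top)]
    simp only [toReal_gaussianPDF, smul_eq_mul, hprod]
    exact (integrable_exp_neg_mul_sq hbpos).const_mul _
  · rw [integral_gaussianReal_eq_integral_smul hv]
    simp only [smul_eq_mul, hprod]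
    rw [integral_const_mul, integral_gaussian, ← Real.sqrt_inv, ← Real.sqrt_mul (by positivity),
      Real.sqrt_le_left (by norm_num)]
    have hpi := Real.pi_pos
    rw [show (2 * Real.pi * v)⁻¹ * (Real.pi / b) = (1 / (2 * v)) / b by field_simp,
      div_le_iff₀ hbpos]
    calc 1 / (2 * (v : ℝ)) = 2 * (1 / (4 * v)) := by field_simp; norm_num
      _ ≤ 2 * b := by gcongr
      _ ≤ 2 ^ 2 * b := by nlinarith

end GaussianOneDim

/-! ### Integration by parts for a Gaussian field -/

section GaussianField
open MeasureTheory ProbabilityTheory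

variable {ι : Type*} [Fintype ι] [DecidableEq ι] {S : Matrix ι ι ℝ}

/-- Resampling one coordinate of a Gaussian field, and moving the others along with it. -/
noncomputable def resample (S : Matrix ι ι ℝ) (y : ι) (p : EuclideanSpace ℝ ι × ℝ) :
    EuclideanSpace ℝ ι :=
  WithLp.toLp 2 fun x => p.1 x + (p.2 - p.1 y) / S y y * S x y

lemma measurable_resample (y : ι) : Measurable (resample S y) := by
  unfold resample
  fun_prop

/-- The field minus its regression on the coordinate `y` is independent of that coordinate, which
can therefore be replaced by a fresh copy. In characteristic functions: passing from t to t - a e_y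
lowers the quadratic form by a²S(y,y), and the fresh variable restores that amount. -/
lemma map_resample (hS : S.PosSemidef) {y : ι} (hy : 0 < S y y) :
    ((multivariateGaussian 0 S).prod (gaussianReal 0 (S y y).toNNReal)).map (resample S y) =
      multivariateGaussian 0 S := by
  have := Measure.isProbabilityMeasure_map (μ := (multivariateGaussian 0 S).prod
    (gaussianReal 0 (S y y).toNNReal)) (measurable_resample (S := S) y).aemeasurable
  apply Measure.ext_of_charFun
  ext t
  set a : ℝ := (∑ x, S x y * t x) / S y y with ha
  have hsym : ∀ x z, S x z = S z x := fun x z => by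
    have := hS.isHermitian.apply z x
    simpa using this
  rw [charFun_apply, integral_map (measurable_resample y).aemeasurable (by fun_prop)]
  have hsplit : ∀ p : EuclideanSpace ℝ ι × ℝ,
      Complex.exp (inner ℝ (resample S y p) t * Complex.I) =
        Complex.exp (inner ℝ p.1 (t - a • EuclideanSpace.single y (1 : ℝ)) * Complex.I) *
          Complex.exp (a * p.2 * Complex.I) := by
    intro p
    rw [← Complex.exp_add, ← add_mul]
    congr 2
    have : inner ℝ (resample S y p) t =
        inner ℝ p.1 (t - a • EuclideanSpace.single y (1 : ℝ)) + a * p.2 := by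
      rw [inner_sub_right, inner_smul_right, EuclideanSpace.inner_single_right]
      simp only [PiLp.inner_apply, resample, RCLike.inner_apply, conj_trivial, mul_add,
        Finset.sum_add_distrib]
      have h1 : ∑ x, t x * ((p.2 - p.1 y) / S y y * S x y) = (p.2 - p.1 y) * a := by
        rw [ha, ← mul_div_assoc, Finset.mul_sum, Finset.sum_div]
        exact Finset.sum_congr rfl fun x _ => by ring
      rw [h1]; ring
    rw [this]; push_cast; ring
  simp_rw [hsplit]
  rw [integral_prod_mul (fun ζ : EuclideanSpace ℝ ι =>
    Complex.exp (inner ℝ ζ (t - a • EuclideanSpace.single y (1 : ℝ)) * Complex.I))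
    (fun s : ℝ => Complex.exp (a * s * Complex.I)), ← charFun_apply, ← charFun_apply_real,
    charFun_multivariateGaussian hS, charFun_multivariateGaussian hS, charFun_gaussianReal,
    ← Complex.exp_add]
  congr 1
  have hq : (t - a • EuclideanSpace.single y (1 : ℝ)).ofLp ⬝ᵥ
      Matrix.mulVec S (t - a • EuclideanSpace.single y (1 : ℝ)).ofLp =
      t.ofLp ⬝ᵥ Matrix.mulVec S t.ofLp - a ^ 2 * S y y := by
    have e1 : (t - a • EuclideanSpace.single y (1 : ℝ)).ofLp = t.ofLp - a • Pi.single y 1 := by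
      ext x; simp [Pi.single_apply]
    have e2 : (Matrix.mulVec S t.ofLp) y = a * S y y := by
      rw [ha, div_mul_cancel₀ _ hy.ne', Matrix.mulVec, dotProduct]
      exact Finset.sum_congr rfl fun x _ => by rw [hsym]
    have e3 : t.ofLp ⬝ᵥ Matrix.mulVec S (Pi.single y 1) = a * S y y := by
      rw [ha, div_mul_cancel₀ _ hy.ne', dotProduct]
      exact Finset.sum_congr rfl fun x _ => by
        simp [Matrix.mulVec, dotProduct, Pi.single_apply, mul_comm]
    rw [e1, Matrix.mulVec_sub, Matrix.mulVec_smul, sub_dotProduct, dotProduct_sub, dotProduct_sub,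
      smul_dotProduct, smul_dotProduct, dotProduct_smul, dotProduct_smul, e3,
      single_one_dotProduct, single_one_dotProduct, e2]
    simp only [Matrix.mulVec_single_one, Matrix.col_apply, smul_eq_mul]
    ring
  rw [hq]
  simp only [inner_zero_right, Complex.ofReal_zero, zero_mul, zero_sub, mul_zero,
    Real.coe_toNNReal _ hy.le]
  push_cast
  ring

/-- Gaussian integration by parts. -/
lemma integral_coord_mul (hS : S.PosSemidef) {y : ι} (hy : 0 < S y y) {k k' : (ι → ℝ) → ℂ}
    (hk : ∀ φ : ι → ℝ, HasDerivAt (fun s : ℝ => k fun x => φ x + s * S x y) (k' φ) 0)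
    (h0 : Integrable (fun ζ : EuclideanSpace ℝ ι => k fun x => ζ x) (multivariateGaussian 0 S))
    (h1 : Integrable (fun ζ : EuclideanSpace ℝ ι => (ζ y : ℂ) * k fun x => ζ x)
      (multivariateGaussian 0 S))
    (h2 : Integrable (fun ζ : EuclideanSpace ℝ ι => k' fun x => ζ x)
      (multivariateGaussian 0 S)) :
    ∫ ζ, (ζ y : ℂ) * k (fun x => ζ x) ∂(multivariateGaussian 0 S) =
      ∫ ζ, k' (fun x => ζ x) ∂(multivariateGaussian 0 S) := by
  set μ := multivariateGaussian 0 S with hμ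
  set v : ℝ≥0 := (S y y).toNNReal with hv
  have hvS : (v : ℝ) = S y y := Real.coe_toNNReal _ hy.le
  have hv0 : v ≠ 0 := fun h => hy.ne' (by rw [← hvS, h]; rfl)
  have hm := map_resample hS hy
  rw [← hμ, ← hv] at hm
  have hT := (measurable_resample (S := S) y).aemeasurable (μ := μ.prod (gaussianReal 0 v))
  have i0 := h0; have i1 := h1; have i2 := h2
  rw [← hm] at i0 i1 i2
  have j0 := i0.comp_aemeasurable hT
  have j1 := i1.comp_aemeasurable hT
  have j2 := i2.comp_aemeasurable hT
  simp only [Function.comp_def] at j0 j1 j2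
  have e1 : ∫ ζ, (ζ y : ℂ) * k (fun x => ζ x) ∂μ = ∫ p, ((resample S y p) y : ℂ) *
      k (fun x => resample S y p x) ∂(μ.prod (gaussianReal 0 v)) := by
    conv_lhs => rw [← hm]
    exact integral_map hT i1.aestronglyMeasurable
  have e2 : ∫ ζ, k' (fun x => ζ x) ∂μ = ∫ p,
      k' (fun x => resample S y p x) ∂(μ.prod (gaussianReal 0 v)) := by
    conv_lhs => rw [← hm]
    exact integral_map hT i2.aestronglyMeasurable
  -- For fixed `ζ` the resampled field is affine in the fresh variable s, with slope S(·,y)/S(y,y),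
  -- and its coordinate `y` equals s. The one-dimensional formula applies, and its variance S(y,y)
  -- cancels the denominator of the slope.
  rw [e1, e2, integral_prod _ j1, integral_prod _ j2]
  refine integral_congr_ae ?_
  filter_upwards [j0.prod_right_ae, j1.prod_right_ae, j2.prod_right_ae] with ζ a0 a1 a2
  have hy1 : ∀ s, (resample S y (ζ, s)) y = s := fun s => by
    simp only [resample]; field_simp; ring
  simp only [hy1] at a0 a1 a2 ⊢
  rw [integral_mul_gaussianReal (k := fun s => k fun x => resample S y (ζ, s) x)
    (k' := fun s => ((S y y : ℝ) : ℂ)⁻¹ * k' fun x => resample S y (ζ, s) x) hv0 ?_ a0 a1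
    (a2.const_mul _), integral_const_mul, hvS, mul_inv_cancel_left₀ (by exact_mod_cast hy.ne')]
  intro s
  have h := hk fun x => resample S y (ζ, s) x
  have hs : HasDerivAt (fun t : ℝ => (t - s) / S y y) (1 / S y y) s :=
    ((hasDerivAt_id s).sub_const s).div_const _
  have h' : HasDerivAt (fun r : ℝ => k fun x => resample S y (ζ, s) x + r * S x y)
      (k' fun x => resample S y (ζ, s) x) ((s - s) / S y y) := by simpa using h
  have hc := h'.scomp s hs
  simp only [Function.comp_def] at hc
  refine (hc.congr_deriv ?_).congr_of_eventuallyEq (Filter.Eventually.of_forall fun t => ?_)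
  · rw [Complex.real_smul]; push_cast; ring
  · simp only
    congr 1; ext x
    simp only [resample]; field_simp; ring

end GaussianField

/-! ### Complex translation of a charged function -/

section ComplexTranslation
open MeasureTheory ProbabilityTheory

variable {ι : Type*} [Fintype ι] [DecidableEq ι] {S : Matrix ι ι ℝ} {Y : Finset ι}
  {g g₂ : (ι → ℝ) → ℝ} {W : EuclideanSpace ℝ ι → ℝ} {H : (ι → ℝ) → ℂ} {β : ℝ} {y : ι}

/-- `E[e^{(z - iβ) ζ_y} H(φ + ζ)]`. -/
noncomputable def expTilt (S : Matrix ι ι ℝ) (y : ι) (β : ℝ) (H : (ι → ℝ) → ℂ) (φ : ι → ℝ)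
    (z : ℂ) : ℂ :=
  ∫ ζ : EuclideanSpace ℝ ι, Complex.exp ((z - Complex.I * β) * ζ y) * H (fun x => φ x + ζ x)
    ∂(multivariateGaussian 0 S)

lemma norm_exp_tilt_le (z : ℂ) (β s : ℝ) :
    ‖Complex.exp ((z - Complex.I * β) * s)‖ ≤ Real.exp (‖z‖ * |s|) := by
  rw [Complex.norm_exp]
  refine Real.exp_le_exp.2 ?_
  have : ((z - Complex.I * β) * s).re = z.re * s := by simp
  rw [this]
  calc z.re * s ≤ |z.re * s| := le_abs_self _
    _ = |z.re| * |s| := abs_mul _ _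
    _ ≤ ‖z‖ * |s| := by gcongr; exact Complex.abs_re_le_norm z

/-- The Gaussian moments of the weight `W` that are needed for translations into the complex. -/
def HasExpMoments (S : Matrix ι ι ℝ) (y : ι) (W : EuclideanSpace ℝ ι → ℝ) : Prop :=
  ∀ a : ℝ, Integrable (fun ζ : EuclideanSpace ℝ ι => Real.exp (a * |ζ y|) * W ζ)
    (multivariateGaussian 0 S)

/-- The exponential growth of the tilt in |ζ_y|, and an additional factor |ζ_y| ≤ e^{|ζ_y|}, are
absorbed by the exponential moments of the weight. -/
lemma integrable_expTilt
    (hT : IsShiftBound (multivariateGaussian 0 S) (fun _ => 1) (fun ζ x => ζ x) g g₂ W)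
    (hW : HasExpMoments S y W) (hH : IsDominated Y g H) (φ : ι → ℝ) (z : ℂ) :
    Integrable (fun ζ : EuclideanSpace ℝ ι =>
      Complex.exp ((z - Complex.I * β) * ζ y) * H (fun x => φ x + ζ x))
      (multivariateGaussian 0 S) ∧
    Integrable (fun ζ : EuclideanSpace ℝ ι =>
      (ζ y : ℂ) * (Complex.exp ((z - Complex.I * β) * ζ y) * H (fun x => φ x + ζ x)))
      (multivariateGaussian 0 S) := by
  obtain ⟨B, hB0, hB⟩ := hH.bound []
  have hc := hH.smooth.continuous
  have hle : ∀ ζ : EuclideanSpace ℝ ι,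
      ‖Complex.exp ((z - Complex.I * β) * ζ y) * H (fun x => φ x + ζ x)‖ ≤
        Real.exp (‖z‖ * |ζ y|) * (B * (g₂ φ * W ζ)) := fun ζ => by
    rw [norm_mul]
    gcongr
    · exact norm_exp_tilt_le _ _ _
    · exact (hB _).trans (mul_le_mul_of_nonneg_left (hT.bound φ ζ) hB0)
  have hm : Continuous fun ζ : EuclideanSpace ℝ ι =>
      Complex.exp ((z - Complex.I * β) * ζ y) * H (fun x => φ x + ζ x) := by fun_prop
  constructor
  · refine ((hW ‖z‖).const_mul (B * g₂ φ)).mono' hm.aestronglyMeasurable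
      (ae_of_all _ fun ζ => (hle ζ).trans (le_of_eq ?_))
    ring
  · refine ((hW (‖z‖ + 1)).const_mul (B * g₂ φ)).mono'
      (Continuous.aestronglyMeasurable (by fun_prop)) (ae_of_all _ fun ζ => ?_)
    rw [norm_mul, Complex.norm_real, Real.norm_eq_abs]
    have h1 : |ζ y| ≤ Real.exp |ζ y| := by linarith [Real.add_one_le_exp |ζ y|]
    calc |ζ y| * _ ≤ Real.exp |ζ y| * (Real.exp (‖z‖ * |ζ y|) * (B * (g₂ φ * W ζ))) := by
          gcongr; exact hle ζ
      _ = B * g₂ φ * (Real.exp ((‖z‖ + 1) * |ζ y|) * W ζ) := by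
          rw [add_mul, one_mul, Real.exp_add]; ring

/-- Holds for every complex z, so the tilted expectation is entire although `H` itself is merely
smooth. -/
lemma hasDerivAt_expTilt
    (hT : IsShiftBound (multivariateGaussian 0 S) (fun _ => 1) (fun ζ x => ζ x) g g₂ W)
    (hW : HasExpMoments S y W) (hH : IsDominated Y g H) (φ : ι → ℝ) (z : ℂ) :
    HasDerivAt (expTilt S y β H φ) (∫ ζ : EuclideanSpace ℝ ι,
      (ζ y : ℂ) * (Complex.exp ((z - Complex.I * β) * ζ y) * H (fun x => φ x + ζ x))
        ∂(multivariateGaussian 0 S)) z := by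
  obtain ⟨B, hB0, hB⟩ := hH.bound []
  refine (hasDerivAt_integral_of_dominated_loc_of_deriv_le
    (F := fun z (ζ : EuclideanSpace ℝ ι) =>
      Complex.exp ((z - Complex.I * β) * ζ y) * H (fun x => φ x + ζ x))
    (F' := fun z (ζ : EuclideanSpace ℝ ι) =>
      (ζ y : ℂ) * (Complex.exp ((z - Complex.I * β) * ζ y) * H (fun x => φ x + ζ x)))
    (bound := fun ζ => B * g₂ φ * (Real.exp ((‖z‖ + 2) * |ζ y|) * W ζ))
    (Metric.ball_mem_nhds z one_pos)
    (Filter.Eventually.of_forall fun w =>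
      (integrable_expTilt hT hW hH φ w).1.aestronglyMeasurable)
    (integrable_expTilt hT hW hH φ z).1
    (integrable_expTilt hT hW hH φ z).2.aestronglyMeasurable
    (ae_of_all _ fun ζ w hw => ?_) ((hW _).const_mul _) (ae_of_all _ fun ζ w _ => ?_)).2
  · have hw' : ‖w‖ ≤ ‖z‖ + 1 := by
      have := norm_sub_norm_le w z
      rw [Metric.mem_ball, dist_eq_norm] at hw
      linarith
    rw [norm_mul, norm_mul, Complex.norm_real, Real.norm_eq_abs]
    have h1 : |ζ y| ≤ Real.exp |ζ y| := by linarith [Real.add_one_le_exp |ζ y|]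
    have h2 : ‖Complex.exp ((w - Complex.I * β) * ζ y)‖ ≤ Real.exp ((‖z‖ + 1) * |ζ y|) :=
      (norm_exp_tilt_le _ _ _).trans (Real.exp_le_exp.2 (by gcongr))
    have h3 : ‖H fun x => φ x + ζ x‖ ≤ B * (g₂ φ * W ζ) :=
      (hB _).trans (mul_le_mul_of_nonneg_left (hT.bound φ ζ) hB0)
    calc |ζ y| * _ ≤ Real.exp |ζ y| * (Real.exp ((‖z‖ + 1) * |ζ y|) * (B * (g₂ φ * W ζ))) := by
          gcongr
      _ = B * g₂ φ * (Real.exp ((‖z‖ + 2) * |ζ y|) * W ζ) := by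
          rw [show (‖z‖ + 2) * |ζ y| = |ζ y| + (‖z‖ + 1) * |ζ y| by ring, Real.exp_add]; ring
  · have h : HasDerivAt (fun w : ℂ => (w - Complex.I * β) * ζ y) (ζ y) w := by
      simpa using ((hasDerivAt_id w).sub_const (Complex.I * β)).mul_const (ζ y : ℂ)
    refine (h.cexp.mul_const (H fun x => φ x + ζ x)).congr_deriv ?_
    ring

/-- The derivative of `S(·,y) - S(y,y)`, the direction in which the field is translated. -/
lemma deriv_expTilt (hS : S.PosSemidef) (hy : 0 < S y y)
    (hT : IsShiftBound (multivariateGaussian 0 S) (fun _ => 1) (fun ζ x => ζ x) g g₂ W)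
    (hW : HasExpMoments S y W) (hH : IsDominated Y g H) (hβ : HasCharge β H) (φ : ι → ℝ) (z : ℂ) :
    ∫ ζ : EuclideanSpace ℝ ι,
      (ζ y : ℂ) * (Complex.exp ((z - Complex.I * β) * ζ y) * H (fun x => φ x + ζ x))
        ∂(multivariateGaussian 0 S) =
      z * S y y * expTilt S y β H φ z +
        expTilt S y β (cdir Y (fun x => ((S x y - S y y : ℝ) : ℂ)) H) φ z := by
  set v' : ι → ℂ := fun x => ((S x y - S y y : ℝ) : ℂ) with hv'
  have hH' := hH.cdir v'
  have i1 := integrable_expTilt (β := β) hT hW hH φ z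
  have i2 := integrable_expTilt (β := β) hT hW hH' φ z
  have hd : Differentiable ℝ H := hH.smooth.differentiable (by simp)
  rw [integral_coord_mul hS hy (k := fun ψ : ι → ℝ =>
      Complex.exp ((z - Complex.I * β) * ψ y) * H (fun x => φ x + ψ x))
    (k' := fun ψ => z * S y y * (Complex.exp ((z - Complex.I * β) * ψ y) *
      H (fun x => φ x + ψ x)) + Complex.exp ((z - Complex.I * β) * ψ y) *
        cdir Y v' H (fun x => φ x + ψ x)) ?_ i1.1 i1.2 ((i1.1.const_mul _).add i2.1),
    integral_add (i1.1.const_mul _) i2.1, integral_const_mul]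
  · rfl
  intro ψ
  have h1 : HasDerivAt (fun s : ℝ => Complex.exp ((z - Complex.I * β) * ((ψ y + s * S y y : ℝ) : ℂ)))
      (Complex.exp ((z - Complex.I * β) * ψ y) * ((z - Complex.I * β) * S y y)) 0 := by
    have h0 : HasDerivAt (fun s : ℝ => ψ y + s * S y y) (S y y) 0 := by
      simpa using ((hasDerivAt_id (0 : ℝ)).mul_const (S y y)).const_add (ψ y)
    have := ((h0.ofReal_comp).const_mul (z - Complex.I * β)).cexp
    simpa using this
  have h2 : HasDerivAt (fun s : ℝ => H fun x => φ x + (ψ x + s * S x y))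
      (fderiv ℝ H (fun x => φ x + ψ x) fun x => S x y) 0 := by
    have h0 : HasDerivAt (fun s : ℝ => fun x => φ x + (ψ x + s * S x y)) (fun x => S x y) 0 := by
      rw [hasDerivAt_pi]
      intro x
      simpa using (((hasDerivAt_id (0 : ℝ)).mul_const (S x y)).const_add (ψ x)).const_add (φ x)
    have hF' : HasFDerivAt H (fderiv ℝ H (fun x => φ x + ψ x))
        (fun x => φ x + (ψ x + (0 : ℝ) * S x y)) := by
      simpa using (hd fun x => φ x + ψ x).hasFDerivAt
    exact hF'.comp_hasDerivAt 0 h0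
  -- S(·,y) is `v'` plus the constant S(y,y). By the charge of `H` the constant contributes
  -- iβS(y,y), which cancels the -iβ of the tilt and leaves z S(y,y).
  have h3 : fderiv ℝ H (fun x => φ x + ψ x) (fun x => S x y) =
      cdir Y v' H (fun x => φ x + ψ x) + S y y * (Complex.I * β) * H fun x => φ x + ψ x := by
    rw [hH.supported.fderiv_apply hd,
      show (fun x => ((S x y : ℝ) : ℂ)) = v' + fun _ => ((S y y : ℝ) : ℂ) by ext; simp [hv'],
      cdir_add_dir, hβ.cdir_one hH.supported hd]
    rfl
  refine (h1.mul h2).congr_deriv ?_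
  rw [h3]
  simp
  ring

/-- Moving a charge into the complex plane: the expectation of a function of charge `β` gains the
factor `e^{-β² S(y,y)/2}`. -/
lemma enorm_integral_le_of_hasCharge (hS : S.PosSemidef) (hy : 0 < S y y)
    (hT : IsShiftBound (multivariateGaussian 0 S) (fun _ => 1) (fun ζ x => ζ x) g g₂ W)
    (hW : HasExpMoments S y W) (hH : IsDominated Y g H) (hβ : HasCharge β H) (φ : ι → ℝ) :
    ‖∫ ζ : EuclideanSpace ℝ ι, H (fun x => φ x + ζ x) ∂(multivariateGaussian 0 S)‖ₑ ≤
      ENNReal.ofReal (Real.exp (-(β ^ 2 * S y y / 2))) *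
        ∑' m : ℕ, ENNReal.ofReal (|β| ^ m / m.factorial) *
          ∫⁻ ζ : EuclideanSpace ℝ ι,
            ‖cdirs Y (List.replicate m fun x => ((S x y - S y y : ℝ) : ℂ)) H
              (fun x => φ x + ζ x)‖ₑ ∂(multivariateGaussian 0 S) := by
  set v' : ι → ℂ := fun x => ((S x y - S y y : ℝ) : ℂ) with hv'
  have hdm : ∀ m, IsDominated Y g (cdirs Y (List.replicate m v') H) := fun m => hH.cdirs _
  have hcm : ∀ m, HasCharge β (cdirs Y (List.replicate m v') H) := fun m => hβ.cdirs hH.smooth _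
  -- The Gaussian prefactor removes the term z S(y,y) from the derivative, so that differentiating
  -- `Q m` just gives `Q (m + 1)`.
  set Q : ℕ → ℂ → ℂ := fun m z => Complex.exp (-(z ^ 2 * S y y / 2)) *
    expTilt S y β (cdirs Y (List.replicate m v') H) φ z with hQ
  have hder : ∀ m z, HasDerivAt (Q m) (Q (m + 1) z) z := by
    intro m z
    have h1 := hasDerivAt_expTilt (β := β) hT hW (hdm m) φ z
    rw [deriv_expTilt hS hy hT hW (hdm m) (hcm m)] at h1
    have h2 : HasDerivAt (fun z : ℂ => Complex.exp (-(z ^ 2 * S y y / 2)))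
        (Complex.exp (-(z ^ 2 * S y y / 2)) * (-(z * S y y))) z := by
      have := (((hasDerivAt_pow 2 z).mul_const (S y y : ℂ)).div_const 2).neg.cexp
      refine this.congr_deriv ?_
      simp; ring
    refine (h2.mul h1).congr_deriv ?_
    simp only [hQ, List.replicate_succ, cdirs_cons]
    ring
  have hiter : ∀ m, iteratedDeriv m (Q 0) = Q m := by
    intro m
    induction m with
    | zero => simp
    | succ m ih => rw [iteratedDeriv_succ, ih]; ext z; exact (hder m z).deriv
  have hent : Differentiable ℂ (Q 0) := fun z => (hder 0 z).differentiableAt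
  -- The Taylor series at 0 evaluated at iβ replaces a contour shift. At iβ the tilt disappears and
  -- the prefactor is e^{β²S(y,y)/2}; at 0 the tilt is a phase, so the coefficients are bounded by
  -- expectations of derivatives of `H`.
  have hsum := Complex.hasSum_taylorSeries_of_entire hent 0 (Complex.I * β)
  have hval : Q 0 (Complex.I * β) = Complex.exp ((β ^ 2 * S y y / 2 : ℝ)) *
      ∫ ζ : EuclideanSpace ℝ ι, H (fun x => φ x + ζ x) ∂(multivariateGaussian 0 S) := by
    simp only [hQ, expTilt, sub_self, zero_mul, Complex.exp_zero, one_mul, List.replicate_zero,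
      cdirs_nil]
    congr 2
    rw [mul_pow, Complex.I_sq]; push_cast; ring
  have hbd : ∀ m, ‖Q m 0‖ₑ ≤ ∫⁻ ζ : EuclideanSpace ℝ ι, ‖cdirs Y (List.replicate m v') H
      (fun x => φ x + ζ x)‖ₑ ∂(multivariateGaussian 0 S) := by
    intro m
    simp only [hQ, expTilt]
    norm_num
    refine (enorm_integral_le_lintegral_enorm _).trans (lintegral_mono fun ζ => ?_)
    rw [enorm_mul]
    refine mul_le_of_le_one_left' ?_
    rw [← ofReal_norm]
    have : ‖Complex.exp (-(Complex.I * β * ζ y))‖ = 1 := by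
      rw [show -(Complex.I * β * ζ y) = ((-(β * ζ y) : ℝ) : ℂ) * Complex.I by push_cast; ring,
        Complex.norm_exp_ofReal_mul_I]
    rw [this]; simp
  have hfin : ‖Q 0 (Complex.I * β)‖ₑ ≤ ∑' m : ℕ, ENNReal.ofReal (|β| ^ m / m.factorial) *
      ∫⁻ ζ : EuclideanSpace ℝ ι, ‖cdirs Y (List.replicate m v') H
        (fun x => φ x + ζ x)‖ₑ ∂(multivariateGaussian 0 S) := by
    rw [← hsum.tsum_eq]
    refine enorm_tsum_le_tsum_enorm.trans (ENNReal.tsum_le_tsum fun m => ?_)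
    rw [hiter, enorm_smul, enorm_smul, ← mul_assoc]
    refine mul_le_mul' (le_of_eq ?_) (hbd m)
    rw [← ofReal_norm, ← ofReal_norm, ← ENNReal.ofReal_mul (norm_nonneg _)]
    congr 1
    simp [mul_pow]
    ring
  have hinv : ∫ ζ : EuclideanSpace ℝ ι, H (fun x => φ x + ζ x) ∂(multivariateGaussian 0 S) =
      ((Real.exp (-(β ^ 2 * S y y / 2)) : ℝ) : ℂ) * Q 0 (Complex.I * β) := by
    rw [hval, ← mul_assoc, Complex.ofReal_exp, ← Complex.exp_add]
    simp
  rw [hinv, enorm_mul]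
  refine mul_le_mul' (le_of_eq ?_) hfin
  rw [← ofReal_norm, Complex.norm_real, Real.norm_eq_abs, abs_of_pos (Real.exp_pos _)]

end ComplexTranslation

/-! ### Norms of averages and expectations -/

section NormsOfAverages
open MeasureTheory ProbabilityTheory

variable {L R : ℕ} [NeZero L] {Y : Finset (Site L R)} {F : (Site L R → ℝ) → ℂ}
  {g g₂ : (Site L R → ℝ) → ℝ}

/-- Only this inequality is needed, and superadditivity of the lower integral gives it for
arbitrary, possibly non-measurable, functions. -/
lemma tsum_lintegral_le {T : Type*} [MeasurableSpace T] (ν : Measure T) (f : ℕ → T → ℝ≥0∞) :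
    ∑' n, ∫⁻ t, f n t ∂ν ≤ ∫⁻ t, ∑' n, f n t ∂ν := by
  rw [ENNReal.tsum_eq_iSup_sum]
  refine iSup_le fun s => ?_
  calc ∑ n ∈ s, ∫⁻ t, f n t ∂ν ≤ ∫⁻ t, ∑ n ∈ s, f n t ∂ν := by
        classical
        induction s using Finset.induction_on with
        | empty => simp
        | insert a s ha ih =>
          simp only [Finset.sum_insert ha]
          exact (add_le_add le_rfl ih).trans (le_lintegral_add _ _)
    _ ≤ _ := lintegral_mono fun t => ENNReal.sum_le_tsum s

lemma cdirs_cdirs_comm (hF : ContDiff ℝ ∞ F) (l l' : List (Site L R → ℂ)) :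
    cdirs Y l (cdirs Y l' F) = cdirs Y l' (cdirs Y l F) := by
  induction l with
  | nil => rfl
  | cons f l ih => rw [cdirs_cons, cdirs_cons, cdirs_cdir (contDiff_cdirs hF l), ih]

lemma tNorm_shiftAvg_le {T : Type*} [MeasurableSpace T] {ν : Measure T} {c : T → ℂ}
    {u : T → Site L R → ℝ} {W : T → ℝ} (hT : IsShiftBound ν c u g g₂ W)
    (hF : IsDominated Y g F) (h : ℝ) (k : ℕ) (φ : Site L R → ℝ) :
    tNorm h k Y (shiftAvg ν c u F) φ ≤ ∫⁻ t, tNorm h k Y F (fun x => φ x + u t x) ∂ν := by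
  refine le_trans ?_ (tsum_lintegral_le ν _)
  refine ENNReal.tsum_le_tsum fun n => le_trans ?_ (lintegral_const_mul_le _ _)
  gcongr
  refine tnNorm_le (hT.contDiff hF) fun l hl hl1 => ?_
  rw [hT.cdirs_shiftAvg hF]
  refine (enorm_integral_le_lintegral_enorm _).trans (lintegral_mono fun t => ?_)
  rw [enorm_mul]
  refine (mul_le_of_le_one_left' ?_).trans (hl ▸ enorm_cdirs_le_tnNorm hF.smooth hl1)
  rw [← ofReal_norm, ENNReal.ofReal_le_one]
  exact hT.norm_coeff_le t

/-- The radius is halved to pay for the translation: its m-th term brings (|β|b)^m/m! ≤ (h/2)^m/m!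
and m additional derivatives. Together with the weight (h/2)ⁿ/n! of the norm, the binomial theorem
for (h/2 + h/2)^N restores the weights h^N/N!. -/
lemma tNorm_expectation_le {S : Matrix (Site L R) (Site L R) ℝ} {y : Site L R} {β : ℝ}
    {W : EuclideanSpace ℝ (Site L R) → ℝ}
    (hS : S.PosSemidef) (hy : 0 < S y y)
    (hT : IsShiftBound (multivariateGaussian 0 S) (fun _ => 1) (fun ζ x => ζ x) g g₂ W)
    (hW : HasExpMoments S y W) (hF : IsDominated Y g F) (hβ : HasCharge β F) {k : ℕ} {b : ℝ≥0}
    (hb : b ≠ 0) (hSb : c2Norm k Y (fun x => ((S x y - S y y : ℝ) : ℂ)) ≤ b) {h : ℝ}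
    (hh : 0 ≤ h) (hβb : |β| * b ≤ h / 2) (φ : Site L R → ℝ) :
    tNorm (h / 2) k Y (fun φ => ∫ ζ : EuclideanSpace ℝ (Site L R), F (fun x => φ x + ζ x)
      ∂(multivariateGaussian 0 S)) φ ≤
      ENNReal.ofReal (Real.exp (-(β ^ 2 * S y y / 2))) *
        ∫⁻ ζ : EuclideanSpace ℝ (Site L R), tNorm h k Y F (fun x => φ x + ζ x)
          ∂(multivariateGaussian 0 S) := by
  set μ := multivariateGaussian 0 S with hμ
  set E := ENNReal.ofReal (Real.exp (-(β ^ 2 * S y y / 2))) with hE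
  have havg : (fun φ => ∫ ζ : EuclideanSpace ℝ (Site L R), F (fun x => φ x + ζ x) ∂μ) =
      shiftAvg μ (fun _ => 1) (fun ζ x => ζ x) F := by ext; simp [shiftAvg]
  rw [havg]
  set I : ℕ → ℝ≥0∞ := fun n => ∫⁻ ζ : EuclideanSpace ℝ (Site L R),
    tnNorm k Y n F (fun x => φ x + ζ x) ∂μ with hI
  have hn : ∀ n, tnNorm k Y n (shiftAvg μ (fun _ => 1) (fun ζ x => ζ x) F) φ ≤
      E * ∑' m : ℕ, ENNReal.ofReal ((h / 2) ^ m / m.factorial) * I (n + m) := by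
    intro n
    refine tnNorm_le (hT.contDiff hF) fun l hl hl1 => ?_
    rw [hT.cdirs_shiftAvg hF]
    have := enorm_integral_le_of_hasCharge hS hy hT hW (hF.cdirs l) (hβ.cdirs hF.smooth l) φ
    simp only [shiftAvg, one_mul]
    refine this.trans (mul_le_mul_right (ENNReal.tsum_le_tsum fun m => ?_) _)
    calc ENNReal.ofReal (|β| ^ m / m.factorial) * _
        ≤ ENNReal.ofReal (|β| ^ m / m.factorial) * ((b : ℝ≥0∞) ^ m * I (n + m)) := by
          gcongr
          refine le_trans (lintegral_mono fun ζ => ?_)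
            (lintegral_const_mul' _ _ (by simp)).le
          rw [cdirs_cdirs_comm hF.smooth]
          refine (hl ▸ enorm_cdirs_le_tnNorm (contDiff_cdirs hF.smooth _) hl1 :
            _ ≤ tnNorm k Y n _ _).trans ?_
          exact tnNorm_cdirs_replicate_le hF.smooth n m hb hSb
      _ ≤ ENNReal.ofReal ((h / 2) ^ m / m.factorial) * I (n + m) := by
          rw [← mul_assoc]
          gcongr
          rw [show (b : ℝ≥0∞) = ENNReal.ofReal b by simp, ← ENNReal.ofReal_pow (NNReal.coe_nonneg b),
            ← ENNReal.ofReal_mul (by positivity)]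
          refine ENNReal.ofReal_le_ofReal ?_
          rw [div_mul_eq_mul_div, ← mul_pow]
          gcongr
  calc tNorm (h / 2) k Y (shiftAvg μ (fun _ => 1) (fun ζ x => ζ x) F) φ
      ≤ ∑' n : ℕ, ENNReal.ofReal ((h / 2) ^ n / n.factorial) *
          (E * ∑' m : ℕ, ENNReal.ofReal ((h / 2) ^ m / m.factorial) * I (n + m)) := by
        refine ENNReal.tsum_le_tsum fun n => ?_
        gcongr
        exact hn n
    _ = E * ∑' N : ℕ, ENNReal.ofReal (h ^ N / N.factorial) * I N := by
        simp_rw [mul_left_comm _ E, ENNReal.tsum_mul_left]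
        congr 1
        simp_rw [← ENNReal.tsum_mul_left]
        rw [← tsum_antidiagonal fun n m => ENNReal.ofReal ((h / 2) ^ n / n.factorial) *
          (ENNReal.ofReal ((h / 2) ^ m / m.factorial) * I (n + m))]
        refine tsum_congr fun N => ?_
        -- Binomial expansion of (h/2 + h/2)^N, divided by N!.
        have hexp : h ^ N / N.factorial =
            ∑ p ∈ Finset.HasAntidiagonal.antidiagonal N,
              (h / 2) ^ p.1 / p.1.factorial * ((h / 2) ^ p.2 / p.2.factorial) := by
          have h1 := (Commute.all (h / 2) (h / 2)).add_pow' N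
          rw [add_halves] at h1
          rw [h1, Finset.sum_div]
          refine Finset.sum_congr rfl fun p hp => ?_
          rw [← Finset.HasAntidiagonal.mem_antidiagonal.1 hp, Nat.choose_symm_add, Nat.add_choose,
            nsmul_eq_mul, Nat.cast_div
            (Nat.factorial_mul_factorial_dvd_factorial_add _ _) (by positivity)]
          push_cast
          field_simp
        rw [hexp, ENNReal.ofReal_sum_of_nonneg (fun p _ => by positivity), Finset.sum_mul]
        refine Finset.sum_congr rfl fun p hp => ?_
        rw [← mul_assoc, ← ENNReal.ofReal_mul (by positivity),
          Finset.HasAntidiagonal.mem_antidiagonal.1 hp]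
    _ ≤ _ := by
        gcongr
        refine le_trans ?_ (tsum_lintegral_le μ _)
        exact ENNReal.tsum_le_tsum fun n => lintegral_const_mul_le _ _

/-- A smooth function of the field whose norm is dominated by `g` has all its derivatives
dominated by `g`. -/
lemma isDominated_of_tNorm_le (hF : ContDiff ℝ ∞ F) (hs : SupportedOn Y F) {h : ℝ} (hh : 0 < h)
    {k : ℕ} {M : ℝ} (hM : 0 ≤ M) (hg : ∀ φ, 0 ≤ g φ)
    (hbd : ∀ φ, tNorm h k Y F φ ≤ ENNReal.ofReal (M * g φ)) : IsDominated Y g F where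
  smooth := hF
  supported := hs
  bound l := by
    -- Arbitrary directions are reduced to normalized ones; adding 1 to the norm keeps the scaling
    -- factor positive.
    have h1 : ∃ C : ℝ≥0, ∀ n φ, tnNorm k Y n (cdirs Y l F) φ ≤ C * tnNorm k Y (n + l.length) F φ := by
      induction l with
      | nil => exact ⟨1, fun n φ => by simp⟩
      | cons f l ih =>
        obtain ⟨C, hC⟩ := ih
        refine ⟨(c2Norm k Y f + 1) * C, fun n φ => ?_⟩
        rw [cdirs_cons]
        refine (tnNorm_cdir_le (contDiff_cdirs hF l) (ε := c2Norm k Y f + 1) (by positivity)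
          (le_add_of_nonneg_right zero_le_one)).trans ?_
        rw [List.length_cons, show n + (l.length + 1) = n + 1 + l.length by ring, ENNReal.coe_mul,
          mul_assoc]
        gcongr
        exact hC _ _
    obtain ⟨C, hC⟩ := h1
    set n := l.length with hn
    refine ⟨C * (n.factorial / h ^ n) * M, by positivity, fun φ => ?_⟩
    have h2 : ENNReal.ofReal (h ^ n / n.factorial) * tnNorm k Y n F φ ≤ ENNReal.ofReal (M * g φ) :=
      (ENNReal.le_tsum n).trans (hbd φ)
    have h3 : tnNorm k Y n F φ ≤ ENNReal.ofReal (n.factorial / h ^ n * (M * g φ)) := by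
      rw [ENNReal.ofReal_mul (by positivity), ← inv_div, ENNReal.ofReal_inv_of_pos (by positivity),
        mul_comm, ← div_eq_mul_inv, ENNReal.le_div_iff_mul_le (Or.inl ?_) (Or.inl ENNReal.ofReal_ne_top),
        mul_comm]
      · exact h2
      · simpa using by positivity
    have h4 := hC 0 φ
    rw [tnNorm_zero φ k (contDiff_cdirs hF l), zero_add] at h4
    have h5 : ‖cdirs Y l F φ‖ₑ ≤ ENNReal.ofReal (C * (n.factorial / h ^ n) * M * g φ) := by
      refine h4.trans ((mul_le_mul_right h3 _).trans (le_of_eq ?_))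
      rw [show (C : ℝ≥0∞) = ENNReal.ofReal C by simp, ← ENNReal.ofReal_mul (by positivity)]
      congr 1; ring
    rw [← ofReal_norm] at h5
    have := hg φ
    exact (ENNReal.ofReal_le_ofReal_iff (by positivity)).1 h5

end NormsOfAverages

/-! ### Logarithmic growth of the Coulomb potential and of the variance -/

section Potential
open MeasureTheory Real Set

lemma sq_le_two_sub_cos {x : ℝ} (hx : |x| ≤ π) :
    4 / π ^ 2 * x ^ 2 ≤ 2 * (1 - cos x) := by
  have := cos_le_one_sub_mul_cos_sq hx
  linear_combination 2 * this

lemma two_sub_cos_le (x : ℝ) : 2 * (1 - cos x) ≤ x ^ 2 := by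
  linarith [one_sub_sq_div_two_le_cos (x := x)]

/-- The fourth-order bound makes the lattice and continuum symbols agree to second order, so that
the difference of their inverses stays bounded near p = 0. For |x| > 1 it is trivial. -/
lemma sq_sub_two_sub_cos_le (x : ℝ) : x ^ 2 - 2 * (1 - cos x) ≤ x ^ 4 := by
  by_cases h : |x| ≤ 1
  · have := (abs_le.1 (cos_bound h)).2
    have e : |x| ^ 4 = x ^ 4 := by rw [show (4 : ℕ) = 2 * 2 by rfl, pow_mul, sq_abs, ← pow_mul]
    rw [e] at this
    nlinarith [sq_nonneg (x ^ 2)]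
  · have h1 : 1 ≤ x ^ 2 := by
      rw [← sq_abs]; push Not at h; nlinarith
    nlinarith [cos_le_one x]

/-- The lattice propagator and the continuum propagator differ by a bounded function. -/
lemma abs_inv_sub_inv_le {p : ℝ × ℝ} (hp : p ∈ Icc (-π) π ×ˢ Icc (-π) π) :
    |(2 * (1 - cos p.1) + 2 * (1 - cos p.2))⁻¹ - (p.1 ^ 2 + p.2 ^ 2)⁻¹| ≤ π ^ 2 / 4 := by
  have h1 := sq_le_two_sub_cos (abs_le.2 hp.1)
  have h2 := sq_le_two_sub_cos (abs_le.2 hp.2)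
  have h3 := two_sub_cos_le p.1
  have h4 := two_sub_cos_le p.2
  have h5 := sq_sub_two_sub_cos_le p.1
  have h6 := sq_sub_two_sub_cos_le p.2
  set a := 2 * (1 - cos p.1) + 2 * (1 - cos p.2) with ha
  set b := p.1 ^ 2 + p.2 ^ 2 with hb
  have hb0 : 0 ≤ b := by positivity
  have hpi := pi_pos
  -- The difference of inverses is (b - a)/(ab); with b - a ≤ b² and this comparison it is at most
  -- π²/4.
  have hab : 4 / π ^ 2 * b ≤ a := by rw [hb, ha]; linarith
  rcases hb0.eq_or_lt with hb0 | hb0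
  · have : a = 0 := le_antisymm (by linarith) (by rw [← hb0] at hab; linarith)
    rw [this, ← hb0]; simp; positivity
  · have ha0 : 0 < a := lt_of_lt_of_le (by positivity) hab
    have hle : b - a ≤ b ^ 2 := by
      have : p.1 ^ 4 + p.2 ^ 4 ≤ b ^ 2 := by rw [hb]; nlinarith [mul_nonneg (sq_nonneg p.1) (sq_nonneg p.2)]
      linarith
    rw [inv_sub_inv ha0.ne' hb0.ne', abs_div, abs_of_pos (mul_pos ha0 hb0),
      abs_of_nonneg (by linarith), div_le_iff₀ (mul_pos ha0 hb0)]
    calc b - a ≤ b * b := by rw [← sq]; exact hle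
      _ ≤ (π ^ 2 / 4 * a) * b := by
          gcongr
          calc b = π ^ 2 / 4 * (4 / π ^ 2 * b) := by field_simp
            _ ≤ _ := by gcongr
      _ = _ := by ring

lemma volume_square_real :
    (volume : Measure (ℝ × ℝ)).real (Icc (-π) π ×ˢ Icc (-π) π) = 4 * π ^ 2 := by
  have := pi_pos
  rw [Measure.volume_eq_prod, Measure.real, Measure.prod_prod, Real.volume_Icc, ENNReal.toReal_mul,
    ENNReal.toReal_ofReal (by linarith)]
  ring

lemma volume_square_lt_top :
    (volume : Measure (ℝ × ℝ)) (Icc (-π) π ×ˢ Icc (-π) π) < ⊤ :=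
  (isCompact_Icc.prod isCompact_Icc).measure_lt_top

/-- The continuum analogue of the lattice Coulomb potential. -/
noncomputable def continuumIntegral (N : ℕ) : ℝ :=
  ∫ p in (Icc (-π) π ×ˢ Icc (-π) π : Set (ℝ × ℝ)), (1 - cos (N * p.1)) * (p.1 ^ 2 + p.2 ^ 2)⁻¹

lemma integrableOn_continuum (N : ℕ) : IntegrableOn
    (fun p : ℝ × ℝ => (1 - cos (N * p.1)) * (p.1 ^ 2 + p.2 ^ 2)⁻¹)
    (Icc (-π) π ×ˢ Icc (-π) π) := by
  refine Measure.integrableOn_of_bounded (M := (N : ℝ) ^ 2) volume_square_lt_top.ne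
    (Measurable.aestronglyMeasurable (by fun_prop)) (ae_of_all _ fun p => ?_)
  have h0 : 0 ≤ 1 - cos (N * p.1) := by linarith [cos_le_one (N * p.1)]
  rw [norm_eq_abs, abs_of_nonneg (mul_nonneg h0 (by positivity)), ← div_eq_mul_inv]
  refine div_le_of_le_mul₀ (by positivity) (by positivity) ?_
  have := two_sub_cos_le (N * p.1)
  nlinarith [mul_nonneg (sq_nonneg (N : ℝ)) (sq_nonneg p.2), mul_nonneg (sq_nonneg (N : ℝ)) (sq_nonneg p.1)]

/-- The integrands differ by at most 2 · π²/4, and the area (2π)² of the square cancels the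
prefactor. -/
lemma abs_coulombPotential_add_le (N : ℕ) :
    |coulombPotential ((N : ℤ), 0) + 1 / (4 * π ^ 2) * continuumIntegral N| ≤ π ^ 2 / 2 := by
  have hpi := pi_pos
  set D : Set (ℝ × ℝ) := Icc (-π) π ×ˢ Icc (-π) π with hD
  have hDm : MeasurableSet D := measurableSet_Icc.prod measurableSet_Icc
  set f : ℝ × ℝ → ℝ := fun p => (1 - cos (N * p.1)) *
    ((2 * (1 - cos p.1) + 2 * (1 - cos p.2))⁻¹ - (p.1 ^ 2 + p.2 ^ 2)⁻¹) with hf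
  have hfb : ∀ p ∈ D, ‖f p‖ ≤ π ^ 2 / 2 := fun p hp => by
    have h0 : |1 - cos (N * p.1)| ≤ 2 := by
      rw [abs_le]; constructor <;> linarith [cos_le_one (N * p.1), neg_one_le_cos (N * p.1)]
    rw [hf, norm_mul, norm_eq_abs, norm_eq_abs]
    calc _ ≤ 2 * (π ^ 2 / 4) := mul_le_mul h0 (abs_inv_sub_inv_le hp) (abs_nonneg _) zero_le_two
      _ = _ := by ring
  have hfi : IntegrableOn f D := by
    refine Measure.integrableOn_of_bounded (M := π ^ 2 / 2) volume_square_lt_top.ne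
      (Measurable.aestronglyMeasurable (by fun_prop)) ?_
    exact (ae_restrict_iff' hDm).2 (ae_of_all _ hfb)
  have hW : coulombPotential ((N : ℤ), 0) =
      -(1 / (4 * π ^ 2) * (∫ p in D, f p) + 1 / (4 * π ^ 2) * continuumIntegral N) := by
    rw [coulombPotential, continuumIntegral, ← mul_add,
      ← integral_add hfi (integrableOn_continuum N), ← mul_neg, ← integral_neg]
    congr 1
    · ring
    · refine integral_congr_ae (ae_of_all _ fun p => ?_)
      simp only [hf]
      push_cast
      rw [mul_zero, add_zero, mul_comm p.1]
      ring
  rw [hW, neg_add, add_assoc, neg_add_cancel, add_zero, abs_neg, abs_mul,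
    abs_of_pos (by positivity : 0 < 1 / (4 * π ^ 2))]
  have := norm_setIntegral_le_of_norm_le_const volume_square_lt_top hfb
  rw [volume_square_real, norm_eq_abs] at this
  calc _ ≤ 1 / (4 * π ^ 2) * (π ^ 2 / 2 * (4 * π ^ 2)) := by gcongr
    _ = _ := by field_simp

lemma integral_inv_sq_add_sq {p : ℝ} (hp : 0 < p) :
    ∫ x in (-π)..π, (p ^ 2 + x ^ 2)⁻¹ = 2 / p * arctan (π / p) := by
  have h : ∀ x, HasDerivAt (fun x => arctan (x / p) / p) ((p ^ 2 + x ^ 2)⁻¹) x := fun x => by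
    have := (((hasDerivAt_id x).div_const p).arctan).div_const p
    refine this.congr_deriv ?_
    simp only [id]
    field_simp
  rw [intervalIntegral.integral_eq_sub_of_hasDerivAt (fun x _ => h x)]
  · rw [neg_div, arctan_neg]; ring
  · refine Continuous.intervalIntegrable ?_ _ _
    exact Continuous.inv₀ (by fun_prop) fun x => by positivity

/-- From arctan(π/p) = π/2 - arctan(p/π): the correction to π/p is (2/p) arctan(p/π) ≤ 2/π. -/
lemma abs_inner_sub_le {p : ℝ} (hp : 0 < p) :
    |(∫ x in (-π)..π, (p ^ 2 + x ^ 2)⁻¹) - π / p| ≤ 1 := by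
  have hpi := pi_gt_three
  rw [integral_inv_sq_add_sq hp]
  have h1 : arctan (π / p) = π / 2 - arctan (p / π) := by
    rw [← inv_div, arctan_inv_of_pos (by positivity)]
  have h2 : arctan (p / π) ≤ p / π := by
    have := le_tan (arctan_nonneg.2 (by positivity : 0 ≤ p / π)) (arctan_lt_pi_div_two _)
    rwa [tan_arctan] at this
  have h3 : 0 ≤ arctan (p / π) := arctan_nonneg.2 (by positivity)
  have h4 : 2 / p * arctan (π / p) - π / p = -(2 / p * arctan (p / π)) := by
    rw [h1]; field_simp; ring
  rw [h4, abs_neg, abs_of_nonneg (by positivity)]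
  calc 2 / p * arctan (p / π) ≤ 2 / p * (p / π) := by gcongr
    _ = 2 / π := by field_simp
    _ ≤ 1 := by rw [div_le_one (by positivity)]; linarith

lemma norm_one_sub_cos_div_le (N : ℕ) (p : ℝ) : ‖(1 - cos (N * p)) / p‖ ≤ N ^ 2 * |p| := by
  have h0 : 0 ≤ 1 - cos (N * p) := by linarith [cos_le_one (N * p)]
  rw [norm_div, norm_eq_abs, norm_eq_abs, abs_of_nonneg h0]
  refine div_le_of_le_mul₀ (abs_nonneg _) (by positivity) ?_
  have := two_sub_cos_le (N * p)
  rw [mul_assoc, abs_mul_abs_self]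
  nlinarith [mul_nonneg (sq_nonneg (N : ℝ)) (sq_nonneg p)]

lemma intervalIntegrable_one_sub_cos_div (N : ℕ) (a b : ℝ) :
    IntervalIntegrable (fun p => (1 - cos (N * p)) / p) volume a b :=
  (Continuous.intervalIntegrable (u := fun p : ℝ => (N : ℝ) ^ 2 * |p|) (by fun_prop) a b).mono_fun
    (Measurable.aestronglyMeasurable (by fun_prop)) (ae_of_all _ fun p =>
      (norm_one_sub_cos_div_le N p).trans (le_abs_self _))

/-- Split at 1/N. Below, the integrand is at most N²p ≤ N, so the integral is at most 1. Above, 1/p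
gives log N + log π, and integration by parts bounds the oscillating part uniformly in N. The
constant is 1 + 2 + 3. -/
lemma abs_integral_one_sub_cos_div_le {N : ℕ} (hN : 1 ≤ N) :
    |(∫ p in (0 : ℝ)..π, (1 - cos (N * p)) / p) - log N| ≤ 6 := by
  have hpi := pi_gt_three
  have hpi4 := pi_le_four
  have hN0 : (1 : ℝ) ≤ N := by exact_mod_cast hN
  have hNp : (0 : ℝ) < N := by linarith
  have hinv : (N : ℝ)⁻¹ ≤ 1 := inv_le_one_of_one_le₀ hN0
  have hinv0 : (0 : ℝ) < (N : ℝ)⁻¹ := by positivity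
  have hb := norm_one_sub_cos_div_le N
  have hi := intervalIntegrable_one_sub_cos_div N
  have hne : ∀ p ∈ uIcc (N : ℝ)⁻¹ π, p ≠ 0 := fun p hp => by
    rw [uIcc_of_le (by linarith)] at hp
    linarith [hp.1]
  have hi1 : IntervalIntegrable (fun p : ℝ => p⁻¹) volume (N : ℝ)⁻¹ π :=
    (continuousOn_inv₀.mono fun p hp => hne p hp).intervalIntegrable
  have hi2 : IntervalIntegrable (fun p : ℝ => cos (N * p) * p⁻¹) volume (N : ℝ)⁻¹ π :=
    (ContinuousOn.mul (by fun_prop) (continuousOn_inv₀.mono fun p hp => hne p hp)).intervalIntegrable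
  have hi3 : IntervalIntegrable (fun p : ℝ => sin (N * p) * ((N : ℝ) * p ^ 2)⁻¹) volume (N : ℝ)⁻¹ π :=
    (ContinuousOn.mul (by fun_prop) (ContinuousOn.inv₀ (by fun_prop) fun p hp =>
      mul_ne_zero hNp.ne' (pow_ne_zero 2 (hne p hp)))).intervalIntegrable
  have h1 : |∫ p in (0 : ℝ)..(N : ℝ)⁻¹, (1 - cos (N * p)) / p| ≤ 1 := by
    have := intervalIntegral.norm_integral_le_of_norm_le_const (a := 0) (b := (N : ℝ)⁻¹)
      (f := fun p => (1 - cos (N * p)) / p) (C := N) fun p hp => by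
        rw [uIoc_of_le hinv0.le] at hp
        refine (hb p).trans ?_
        rw [abs_of_pos hp.1]
        calc (N : ℝ) ^ 2 * p ≤ N ^ 2 * (N : ℝ)⁻¹ := by gcongr; exact hp.2
          _ = (N : ℝ) := by field_simp
    rw [sub_zero, abs_of_pos hinv0, mul_inv_cancel₀ hNp.ne'] at this
    exact this
  have h2 : ∫ p in (N : ℝ)⁻¹..π, p⁻¹ = log N + log π := by
    rw [integral_inv_of_pos hinv0 (by linarith), div_inv_eq_mul, log_mul (by linarith) hNp.ne',
      add_comm]
  have h3 : |∫ p in (N : ℝ)⁻¹..π, cos (N * p) * p⁻¹| ≤ 3 := by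
    have hd : ∀ p ∈ uIcc (N : ℝ)⁻¹ π, HasDerivAt (fun p => sin (N * p) * (N * p)⁻¹)
        (cos (N * p) * p⁻¹ - sin (N * p) * ((N : ℝ) * p ^ 2)⁻¹) p := fun p hp => by
      have hp0 := hne p hp
      have e1 : HasDerivAt (fun p : ℝ => (N : ℝ) * p) N p := by
        simpa using (hasDerivAt_id p).const_mul (N : ℝ)
      refine ((e1.sin).mul (e1.fun_inv (mul_ne_zero hNp.ne' hp0))).congr_deriv ?_
      field_simp
      try ring
    have e := intervalIntegral.integral_eq_sub_of_hasDerivAt hd (hi2.sub hi3)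
    rw [intervalIntegral.integral_sub hi2 hi3, sub_eq_iff_eq_add] at e
    rw [e, mul_inv_cancel₀ hNp.ne', inv_one, mul_one]
    have hs : |∫ p in (N : ℝ)⁻¹..π, sin (N * p) * ((N : ℝ) * p ^ 2)⁻¹| ≤ 1 := by
      have hd2 : ∀ p ∈ uIcc (N : ℝ)⁻¹ π, HasDerivAt (fun p : ℝ => -((N : ℝ) * p)⁻¹)
          (((N : ℝ) * p ^ 2)⁻¹) p := fun p hp => by
        have hp0 := hne p hp
        have e1 : HasDerivAt (fun p : ℝ => (N : ℝ) * p) N p := by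
          simpa using (hasDerivAt_id p).const_mul (N : ℝ)
        refine ((e1.inv (mul_ne_zero hNp.ne' hp0)).neg).congr_deriv ?_
        field_simp
      have hi4 : IntervalIntegrable (fun p : ℝ => ((N : ℝ) * p ^ 2)⁻¹) volume (N : ℝ)⁻¹ π :=
        (ContinuousOn.inv₀ (by fun_prop) fun p hp =>
          mul_ne_zero hNp.ne' (pow_ne_zero 2 (hne p hp))).intervalIntegrable
      have := intervalIntegral.norm_integral_le_of_norm_le (by linarith)
        (f := fun p => sin (N * p) * ((N : ℝ) * p ^ 2)⁻¹) (ae_of_all _ fun p _ => ?_) hi4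
      · rw [intervalIntegral.integral_eq_sub_of_hasDerivAt hd2 hi4, norm_eq_abs,
          mul_inv_cancel₀ hNp.ne'] at this
        have h0 : 0 < ((N : ℝ) * π)⁻¹ := by positivity
        linarith
      · rw [norm_mul, norm_eq_abs, norm_eq_abs, abs_of_nonneg (by positivity : 0 ≤ ((N : ℝ) * p ^ 2)⁻¹)]
        exact mul_le_of_le_one_left (by positivity) (abs_sin_le_one _)
    -- The upper boundary term vanishes since N is an integer; the lower one is sin 1.
    have hA : |sin (N * π) * (N * π)⁻¹| ≤ 1 := by rw [sin_nat_mul_pi]; simp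
    have hB : |sin 1| ≤ 1 := abs_sin_le_one 1
    rw [abs_le] at *
    constructor <;> linarith [hs.1, hs.2, hA.1, hA.2, hB.1, hB.2]
  have hsplit : ∫ p in (0 : ℝ)..π, (1 - cos (N * p)) / p =
      (∫ p in (0 : ℝ)..(N : ℝ)⁻¹, (1 - cos (N * p)) / p) + ((log N + log π) -
        ∫ p in (N : ℝ)⁻¹..π, cos (N * p) * p⁻¹) := by
    rw [← h2, ← intervalIntegral.integral_sub hi1 hi2,
      ← intervalIntegral.integral_add_adjacent_intervals (hi 0 (N : ℝ)⁻¹) (hi _ π)]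
    congr 1
    refine intervalIntegral.integral_congr fun p _ => ?_
    ring
  have hlog : 0 ≤ log π := log_nonneg (by linarith)
  have hlog2 : log π ≤ 2 := by
    rw [log_le_iff_le_exp (by linarith)]
    have := add_one_le_exp (1 : ℝ)
    have h : exp 2 = exp 1 * exp 1 := by rw [← exp_add]; norm_num
    rw [h]; nlinarith
  rw [hsplit]
  rw [abs_le] at *
  constructor <;> linarith [h1.1, h1.2, h3.1, h3.2]

/-- Integrating first over the second momentum gives π/p up to a bounded error, which leaves twice π
times the one-dimensional logarithmic integral, by evenness in p. -/
lemma abs_continuumIntegral_sub_le {N : ℕ} (hN : 1 ≤ N) :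
    |continuumIntegral N - 2 * π * log N| ≤ 70 := by
  have hpi := pi_gt_three
  have hpi4 := pi_le_four
  set f : ℝ → ℝ := fun p => (1 - cos (N * p)) * ∫ x in (-π)..π, (p ^ 2 + x ^ 2)⁻¹ with hf
  have hI := integrableOn_continuum N
  rw [IntegrableOn, Measure.volume_eq_prod, ← Measure.prod_restrict] at hI
  have hfI : IntervalIntegrable f volume (-π) π := by
    have := hI.integral_prod_left
    rw [intervalIntegrable_iff_integrableOn_Icc_of_le (by linarith)]
    refine this.congr (ae_of_all _ fun p => ?_)
    simp only [hf]
    rw [integral_const_mul, intervalIntegral.integral_of_le (by linarith), integral_Icc_eq_integral_Ioc]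
  have hV : continuumIntegral N = ∫ p in (-π)..π, f p := by
    rw [continuumIntegral, Measure.volume_eq_prod, ← Measure.prod_restrict, integral_prod _ hI,
      intervalIntegral.integral_of_le (by linarith), integral_Icc_eq_integral_Ioc]
    refine integral_congr_ae (ae_of_all _ fun p => ?_)
    simp only [hf]
    rw [integral_const_mul, intervalIntegral.integral_of_le (by linarith), integral_Icc_eq_integral_Ioc]
  have heven : ∀ p, f (-p) = f p := fun p => by simp [hf]
  have hsub : Set.uIcc 0 π ⊆ Set.uIcc (-π) π := by
    rw [uIcc_of_le (by linarith), uIcc_of_le (by linarith)]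
    exact Icc_subset_Icc_left (by linarith)
  have hsub' : Set.uIcc (-π) 0 ⊆ Set.uIcc (-π) π := by
    rw [uIcc_of_le (by linarith), uIcc_of_le (by linarith)]
    exact Icc_subset_Icc_right (by linarith)
  have hhalf : ∫ p in (-π)..π, f p = 2 * ∫ p in (0 : ℝ)..π, f p := by
    rw [← intervalIntegral.integral_add_adjacent_intervals (hfI.mono_set hsub') (hfI.mono_set hsub),
      two_mul]
    congr 1
    have := intervalIntegral.integral_comp_neg (a := 0) (b := π) f
    rw [neg_zero] at this
    rw [← this]
    exact intervalIntegral.integral_congr fun p _ => heven p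
  have hk := abs_integral_one_sub_cos_div_le hN
  have hki := intervalIntegrable_one_sub_cos_div N 0 π
  have hdiff : |(∫ p in (0 : ℝ)..π, f p) - π * ∫ p in (0 : ℝ)..π, (1 - cos (N * p)) / p| ≤ 8 := by
    rw [← intervalIntegral.integral_const_mul,
      ← intervalIntegral.integral_sub (hfI.mono_set hsub) (hki.const_mul π)]
    have := intervalIntegral.norm_integral_le_of_norm_le_const (a := 0) (b := π)
      (f := fun p => f p - π * ((1 - cos (N * p)) / p)) (C := 2) fun p hp => by
        rw [uIoc_of_le (by linarith)] at hp
        have e : f p - π * ((1 - cos (N * p)) / p) = (1 - cos (N * p)) *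
            ((∫ x in (-π)..π, (p ^ 2 + x ^ 2)⁻¹) - π / p) := by
          simp only [hf]; ring
        have h0 : |1 - cos (N * p)| ≤ 2 := by
          rw [abs_le]; constructor <;> linarith [cos_le_one (N * p), neg_one_le_cos (N * p)]
        rw [e, norm_mul, norm_eq_abs, norm_eq_abs]
        calc _ ≤ (2 : ℝ) * 1 := mul_le_mul h0 (abs_inner_sub_le hp.1) (abs_nonneg _) zero_le_two
          _ = 2 := by norm_num
    rw [sub_zero, abs_of_pos (by linarith), norm_eq_abs] at this
    linarith
  rw [hV, hhalf]
  set a := ∫ p in (0 : ℝ)..π, f p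
  set b := ∫ p in (0 : ℝ)..π, (1 - cos (N * p)) / p
  have e : 2 * a - 2 * π * log N = 2 * (a - π * b) + 2 * π * (b - log N) := by ring
  rw [e]
  calc _ ≤ |2 * (a - π * b)| + |2 * π * (b - log N)| := abs_add_le _ _
    _ = 2 * |a - π * b| + 2 * π * |b - log N| := by
        rw [abs_mul, abs_mul, abs_of_pos (by norm_num : (0 : ℝ) < 2), abs_of_pos (by linarith : 0 < 2 * π)]
    _ ≤ 2 * 8 + 2 * 4 * 6 := by gcongr
    _ ≤ 70 := by norm_num

/-- The asymptotics of the lattice Coulomb potential along a coordinate axis. -/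
lemma abs_coulombPotential_add_log_le {N : ℕ} (hN : 1 ≤ N) :
    |coulombPotential ((N : ℤ), 0) + 1 / (2 * π) * log N| ≤ 78 := by
  have hpi := pi_gt_three
  have hpi4 := pi_le_four
  have h1 := abs_coulombPotential_add_le N
  have h2 := abs_continuumIntegral_sub_le hN
  have e : coulombPotential ((N : ℤ), 0) + 1 / (2 * π) * log N =
      (coulombPotential ((N : ℤ), 0) + 1 / (4 * π ^ 2) * continuumIntegral N) -
        1 / (4 * π ^ 2) * (continuumIntegral N - 2 * π * log N) := by
    field_simp; ring
  have h3 : 1 / (4 * π ^ 2) ≤ 1 := by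
    rw [div_le_one (by positivity)]; nlinarith
  rw [e]
  calc _ ≤ |coulombPotential ((N : ℤ), 0) + 1 / (4 * π ^ 2) * continuumIntegral N| +
        |1 / (4 * π ^ 2) * (continuumIntegral N - 2 * π * log N)| := abs_sub _ _
    _ ≤ π ^ 2 / 2 + 1 * 70 := by
        rw [abs_mul, abs_of_pos (by positivity : 0 < 1 / (4 * π ^ 2))]
        gcongr
    _ ≤ 78 := by nlinarith

variable {γ : ℕ} {C : ℕ → ℤ × ℤ → ℝ}

/-- Telescoping along the first axis with the bound on the first derivative. -/
lemma IsFiniteRangeDecomposition.exists_abs_sub_le (hC : IsFiniteRangeDecomposition γ C) :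
    ∃ c : ℝ, 0 ≤ c ∧ ∀ h N : ℕ, |C h ((N : ℤ), 0) - C h 0| ≤ N * (c * ((γ : ℝ) ^ h)⁻¹) := by
  obtain ⟨c, hc⟩ := hC.derivBound 1 le_rfl
  have hc0 : 0 ≤ c := by
    have := (abs_nonneg _).trans (hc 0 (fun _ => 0) 0)
    simpa using this
  refine ⟨c, hc0, fun h N => ?_⟩
  induction N with
  | zero => simp [Prod.zero_eq_mk]
  | succ N ih =>
    have h1 := hc h (fun _ => 0) ((N : ℤ), 0)
    simp only [List.ofFn_succ, List.ofFn_zero, latticeDeriv, unitVec, one_mul, Matrix.cons_val_zero,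
      Prod.mk_add_mk, add_zero] at h1
    have e : C h (((N + 1 : ℕ) : ℤ), 0) - C h 0 =
        (C h ((N : ℤ) + 1, 0) - C h ((N : ℤ), 0)) + (C h ((N : ℤ), 0) - C h 0) := by
      push_cast; ring
    rw [e]
    refine (abs_add_le _ _).trans ((add_le_add h1 ih).trans (le_of_eq ?_))
    push_cast; ring

/-- The variance of the field grows logarithmically with the scale. -/
lemma IsFiniteRangeDecomposition.exists_abs_sum_sub_le (hγ : 1 < γ)
    (hC : IsFiniteRangeDecomposition γ C) :
    ∃ B : ℝ, ∀ n : ℕ, |∑ h ∈ Finset.range n, C h 0 - 1 / (2 * π) * (n * log γ)| ≤ B := by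
  obtain ⟨c, hc0, hc⟩ := hC.exists_abs_sub_le
  have hγ2 : (2 : ℝ) ≤ γ := by exact_mod_cast hγ
  have hγ0 : (0 : ℝ) < γ := by linarith
  refine ⟨78 + 2 * c, fun n => ?_⟩
  -- Evaluate the decomposition at distance γⁿ. Scales h < n have range at most γⁿ/2, so each
  -- contributes exactly -C_h(0); scales h ≥ n vary by at most cγⁿ⁻ʰ over that distance, a geometric
  -- series with sum at most 2c.
  have hN : 1 ≤ γ ^ n := Nat.one_le_pow _ _ (by omega)
  have h1 := abs_coulombPotential_add_log_le hN
  have h2 := (hasSum_nat_add_iff' n).2 (hC.hasSum_coulomb (((γ ^ n : ℕ) : ℤ), 0))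
  have h3 : ∑ h ∈ Finset.range n, (C h (((γ ^ n : ℕ) : ℤ), 0) - C h 0) =
      -∑ h ∈ Finset.range n, C h 0 := by
    rw [← Finset.sum_neg_distrib]
    refine Finset.sum_congr rfl fun h hh => ?_
    rw [hC.finiteRange, zero_sub]
    have : γ ^ (h + 1) ≤ γ ^ n := Nat.pow_le_pow_right (by omega) (Finset.mem_range.1 hh)
    simp only [Int.natAbs_natCast, Int.natAbs_zero]
    omega
  have h4 : HasSum (fun i : ℕ => c * (1 / 2 : ℝ) ^ i) (c * 2) := hasSum_geometric_two.mul_left c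
  have h5 := h2.norm_le_of_bounded h4 fun i => by
    refine (hc (i + n) (γ ^ n)).trans ?_
    rw [pow_add]
    push_cast
    have e : (γ : ℝ) ^ n * (c * ((γ : ℝ) ^ i * (γ : ℝ) ^ n)⁻¹) = c * ((γ : ℝ) ^ i)⁻¹ := by
      field_simp
    rw [e, one_div, inv_pow]
    gcongr
  rw [h3, norm_eq_abs] at h5
  push_cast at h1 h5
  rw [log_pow] at h1
  rw [abs_le] at *
  constructor <;> linarith [h1.1, h1.2, h5.1, h5.2]

/-- Difference of two partial sums, each known up to an error independent of the scale; hence the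
constant `B` does not depend on M or j. -/
lemma IsFiniteRangeDecomposition.exists_scaleCov_zero_ge (hγ : 1 < γ)
    (hC : IsFiniteRangeDecomposition γ C) :
    ∃ B : ℝ, ∀ M j : ℕ, 1 / (2 * π) * (M * log γ) - B ≤ scaleCov C M j 0 := by
  obtain ⟨B, hB⟩ := hC.exists_abs_sum_sub_le hγ
  refine ⟨2 * B, fun M j => ?_⟩
  have h1 := hB (j * M)
  have h2 := hB ((j + 1) * M)
  rw [scaleCov, Finset.sum_Ico_eq_sub _ (by gcongr; omega)]
  push_cast at h1 h2
  rw [abs_le] at *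
  have e : 1 / (2 * π) * ((j + 1) * M * log γ) =
    1 / (2 * π) * (j * M * log γ) + 1 / (2 * π) * (M * log γ) := by ring
  linarith [h1.1, h1.2, h2.1, h2.2]

end Potential

/-! ### Geometry of blocks on the torus -/

section Lattice

variable {L R : ℕ}

/-- The site with given integer coordinates. -/
def ofInt (L R : ℕ) (a b : ℤ) : Site L R := ((a : ZMod (L ^ R)), (b : ZMod (L ^ R)))

lemma ofInt_add (a b a' b' : ℤ) : ofInt L R a b + ofInt L R a' b' = ofInt L R (a + a') (b + b') := by
  simp [ofInt]

lemma ofInt_sub (a b a' b' : ℤ) : ofInt L R a b - ofInt L R a' b' = ofInt L R (a - a') (b - b') := by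
  simp [ofInt]

lemma nsmul_ofInt (n : ℕ) (a b : ℤ) : n • ofInt L R a b = ofInt L R (n * a) (n * b) := by
  simp [ofInt]

lemma ofInt_zero : ofInt L R 0 0 = 0 := by simp [ofInt]

lemma ofInt_valMinAbs (x : Site L R) : ofInt L R x.1.valMinAbs x.2.valMinAbs = x := by
  simp [ofInt]

variable [NeZero L]

lemma natAbs_valMinAbs_intCast_le {n : ℕ} [NeZero n] (a : ℤ) :
    (a : ZMod n).valMinAbs.natAbs ≤ a.natAbs := by
  have h1 := (a : ZMod n).natAbs_valMinAbs_le
  by_cases h : 2 * a.natAbs < n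
  · have : (a : ZMod n).valMinAbs = a := (ZMod.valMinAbs_spec _ _).2 ⟨rfl, by
      constructor <;> omega⟩
    rw [this]
  · omega

lemma siteAbs_ofInt_le (a b : ℤ) : siteAbs (ofInt L R a b) ≤ max a.natAbs b.natAbs :=
  max_le_max (natAbs_valMinAbs_intCast_le a) (natAbs_valMinAbs_intCast_le b)

lemma siteAbs_ofInt {a b : ℤ} (ha : 2 * a.natAbs < L ^ R) (hb : 2 * b.natAbs < L ^ R) :
    siteAbs (ofInt L R a b) = max a.natAbs b.natAbs := by
  have : ∀ a : ℤ, 2 * a.natAbs < L ^ R → (a : ZMod (L ^ R)).valMinAbs = a := fun a ha =>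
    (ZMod.valMinAbs_spec _ _).2 ⟨rfl, by
      zify at ha
      constructor <;> push_cast <;> cases abs_cases a <;> omega⟩
  simp [siteAbs, ofInt, this a ha, this b hb]

lemma siteAbs_zero : siteAbs (0 : Site L R) = 0 := by simp [siteAbs]

lemma siteAbs_neg (x : Site L R) : siteAbs (-x) = siteAbs x := by
  simp [siteAbs, ZMod.natAbs_valMinAbs_neg]

lemma siteAbs_sub_comm (x y : Site L R) : siteAbs (x - y) = siteAbs (y - x) := by
  rw [← siteAbs_neg, neg_sub]

lemma siteAbs_add_le (x y : Site L R) : siteAbs (x + y) ≤ siteAbs x + siteAbs y := by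
  rw [← ofInt_valMinAbs x, ← ofInt_valMinAbs y, ofInt_add]
  refine (siteAbs_ofInt_le _ _).trans ?_
  rw [ofInt_valMinAbs, ofInt_valMinAbs]
  simp only [siteAbs]
  omega

lemma siteAbs_sub_le (x y z : Site L R) : siteAbs (x - z) ≤ siteAbs (x - y) + siteAbs (y - z) := by
  rw [← sub_add_sub_cancel x y z]; exact siteAbs_add_le _ _

lemma exists_ofInt (x c : Site L R) : ∃ a b : ℤ, x = c + ofInt L R a b ∧
    a.natAbs ≤ siteAbs (x - c) ∧ b.natAbs ≤ siteAbs (x - c) :=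
  ⟨(x - c).1.valMinAbs, (x - c).2.valMinAbs, by rw [ofInt_valMinAbs]; abel,
    le_max_left _ _, le_max_right _ _⟩

lemma mem_block {j : ℕ} {x c : Site L R} : x ∈ block j c ↔ 2 * siteAbs (x - c) ≤ L ^ j := by
  simp [block]

/-- By parity 2|x - c| cannot equal the odd number L^j; the strict form is what makes neighbouring
blocks disjoint. -/
lemma mem_block_odd (hL : Odd L) {j : ℕ} {x c : Site L R} :
    x ∈ block j c ↔ 2 * siteAbs (x - c) + 1 ≤ L ^ j := by
  have h : Odd (L ^ j) := hL.pow
  rw [mem_block]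
  obtain ⟨k, hk⟩ := h
  omega

lemma center_mem_block (j : ℕ) (c : Site L R) : c ∈ block j c := by
  rw [mem_block, sub_self, siteAbs_zero]; simp

/-- The points of `L^j ℤ²`. -/
def IsCenter (j : ℕ) (c : Site L R) : Prop := ∃ v : Site L R, c = (L ^ j) • v

lemma mem_blocks {j : ℕ} {B : Finset (Site L R)} :
    B ∈ blocks j ↔ ∃ c : Site L R, IsCenter j c ∧ B = block j c := by
  simp only [blocks, Finset.mem_image, Finset.mem_univ, true_and, IsCenter]
  constructor
  · rintro ⟨v, rfl⟩; exact ⟨_, ⟨v, rfl⟩, rfl⟩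
  · rintro ⟨c, ⟨v, rfl⟩, rfl⟩; exact ⟨v, rfl⟩

lemma IsCenter.add {j : ℕ} {c d : Site L R} (hc : IsCenter j c) (hd : IsCenter j d) :
    IsCenter j (c + d) := by
  obtain ⟨v, rfl⟩ := hc; obtain ⟨w, rfl⟩ := hd
  exact ⟨v + w, by rw [nsmul_add]⟩

lemma IsCenter.sub {j : ℕ} {c d : Site L R} (hc : IsCenter j c) (hd : IsCenter j d) :
    IsCenter j (c - d) := by
  obtain ⟨v, rfl⟩ := hc; obtain ⟨w, rfl⟩ := hd
  exact ⟨v - w, by rw [nsmul_sub]⟩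

/-- Division with remainder of least absolute value by an odd number. -/
lemma exists_mul_add_odd {s : ℕ} (hs : Odd s) (m : ℤ) :
    ∃ a u : ℤ, m = s * a + u ∧ 2 * u.natAbs + 1 ≤ s := by
  obtain ⟨r, rfl⟩ := hs
  refine ⟨(m + r) / (2 * r + 1 : ℕ), (m + r) % (2 * r + 1 : ℕ) - r, ?_, ?_⟩
  · have := Int.mul_ediv_add_emod (m + r) (2 * r + 1 : ℕ)
    linarith
  · have h1 := Int.emod_nonneg (m + r) (b := (2 * r + 1 : ℕ)) (by positivity)
    have h2 := Int.emod_lt_of_pos (m + r) (b := (2 * r + 1 : ℕ)) (by positivity)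
    omega

lemma exists_mem_blocks (hL : Odd L) (j : ℕ) (x : Site L R) :
    ∃ c : Site L R, IsCenter j c ∧ x ∈ block j c := by
  obtain ⟨a, u, ha, hu⟩ := exists_mul_add_odd (hL.pow (n := j)) x.1.valMinAbs
  obtain ⟨b, v, hb, hv⟩ := exists_mul_add_odd (hL.pow (n := j)) x.2.valMinAbs
  refine ⟨ofInt L R ((L ^ j : ℕ) * a) ((L ^ j : ℕ) * b), ⟨ofInt L R a b, (nsmul_ofInt _ _ _).symm⟩, ?_⟩
  rw [mem_block_odd hL]
  have : x - ofInt L R ((L ^ j : ℕ) * a) ((L ^ j : ℕ) * b) = ofInt L R u v := by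
    conv_lhs => rw [← ofInt_valMinAbs x]
    rw [ofInt_sub, ha, hb]
    congr 1 <;> ring
  rw [this]
  have := siteAbs_ofInt_le (L := L) (R := R) u v
  omega

/-- Since j ≤ R, the number L^j divides the period L^R, so divisibility by L^j passes to
representatives. -/
lemma dvd_valMinAbs {j : ℕ} (hj : j ≤ R) (w : ZMod (L ^ R)) :
    ((L ^ j : ℕ) : ℤ) ∣ ((L ^ j) • w).valMinAbs := by
  have h1 : ((((L ^ j) • w).valMinAbs : ℤ) : ZMod (L ^ R)) = (((L ^ j : ℕ) * w.valMinAbs : ℤ) : ZMod (L ^ R)) := by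
    rw [ZMod.coe_valMinAbs]
    push_cast
    simp
  rw [ZMod.intCast_eq_intCast_iff_dvd_sub] at h1
  have h2 : ((L ^ j : ℕ) : ℤ) ∣ ((L ^ R : ℕ) : ℤ) := by
    exact_mod_cast pow_dvd_pow L hj
  exact (dvd_sub_right (Dvd.intro _ rfl)).1 (h2.trans h1)

lemma IsCenter.eq_zero {j : ℕ} (hj : j ≤ R) {c : Site L R} (hc : IsCenter j c)
    (h : siteAbs c < L ^ j) : c = 0 := by
  obtain ⟨v, rfl⟩ := hc
  have h1 := dvd_valMinAbs hj v.1
  have h2 := dvd_valMinAbs hj v.2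
  simp only [siteAbs, Prod.smul_fst, Prod.smul_snd] at h
  have e1 : ((L ^ j) • v.1).valMinAbs = 0 := Int.eq_zero_of_abs_lt_dvd h1 (by
    rw [← Int.natCast_natAbs]; exact_mod_cast (le_max_left _ _).trans_lt h)
  have e2 : ((L ^ j) • v.2).valMinAbs = 0 := Int.eq_zero_of_abs_lt_dvd h2 (by
    rw [← Int.natCast_natAbs]; exact_mod_cast (le_max_right _ _).trans_lt h)
  rw [ZMod.valMinAbs_eq_zero] at e1 e2
  exact Prod.ext e1 e2

/-- Distinct blocks are disjoint. -/
lemma center_unique (hL : Odd L) {j : ℕ} (hj : j ≤ R) {c d x : Site L R} (hc : IsCenter j c)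
    (hd : IsCenter j d) (hxc : x ∈ block j c) (hxd : x ∈ block j d) : c = d := by
  rw [mem_block_odd hL] at hxc hxd
  have h := siteAbs_sub_le c x d
  rw [siteAbs_sub_comm c x] at h
  exact sub_eq_zero.1 ((hc.sub hd).eq_zero hj (by omega))

lemma block_unique (hL : Odd L) {j : ℕ} (hj : j ≤ R) {B D : Finset (Site L R)} {x : Site L R}
    (hB : B ∈ blocks j) (hD : D ∈ blocks j) (hxB : x ∈ B) (hxD : x ∈ D) : B = D := by
  obtain ⟨c, hc, rfl⟩ := mem_blocks.1 hB
  obtain ⟨d, hd, rfl⟩ := mem_blocks.1 hD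
  rw [center_unique hL hj hc hd hxB hxD]

lemma mem_blocksOf {j : ℕ} {X B : Finset (Site L R)} : B ∈ blocksOf j X ↔ B ∈ blocks j ∧ B ⊆ X := by
  simp [blocksOf]

lemma nonempty_of_mem_blocks {j : ℕ} {B : Finset (Site L R)} (hB : B ∈ blocks j) : B.Nonempty := by
  obtain ⟨c, _, rfl⟩ := mem_blocks.1 hB
  exact ⟨c, center_mem_block j c⟩

lemma IsPolymer.exists_mem {j : ℕ} {X : Finset (Site L R)} (hX : IsPolymer j X) {x : Site L R}
    (hx : x ∈ X) : ∃ B ∈ blocksOf j X, x ∈ B := by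
  obtain ⟨S, hS, rfl⟩ := hX
  obtain ⟨B, hB, hxB⟩ := Finset.mem_biUnion.1 hx
  exact ⟨B, mem_blocksOf.2 ⟨hS hB, Finset.subset_biUnion_of_mem id hB⟩, hxB⟩

/-- The block of a point of a polymer belongs to the polymer. -/
lemma IsPolymer.block_mem (hL : Odd L) {j : ℕ} (hj : j ≤ R) {X B : Finset (Site L R)}
    (hX : IsPolymer j X) {x : Site L R} (hx : x ∈ X) (hB : B ∈ blocks j) (hxB : x ∈ B) :
    B ∈ blocksOf j X := by
  obtain ⟨D, hD, hxD⟩ := hX.exists_mem hx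
  rwa [block_unique hL hj hB (mem_blocksOf.1 hD).1 hxB hxD]

lemma touch_symm {B D : Finset (Site L R)} (h : Touch B D) : Touch D B := by
  obtain ⟨x, hx, y, hy, h⟩ := h
  exact ⟨y, hy, x, hx, by rw [siteAbs_sub_comm, h]⟩

/-- With L^j = 2r + 1 the distance is at most 2r + 1 + r, so a touching block fits in the concentric
square of side 3L^j. -/
lemma Touch.siteAbs_le (hL : Odd L) {j : ℕ} {c d x : Site L R}
    (h : Touch (block j c) (block j d)) (hx : x ∈ block j d) :
    2 * siteAbs (x - c) + 1 ≤ 3 * L ^ j := by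
  obtain ⟨p, hp, q, hq, hpq⟩ := h
  rw [mem_block_odd hL] at hx hp hq
  have h1 := siteAbs_sub_le x d c
  have h2 := siteAbs_sub_le d q c
  have h3 := siteAbs_sub_le q p c
  rw [siteAbs_sub_comm d q] at h2
  rw [siteAbs_sub_comm q p] at h3
  omega

/-- The blocks that meet the square of side `3 L^j` around a block are the block itself and
those that touch it. -/
lemma exists_touch_of_siteAbs_le (hL : Odd L) (hLR : 3 ≤ L ^ R) {j : ℕ} {c x : Site L R}
    (hc : IsCenter j c) (hx : 2 * siteAbs (x - c) + 1 ≤ 3 * L ^ j) :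
    ∃ d, IsCenter j d ∧ x ∈ block j d ∧ (d = c ∨ Touch (block j c) (block j d)) := by
  obtain ⟨m, n, hxc, hm, hn⟩ := exists_ofInt x c
  obtain ⟨a, u, ha, hu⟩ := exists_mul_add_odd (hL.pow (n := j)) m
  obtain ⟨b, v, hb, hv⟩ := exists_mul_add_odd (hL.pow (n := j)) n
  obtain ⟨r, hr⟩ := hL.pow (n := j)
  -- Inside a square of side 3L^j the centre of the block of `x` is displaced by -1, 0 or 1
  -- multiples of L^j in each coordinate.
  have hone : ∀ a m u : ℤ, m = ((L ^ j : ℕ) : ℤ) * a + u → 2 * u.natAbs + 1 ≤ L ^ j →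
      2 * m.natAbs + 1 ≤ 3 * L ^ j → a = -1 ∨ a = 0 ∨ a = 1 := by
    intro a m u h1 h2 h3
    rw [hr] at h1 h2 h3
    have : a.natAbs ≤ 1 := by
      by_contra h
      have h4 : (2 * (2 * r + 1) : ℤ) ≤ |((2 * r + 1 : ℕ) : ℤ) * a| := by
        rw [abs_mul, abs_of_nonneg (by positivity), mul_comm]
        push_cast
        gcongr
        rw [← Int.natCast_natAbs]; omega
      have h5 : ((2 * r + 1 : ℕ) : ℤ) * a = m - u := by omega
      rw [h5] at h4
      cases abs_cases (m - u) <;> omega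
    omega
  have ha1 := hone a m u ha hu (by omega)
  have hb1 := hone b n v hb hv (by omega)
  have hcd : IsCenter j (c + ofInt L R ((L ^ j : ℕ) * a) ((L ^ j : ℕ) * b)) :=
    hc.add ⟨ofInt L R a b, (nsmul_ofInt _ _ _).symm⟩
  refine ⟨_, hcd, ?_, ?_⟩
  · rw [mem_block_odd hL, hxc, add_sub_add_left_eq_sub, ofInt_sub]
    have := siteAbs_ofInt_le (L := L) (R := R) (m - (L ^ j : ℕ) * a) (n - (L ^ j : ℕ) * b)
    rw [ha, hb] at this ⊢
    simp only [add_sub_cancel_left] at this ⊢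
    omega
  · by_cases h0 : a = 0 ∧ b = 0
    · left; rw [h0.1, h0.2]; simp [ofInt_zero]
    right
    -- The last point of one block and the first of the other in the direction (a, b). They differ
    -- by (a, b), whose distance is 1 because the side of the torus is at least 3.
    refine ⟨c + ofInt L R (a * r) (b * r), ?_, c + ofInt L R (a * (r + 1)) (b * (r + 1)), ?_, ?_⟩
    · rw [mem_block_odd hL, add_sub_cancel_left]
      have := siteAbs_ofInt_le (L := L) (R := R) (a * r) (b * r)
      have e1 : (a * r).natAbs ≤ r := by rcases ha1 with h | h | h <;> simp [h]
      have e2 : (b * r).natAbs ≤ r := by rcases hb1 with h | h | h <;> simp [h]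
      omega
    · rw [mem_block_odd hL, add_sub_add_left_eq_sub, ofInt_sub]
      have := siteAbs_ofInt_le (L := L) (R := R) (a * (r + 1) - (L ^ j : ℕ) * a)
        (b * (r + 1) - (L ^ j : ℕ) * b)
      rw [hr] at this ⊢
      have e1 : (a * (r + 1) - (2 * r + 1 : ℕ) * a).natAbs ≤ r := by
        rcases ha1 with h | h | h <;> simp only [h] <;> omega
      have e2 : (b * (r + 1) - (2 * r + 1 : ℕ) * b).natAbs ≤ r := by
        rcases hb1 with h | h | h <;> simp only [h] <;> omega
      omega
    · rw [add_sub_add_left_eq_sub, ofInt_sub, siteAbs_ofInt]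
      · rcases ha1 with h | h | h <;> rcases hb1 with h' | h' | h' <;> simp_all
      · rcases ha1 with h | h | h <;> simp only [h] <;> omega
      · rcases hb1 with h | h | h <;> simp only [h] <;> omega

end Lattice

/-! ### Small polymers and oscillation estimates on their neighbourhoods -/

section SmallPolymers

variable {L R : ℕ} [NeZero L]

lemma IsPolymer.union {j : ℕ} {X Z : Finset (Site L R)} (hX : IsPolymer j X) (hZ : IsPolymer j Z) :
    IsPolymer j (X ∪ Z) := by
  classical
  obtain ⟨S, hS, rfl⟩ := hX
  obtain ⟨T, hT, rfl⟩ := hZ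
  exact ⟨S ∪ T, Finset.union_subset hS hT, by rw [Finset.union_biUnion]⟩

lemma isPolymer_of_mem_blocks {j : ℕ} {B : Finset (Site L R)} (hB : B ∈ blocks j) :
    IsPolymer j B := ⟨{B}, by simpa using hB, by simp⟩

lemma blocksOf_block (hL : Odd L) {j : ℕ} (hj : j ≤ R) {B : Finset (Site L R)}
    (hB : B ∈ blocks j) : blocksOf j B = {B} := by
  ext D
  rw [mem_blocksOf, Finset.mem_singleton]
  constructor
  · rintro ⟨hD, hDB⟩
    obtain ⟨x, hx⟩ := nonempty_of_mem_blocks hD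
    exact block_unique hL hj hD hB hx (hDB hx)
  · rintro rfl; exact ⟨hB, subset_rfl⟩

lemma blocksOf_union_block (hL : Odd L) {j : ℕ} (hj : j ≤ R) {Z B : Finset (Site L R)}
    (hZ : IsPolymer j Z) (hB : B ∈ blocks j) : blocksOf j (Z ∪ B) = insert B (blocksOf j Z) := by
  ext D
  rw [mem_blocksOf, Finset.mem_insert, mem_blocksOf]
  constructor
  · rintro ⟨hD, hDZ⟩
    obtain ⟨x, hx⟩ := nonempty_of_mem_blocks hD
    rcases Finset.mem_union.1 (hDZ hx) with h | h
    · right; exact mem_blocksOf.1 (hZ.block_mem hL hj h hD hx)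
    · left; exact block_unique hL hj hD hB hx h
  · rintro (rfl | ⟨hD, hDZ⟩)
    · exact ⟨hB, Finset.subset_union_right⟩
    · exact ⟨hD, hDZ.trans Finset.subset_union_left⟩

/-- `B` belongs to a connected polymer with at most `n` blocks that meets `X`. -/
def IsNear (j n : ℕ) (X B : Finset (Site L R)) : Prop :=
  ∃ Z, IsConnectedPolymer j Z ∧ B ∈ blocksOf j Z ∧ (Z ∩ X).Nonempty ∧ (blocksOf j Z).card ≤ n

lemma isNear_one (hL : Odd L) {j : ℕ} (hj : j ≤ R) {X B : Finset (Site L R)} (hB : B ∈ blocks j)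
    (hBX : (B ∩ X).Nonempty) : IsNear j 1 X B := by
  have hb := blocksOf_block hL hj hB
  refine ⟨B, ⟨isPolymer_of_mem_blocks hB, nonempty_of_mem_blocks hB, ?_⟩, ?_, hBX, ?_⟩
  · rw [hb]
    intro D hD E hE
    rw [Finset.mem_singleton] at hD hE
    rw [hD, hE]
  · rw [hb]; simp
  · rw [hb]; simp

lemma IsNear.mono {j n m : ℕ} (hnm : n ≤ m) {X B : Finset (Site L R)} (h : IsNear j n X B) :
    IsNear j m X B := by
  obtain ⟨Z, h1, h2, h3, h4⟩ := h
  exact ⟨Z, h1, h2, h3, h4.trans hnm⟩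

/-- Append the new block to the connected polymer; every other block reaches it through `B`. -/
lemma IsNear.touch (hL : Odd L) {j n : ℕ} (hj : j ≤ R) {X B D : Finset (Site L R)}
    (h : IsNear j n X B) (hD : D ∈ blocks j) (hBD : Touch B D) : IsNear j (n + 1) X D := by
  obtain ⟨Z, ⟨hZ, hne, hconn⟩, hBZ, hZX, hcard⟩ := h
  have hu := blocksOf_union_block hL hj hZ hD
  have hlift : ∀ P Q, Relation.ReflTransGen (fun P Q => Q ∈ blocksOf j Z ∧ Touch P Q) P Q →
      Relation.ReflTransGen (fun P Q => Q ∈ blocksOf j (Z ∪ D) ∧ Touch P Q) P Q := by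
    intro P Q hPQ
    exact hPQ.lift id fun a b hab =>
      ⟨by rw [hu]; exact Finset.mem_insert_of_mem hab.1, hab.2⟩
  refine ⟨Z ∪ D, ⟨hZ.union (isPolymer_of_mem_blocks hD), hne.mono Finset.subset_union_left, ?_⟩,
    ?_, ?_, ?_⟩
  · intro P hP Q hQ
    have hPB : Relation.ReflTransGen (fun P Q => Q ∈ blocksOf j (Z ∪ D) ∧ Touch P Q) P B := by
      rw [hu] at hP
      rcases Finset.mem_insert.1 hP with rfl | hP
      · refine Relation.ReflTransGen.single ⟨?_, touch_symm hBD⟩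
        rw [hu]; exact Finset.mem_insert_of_mem hBZ
      · exact hlift _ _ (hconn _ hP _ hBZ)
    refine hPB.trans ?_
    rw [hu] at hQ
    rcases Finset.mem_insert.1 hQ with rfl | hQ
    · refine Relation.ReflTransGen.single ⟨?_, hBD⟩
      rw [hu]; exact Finset.mem_insert_self _ _
    · exact hlift _ _ (hconn _ hBZ _ hQ)
  · rw [hu]; exact Finset.mem_insert_self _ _
  · exact hZX.mono (Finset.inter_subset_inter_right Finset.subset_union_left)
  · rw [hu]; exact (Finset.card_insert_le _ _).trans (by omega)

lemma IsNear.subset_smallNbhd {j : ℕ} {X B : Finset (Site L R)} (h : IsNear j 4 X B) :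
    B ⊆ smallNbhd j X := by
  classical
  obtain ⟨Z, h1, h2, h3, h4⟩ := h
  intro x hx
  simp only [smallNbhd, Finset.mem_filter, Finset.mem_univ, true_and]
  refine ⟨Z, ⟨h1, h4⟩, ?_, (mem_blocksOf.1 h2).2 hx⟩
  convert h3

/-- Small polymers have up to four blocks, so a block reached with three leaves room for any block
that touches it. Hence the whole square of side 3L^j around it lies in the neighbourhood. -/
lemma IsNear.mem_smallNbhd (hL : Odd L) (hLR : 3 ≤ L ^ R) {j : ℕ} (hj : j ≤ R)
    {X : Finset (Site L R)} {c x : Site L R} (hc : IsCenter j c) (h : IsNear j 3 X (block j c))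
    (hx : 2 * siteAbs (x - c) + 1 ≤ 3 * L ^ j) : x ∈ smallNbhd j X := by
  obtain ⟨d, hd, hxd, rfl | ht⟩ := exists_touch_of_siteAbs_le hL hLR hc hx
  · exact (h.mono (by norm_num)).subset_smallNbhd hxd
  · exact (h.touch hL hj (mem_blocks.2 ⟨d, hd, rfl⟩) ht).subset_smallNbhd hxd

lemma IsPolymer.subset_smallNbhd (hL : Odd L) {j : ℕ} (hj : j ≤ R) {X : Finset (Site L R)}
    (hX : IsPolymer j X) : X ⊆ smallNbhd j X := by
  intro x hx
  obtain ⟨B, hB, hxB⟩ := hX.exists_mem hx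
  exact ((isNear_one hL hj (mem_blocksOf.1 hB).1
    ⟨x, Finset.mem_inter.2 ⟨hxB, hx⟩⟩).mono (by norm_num)).subset_smallNbhd hxB

/-- A function with small steps on a square varies little on it. -/
lemma norm_sub_le_of_step {E : Type*} [NormedAddCommGroup E] {g : Site L R → E} {m : ℝ}
    {c : Site L R} {ρ : ℕ}
    (hstep : ∀ x, siteAbs (x - c) ≤ ρ → ∀ μ, ‖g (x + unitVec (ZMod (L ^ R)) μ) - g x‖ ≤ m)
    {x y : Site L R} (hx : siteAbs (x - c) ≤ ρ) (hy : siteAbs (y - c) ≤ ρ) :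
    ‖g x - g y‖ ≤ 4 * ρ * m := by
  have hm : 0 ≤ m := (norm_nonneg _).trans (hstep x hx 0)
  have hbox : ∀ {u v : ℤ}, u.natAbs ≤ ρ → v.natAbs ≤ ρ →
      siteAbs (c + ofInt L R u v - c) ≤ ρ := fun hu hv => by
    rw [add_sub_cancel_left]
    exact (siteAbs_ofInt_le _ _).trans (max_le hu hv)
  have e0 : ∀ u v : ℤ, c + ofInt L R u v + unitVec (ZMod (L ^ R)) 0 = c + ofInt L R (u + 1) v := by
    intro u v; simp [ofInt, unitVec, add_assoc]
  have e1 : ∀ u v : ℤ, c + ofInt L R u v + unitVec (ZMod (L ^ R)) 1 = c + ofInt L R u (v + 1) := by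
    intro u v; simp [ofInt, unitVec, add_assoc]
  have e2 : ∀ u v : ℤ, c + ofInt L R u v + unitVec (ZMod (L ^ R)) 2 = c + ofInt L R (u - 1) v := by
    intro u v; simp [ofInt, unitVec, add_assoc, sub_eq_add_neg]
  have e3 : ∀ u v : ℤ, c + ofInt L R u v + unitVec (ZMod (L ^ R)) 3 = c + ofInt L R u (v - 1) := by
    intro u v; simp [ofInt, unitVec, add_assoc, sub_eq_add_neg]
  -- Walk horizontally and then vertically to the centre without leaving the square: at most 2ρ
  -- steps from each of the two points.
  have h1 : ∀ (n : ℕ) (v : ℤ), v.natAbs ≤ ρ → n ≤ ρ →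
      ‖g (c + ofInt L R n v) - g (c + ofInt L R 0 v)‖ ≤ n * m ∧
      ‖g (c + ofInt L R (-n) v) - g (c + ofInt L R 0 v)‖ ≤ n * m := by
    intro n v hv
    induction n with
    | zero => intro _; simp
    | succ n ih =>
      intro hn
      obtain ⟨i1, i2⟩ := ih (by omega)
      have s1 := hstep _ (hbox (u := n) (v := v) (by omega) hv) 0
      have s2 := hstep _ (hbox (u := -n) (v := v) (by omega) hv) 2
      rw [e0] at s1
      rw [e2] at s2
      push_cast
      rw [neg_add', add_mul, one_mul, add_comm (_ * m)]
      exact ⟨(norm_sub_le_norm_sub_add_norm_sub _ _ _).trans (add_le_add s1 i1),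
        (norm_sub_le_norm_sub_add_norm_sub _ _ _).trans (add_le_add s2 i2)⟩
  have h2 : ∀ (n : ℕ), n ≤ ρ →
      ‖g (c + ofInt L R 0 n) - g (c + ofInt L R 0 0)‖ ≤ n * m ∧
      ‖g (c + ofInt L R 0 (-n)) - g (c + ofInt L R 0 0)‖ ≤ n * m := by
    intro n
    induction n with
    | zero => intro _; simp
    | succ n ih =>
      intro hn
      obtain ⟨i1, i2⟩ := ih (by omega)
      have s1 := hstep _ (hbox (u := 0) (v := n) (by omega) (by omega)) 1
      have s2 := hstep _ (hbox (u := 0) (v := -n) (by omega) (by omega)) 3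
      rw [e1] at s1
      rw [e3] at s2
      push_cast
      rw [neg_add', add_mul, one_mul, add_comm (_ * m)]
      exact ⟨(norm_sub_le_norm_sub_add_norm_sub _ _ _).trans (add_le_add s1 i1),
        (norm_sub_le_norm_sub_add_norm_sub _ _ _).trans (add_le_add s2 i2)⟩
  have hc : ∀ x, siteAbs (x - c) ≤ ρ → ‖g x - g (c + ofInt L R 0 0)‖ ≤ 2 * ρ * m := by
    intro x hx
    obtain ⟨u, v, rfl, hu, hv⟩ := exists_ofInt x c
    have hu' := hu.trans hx
    have hv' := hv.trans hx
    have b1 : ‖g (c + ofInt L R u v) - g (c + ofInt L R 0 v)‖ ≤ ρ * m := by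
      have hle : (u.natAbs : ℝ) * m ≤ ρ * m := by gcongr
      rcases Int.natAbs_eq u with h | h
      · rw [h]; exact ((h1 _ v hv' hu').1).trans (by simpa using hle)
      · rw [h]; exact ((h1 _ v hv' hu').2).trans (by simpa using hle)
    have b2 : ‖g (c + ofInt L R 0 v) - g (c + ofInt L R 0 0)‖ ≤ ρ * m := by
      have hle : (v.natAbs : ℝ) * m ≤ ρ * m := by gcongr
      rcases Int.natAbs_eq v with h | h
      · rw [h]; exact ((h2 _ hv').1).trans (by simpa using hle)
      · rw [h]; exact ((h2 _ hv').2).trans (by simpa using hle)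
    calc _ ≤ _ := norm_sub_le_norm_sub_add_norm_sub _ (g (c + ofInt L R 0 v)) _
      _ ≤ ρ * m + ρ * m := add_le_add b1 b2
      _ = _ := by ring
  have b1 := hc x hx
  have b2 := hc y hy
  rw [norm_sub_rev] at b2
  calc _ ≤ _ := norm_sub_le_norm_sub_add_norm_sub _ (g (c + ofInt L R 0 0)) _
    _ ≤ 2 * ρ * m + 2 * ρ * m := add_le_add b1 b2
    _ = _ := by ring

/-- `b` can be reached from `a` in at most `n` steps. -/
def ReachWithin {α : Type*} (r : α → α → Prop) (a : α) : ℕ → α → Prop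
  | 0, b => b = a
  | n + 1, b => ReachWithin r a n b ∨ ∃ c, ReachWithin r a n c ∧ r c b

lemma reachWithin_mono {α : Type*} {r : α → α → Prop} {a b : α} {n m : ℕ} (hnm : n ≤ m)
    (h : ReachWithin r a n b) : ReachWithin r a m b := by
  induction m, hnm using Nat.le_induction with
  | base => exact h
  | succ m _ ih => exact Or.inl ih

/-- In a finite set everything reachable is reachable in few steps. -/
lemma reachWithin_of_reflTransGen {α : Type*} {r : α → α → Prop} {s : Finset α} {a b : α}
    (ha : a ∈ s) (hr : ∀ x y, r x y → y ∈ s) (h : Relation.ReflTransGen r a b) {n : ℕ}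
    (hn : s.card ≤ n + 1) : ReachWithin r a n b := by
  classical
  have hmem : ∀ n x, ReachWithin r a n x → x ∈ s := by
    intro n
    induction n with
    | zero => intro x hx; rw [show x = a from hx]; exact ha
    | succ n ih =>
      rintro x (hx | ⟨c, _, hc⟩)
      · exact ih x hx
      · exact hr _ _ hc
  -- Either the set reached has stabilized or each further step adds at least one element of `s`.
  have key : ∀ n, (∀ b, Relation.ReflTransGen r a b → ReachWithin r a n b) ∨
      n + 1 ≤ (s.filter (ReachWithin r a n)).card := by
    intro n
    induction n with
    | zero =>
      right
      exact Finset.card_pos.2 ⟨a, Finset.mem_filter.2 ⟨ha, rfl⟩⟩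
    | succ n ih =>
      rcases ih with ih | ih
      · exact Or.inl fun b hb => Or.inl (ih b hb)
      by_cases hcl : ∀ x y, ReachWithin r a n x → r x y → ReachWithin r a n y
      · left
        intro b hb
        induction hb with
        | refl => exact reachWithin_mono (Nat.zero_le _) rfl
        | tail _ hbc ih' =>
          rcases ih' with h' | ⟨c, hc, hcb⟩
          · exact Or.inr ⟨_, h', hbc⟩
          · exact Or.inr ⟨_, hcl _ _ hc hcb, hbc⟩
      · right
        push Not at hcl
        obtain ⟨x, y, hx, hxy, hy⟩ := hcl
        refine Nat.succ_le_of_lt (ih.trans_lt (Finset.card_lt_card ?_))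
        refine (Finset.ssubset_iff_of_subset fun z hz => ?_).2 ⟨y, ?_, ?_⟩
        · rw [Finset.mem_filter] at hz ⊢; exact ⟨hz.1, Or.inl hz.2⟩
        · exact Finset.mem_filter.2 ⟨hr _ _ hxy, Or.inr ⟨x, hx, hxy⟩⟩
        · simp [hy]
  rcases key n with h' | h'
  · exact h' b h
  · have : s.filter (ReachWithin r a n) = s :=
      Finset.eq_of_subset_of_card_le (Finset.filter_subset _ _) (by omega)
    have hb : b ∈ s := by
      rcases Relation.ReflTransGen.cases_tail h with h0 | ⟨c, _, hc⟩
      · rw [h0]; exact ha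
      · exact hr _ _ hc
    rw [← this] at hb
    exact (Finset.mem_filter.1 hb).2

/-- On the small set neighbourhood of a small polymer a function with small steps varies little. -/
lemma IsSmall.norm_sub_le (hL : Odd L) (hLR : 3 ≤ L ^ R) {j : ℕ} (hj : j ≤ R)
    {X : Finset (Site L R)} (hX : IsSmall j X) {E : Type*} [NormedAddCommGroup E]
    {g : Site L R → E} {m : ℝ}
    (hstep : ∀ x ∈ smallNbhd j X, ∀ μ, ‖g (x + unitVec (ZMod (L ^ R)) μ) - g x‖ ≤ m)
    {x x₀ : Site L R} (hx : x ∈ smallNbhd j X) (hx₀ : x₀ ∈ X) :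
    ‖g x - g x₀‖ ≤ 48 * L ^ j * m := by
  classical
  have hm : 0 ≤ m := (norm_nonneg _).trans (hstep x hx 0)
  -- The square of side 3L^j has radius (3L^j - 1)/2, whence 4ρ ≤ 6L^j.
  have hbox : ∀ c, IsCenter j c → IsNear j 3 X (block j c) → ∀ p q : Site L R,
      2 * siteAbs (p - c) + 1 ≤ 3 * L ^ j → 2 * siteAbs (q - c) + 1 ≤ 3 * L ^ j →
      ‖g p - g q‖ ≤ 6 * L ^ j * m := by
    intro c hc hn p q hp hq
    have := norm_sub_le_of_step (g := g) (m := m) (c := c) (ρ := (3 * L ^ j - 1) / 2)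
      (fun z hz μ => hstep z (hn.mem_smallNbhd hL hLR hj hc (by omega)) μ)
      (x := p) (y := q) (by omega) (by omega)
    refine this.trans ?_
    have h : 4 * ((3 * L ^ j - 1) / 2) ≤ 6 * L ^ j := by omega
    have h' : 4 * (((3 * L ^ j - 1) / 2 : ℕ) : ℝ) ≤ 6 * (L : ℝ) ^ j := by exact_mod_cast h
    exact mul_le_mul_of_nonneg_right h' hm
  -- chains of blocks
  have chain : ∀ Z, IsConnectedPolymer j Z → (blocksOf j Z).card ≤ 4 → ∀ P ∈ blocksOf j Z,
      (P ∩ X).Nonempty → ∀ Q ∈ blocksOf j Z, ∀ p ∈ P, ∀ q ∈ Q, ‖g q - g p‖ ≤ 24 * L ^ j * m := by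
    intro Z hZ hcard P hP hPX Q hQ p hp q hq
    have hreach := reachWithin_of_reflTransGen (n := 3) hP (fun _ _ h => h.1)
      (hZ.2.2 P hP Q hQ) (by omega)
    -- Each block of the chain costs 6L^j m. The passage to the last block uses the square around
    -- its predecessor, so only blocks near within three are required to have their square inside
    -- X*. Four blocks give 24.
    have main : ∀ n ≤ 3, ∀ Q, ReachWithin (fun P Q => Q ∈ blocksOf j Z ∧ Touch P Q) P n Q →
        Q ∈ blocks j ∧ IsNear j (n + 1) X Q ∧ ∀ q ∈ Q, ‖g q - g p‖ ≤ 6 * (n + 1) * L ^ j * m := by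
      intro n
      induction n with
      | zero =>
        rintro _ Q (rfl : Q = P)
        have hb := (mem_blocksOf.1 hP).1
        have h1 := isNear_one hL hj hb hPX
        refine ⟨hb, h1, fun q hq => ?_⟩
        obtain ⟨c, hc, rfl⟩ := mem_blocks.1 hb
        rw [mem_block_odd hL] at hp hq
        have := hbox c hc (h1.mono (by norm_num)) q p (by omega) (by omega)
        simpa using this
      | succ n ih =>
        rintro hn Q (hQ | ⟨D, hD, hQ, ht⟩)
        · obtain ⟨a, b, d⟩ := ih (by omega) Q hQ
          refine ⟨a, b.mono (by omega), fun q hq => (d q hq).trans ?_⟩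
          gcongr; simp
        · obtain ⟨a, b, d⟩ := ih (by omega) D hD
          have hQb := (mem_blocksOf.1 hQ).1
          refine ⟨hQb, b.touch hL hj hQb ht, fun q hq => ?_⟩
          obtain ⟨c, hc, rfl⟩ := mem_blocks.1 a
          obtain ⟨e, he, rfl⟩ := mem_blocks.1 hQb
          have h1 := hbox c hc (b.mono (by omega)) q c (ht.siteAbs_le hL hq) (by
            have := Nat.one_le_pow j L (NeZero.pos L)
            rw [sub_self, siteAbs_zero]; omega)
          have h2 := d c (center_mem_block j c)
          calc _ ≤ _ := norm_sub_le_norm_sub_add_norm_sub _ (g c) _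
            _ ≤ _ := add_le_add h1 h2
            _ = _ := by push_cast; ring
    refine ((main 3 le_rfl Q hreach).2.2 q hq).trans (le_of_eq ?_)
    push_cast; ring
  obtain ⟨Z, hZ, hZX, hxZ⟩ : ∃ Z, IsSmall j Z ∧ (Z ∩ X).Nonempty ∧ x ∈ Z := by
    have := (Finset.mem_filter.1 hx).2
    convert this
  -- Two chains, one inside a small polymer from `x` to a point of `X` and one inside `X` from there
  -- to `x₀`: 48 = 24 + 24.
  obtain ⟨z, hz⟩ := hZX
  obtain ⟨hzZ, hzX⟩ := Finset.mem_inter.1 hz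
  obtain ⟨P, hP, hzP⟩ := hZ.1.1.exists_mem hzZ
  obtain ⟨Q, hQ, hxQ⟩ := hZ.1.1.exists_mem hxZ
  have h1 := chain Z hZ.1 hZ.2 P hP ⟨z, Finset.mem_inter.2 ⟨hzP, hzX⟩⟩ Q hQ z hzP x hxQ
  obtain ⟨P', hP', hxP'⟩ := hX.1.1.exists_mem hx₀
  obtain ⟨Q', hQ', hzQ'⟩ := hX.1.1.exists_mem hzX
  have h2 := chain X hX.1 hX.2 P' hP' ⟨x₀, Finset.mem_inter.2 ⟨hxP', hx₀⟩⟩ Q' hQ' x₀ hxP' z hzQ'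
  calc _ ≤ _ := norm_sub_le_norm_sub_add_norm_sub _ (g z) _
    _ ≤ _ := add_le_add h1 h2
    _ = _ := by ring

lemma siteAbs_unitVec_le (μ : Fin 4) : siteAbs (unitVec (ZMod (L ^ R)) μ : Site L R) ≤ 1 := by
  have h : ∃ a b : ℤ, (unitVec (ZMod (L ^ R)) μ : Site L R) = ofInt L R a b ∧
      max a.natAbs b.natAbs ≤ 1 := by
    fin_cases μ
    · exact ⟨1, 0, by simp [unitVec, ofInt], by simp⟩
    · exact ⟨0, 1, by simp [unitVec, ofInt], by simp⟩
    · exact ⟨-1, 0, by simp [unitVec, ofInt], by simp⟩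
    · exact ⟨0, -1, by simp [unitVec, ofInt], by simp⟩
  obtain ⟨a, b, h, h'⟩ := h
  rw [h]
  exact (siteAbs_ofInt_le a b).trans h'

/-- The oscillation estimate applied to the distance from `x₀`, which changes by at most one per
step. -/
lemma IsSmall.siteAbs_le (hL : Odd L) (hLR : 3 ≤ L ^ R) {j : ℕ} (hj : j ≤ R)
    {X : Finset (Site L R)} (hX : IsSmall j X) {x x₀ : Site L R} (hx : x ∈ smallNbhd j X)
    (hx₀ : x₀ ∈ X) : siteAbs (x - x₀) ≤ 48 * L ^ j := by
  have := hX.norm_sub_le hL hLR hj (g := fun x => (siteAbs (x - x₀) : ℝ)) (m := 1)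
    (fun y _ μ => by
      have h1 := siteAbs_sub_le (y + unitVec (ZMod (L ^ R)) μ) y x₀
      have h2 := siteAbs_sub_le y (y + unitVec (ZMod (L ^ R)) μ) x₀
      have h3 := siteAbs_unitVec_le (L := L) (R := R) μ
      rw [siteAbs_sub_comm y (y + unitVec (ZMod (L ^ R)) μ), add_sub_cancel_left] at h2
      rw [add_sub_cancel_left] at h1
      rw [Real.norm_eq_abs, abs_le]
      constructor
      · have : siteAbs (y - x₀) ≤ 1 + siteAbs (y + unitVec (ZMod (L ^ R)) μ - x₀) := by omega
        have : (siteAbs (y - x₀) : ℝ) ≤ 1 + siteAbs (y + unitVec (ZMod (L ^ R)) μ - x₀) := by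
          exact_mod_cast this
        linarith
      · have : siteAbs (y + unitVec (ZMod (L ^ R)) μ - x₀) ≤ 1 + siteAbs (y - x₀) := by omega
        have : (siteAbs (y + unitVec (ZMod (L ^ R)) μ - x₀) : ℝ) ≤ 1 + siteAbs (y - x₀) := by
          exact_mod_cast this
        linarith) hx hx₀
  simp only [sub_self, siteAbs_zero, Nat.cast_zero, sub_zero, mul_one, Real.norm_eq_abs,
    Nat.abs_cast] at this
  exact_mod_cast this

end SmallPolymers

/-! ### Invariance under translations by L^j ℤ² -/

section Translation

variable {L R : ℕ} [NeZero L]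

/-- The translate of `X` by `d`. -/
def translate (d : Site L R) (X : Finset (Site L R)) : Finset (Site L R) := X.image (· + d)

lemma mem_translate {d x : Site L R} {X : Finset (Site L R)} : x ∈ translate d X ↔ x - d ∈ X := by
  simp only [translate, Finset.mem_image]
  constructor
  · rintro ⟨y, hy, rfl⟩; simpa using hy
  · intro h; exact ⟨_, h, by simp⟩

lemma translate_block (j : ℕ) (c d : Site L R) : translate d (block j c) = block j (c + d) := by
  ext x
  rw [mem_translate, mem_block, mem_block, sub_sub, add_comm d]

lemma translate_mem_blocks {j : ℕ} {d : Site L R} (hd : IsCenter j d) {B : Finset (Site L R)}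
    (hB : B ∈ blocks j) : translate d B ∈ blocks j := by
  obtain ⟨c, hc, rfl⟩ := mem_blocks.1 hB
  exact mem_blocks.2 ⟨_, hc.add hd, translate_block j c d⟩

lemma translate_translate_neg (d : Site L R) (X : Finset (Site L R)) :
    translate d (translate (-d) X) = X := by
  ext x; simp [mem_translate]

lemma translate_mono {d : Site L R} {X Z : Finset (Site L R)} (h : X ⊆ Z) :
    translate d X ⊆ translate d Z := Finset.image_subset_image h

lemma isCenter_neg {j : ℕ} {d : Site L R} (hd : IsCenter j d) : IsCenter j (-d) := by
  obtain ⟨v, rfl⟩ := hd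
  exact ⟨-v, by rw [smul_neg]⟩

lemma translate_mem_blocksOf {j : ℕ} {d : Site L R} (hd : IsCenter j d) {B X : Finset (Site L R)}
    (hB : B ∈ blocksOf j X) : translate d B ∈ blocksOf j (translate d X) := by
  rw [mem_blocksOf] at hB ⊢
  exact ⟨translate_mem_blocks hd hB.1, translate_mono hB.2⟩

lemma exists_of_mem_blocksOf_translate {j : ℕ} {d : Site L R} (hd : IsCenter j d)
    {D X : Finset (Site L R)} (hD : D ∈ blocksOf j (translate d X)) :
    ∃ B ∈ blocksOf j X, D = translate d B := by
  refine ⟨translate (-d) D, ?_, (translate_translate_neg d D).symm⟩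
  have := translate_mem_blocksOf (isCenter_neg hd) hD
  rwa [show translate (-d) (translate d X) = X by
    simpa using translate_translate_neg (-d) X] at this

lemma Touch.translate {d : Site L R} {B D : Finset (Site L R)} (h : Touch B D) :
    Touch (translate d B) (translate d D) := by
  obtain ⟨x, hx, y, hy, h⟩ := h
  exact ⟨x + d, by simpa [mem_translate] using hx, y + d, by simpa [mem_translate] using hy,
    by simpa using h⟩

lemma IsPolymer.translate {j : ℕ} {d : Site L R} (hd : IsCenter j d) {X : Finset (Site L R)}
    (hX : IsPolymer j X) : IsPolymer j (translate d X) := by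
  classical
  obtain ⟨S, hS, rfl⟩ := hX
  refine ⟨S.image (CoulombGas.translate d), fun B hB => ?_, ?_⟩
  · obtain ⟨D, hD, rfl⟩ := Finset.mem_image.1 hB
    exact translate_mem_blocks hd (hS hD)
  · ext x
    simp [mem_translate]

lemma IsSmall.translate {j : ℕ} {d : Site L R} (hd : IsCenter j d) {X : Finset (Site L R)}
    (hX : IsSmall j X) : IsSmall j (translate d X) := by
  classical
  obtain ⟨⟨hp, ⟨x, hx⟩, hc⟩, hcard⟩ := hX
  refine ⟨⟨hp.translate hd, ⟨x + d, by simpa [mem_translate] using hx⟩, ?_⟩, ?_⟩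
  · intro B hB D hD
    obtain ⟨P, hP, rfl⟩ := exists_of_mem_blocksOf_translate hd hB
    obtain ⟨Q, hQ, rfl⟩ := exists_of_mem_blocksOf_translate hd hD
    exact (hc P hP Q hQ).lift _ fun P Q h => ⟨translate_mem_blocksOf hd h.1, h.2.translate⟩
  · refine le_trans ?_ hcard
    refine (Finset.card_le_card (t := (blocksOf j X).image (CoulombGas.translate d)) ?_).trans
      Finset.card_image_le
    intro D hD
    obtain ⟨B, hB, rfl⟩ := exists_of_mem_blocksOf_translate hd hD
    exact Finset.mem_image_of_mem _ hB

lemma mem_smallNbhd {j : ℕ} {X : Finset (Site L R)} {x : Site L R} :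
    x ∈ smallNbhd j X ↔ ∃ Y, IsSmall j Y ∧ (∃ y ∈ Y, y ∈ X) ∧ x ∈ Y := by
  classical
  simp only [smallNbhd, Finset.mem_filter, Finset.mem_univ, true_and, Finset.Nonempty,
    Finset.mem_inter]

lemma smallNbhd_mono {j : ℕ} {X Z : Finset (Site L R)} (h : X ⊆ Z) :
    smallNbhd j X ⊆ smallNbhd j Z := by
  intro x hx
  rw [mem_smallNbhd] at hx ⊢
  obtain ⟨Y, hY, ⟨y, hy, hyX⟩, hx⟩ := hx
  exact ⟨Y, hY, ⟨y, hy, h hyX⟩, hx⟩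

lemma add_mem_smallNbhd_translate {j : ℕ} {d : Site L R} (hd : IsCenter j d)
    {X : Finset (Site L R)} {x : Site L R} (hx : x ∈ smallNbhd j X) :
    x + d ∈ smallNbhd j (translate d X) := by
  rw [mem_smallNbhd] at hx ⊢
  obtain ⟨Y, hY, ⟨y, hy, hyX⟩, hx⟩ := hx
  exact ⟨_, hY.translate hd, ⟨y + d, by simpa [mem_translate] using hy,
    by simpa [mem_translate] using hyX⟩, by simpa [mem_translate] using hx⟩

lemma latticeDeriv_translate {E : Type*} [AddCommGroup E] {A : Type*} [Ring A] (l : List (Fin 4))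
    (φ : A × A → E) (d x : A × A) :
    latticeDeriv l (fun y => φ (y + d)) x = latticeDeriv l φ (x + d) := by
  induction l generalizing x with
  | nil => rfl
  | cons μ l ih => simp only [latticeDeriv, ih, add_right_comm]

lemma le_gradSup {E : Type*} [NormedAddCommGroup E] {j n : ℕ} {Y : Finset (Site L R)}
    (φ : Site L R → E) {x : Site L R} (hx : x ∈ Y) (μ : Fin n → Fin 4) :
    (L : ℝ) ^ (n * j) * ‖latticeDeriv (List.ofFn μ) φ x‖ ≤ gradSup j n Y φ := by
  have h : (L : ℝ≥0) ^ (n * j) * ‖latticeDeriv (List.ofFn μ) φ x‖₊ ≤ gradSup j n Y φ :=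
    le_trans (Finset.le_sup (f := fun x => (L : ℝ≥0) ^ (n * j) *
      ‖latticeDeriv (List.ofFn μ) φ x‖₊) hx)
      (Finset.le_sup (f := fun μ : Fin n → Fin 4 => Y.sup fun x => (L : ℝ≥0) ^ (n * j) *
        ‖latticeDeriv (List.ofFn μ) φ x‖₊) (Finset.mem_univ μ))
  exact_mod_cast h

lemma gradSup_le {E : Type*} [NormedAddCommGroup E] {j n : ℕ} {Y : Finset (Site L R)}
    {φ : Site L R → E} {a : ℝ} (ha : 0 ≤ a)
    (h : ∀ x ∈ Y, ∀ μ : Fin n → Fin 4, (L : ℝ) ^ (n * j) * ‖latticeDeriv (List.ofFn μ) φ x‖ ≤ a) :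
    (gradSup j n Y φ : ℝ) ≤ a := by
  lift a to ℝ≥0 using ha
  have : gradSup j n Y φ ≤ a := Finset.sup_le fun μ _ => Finset.sup_le fun x hx => by
    have := h x hx μ
    exact_mod_cast this
  exact_mod_cast this

lemma c2Norm_le {E : Type*} [NormedAddCommGroup E] {j : ℕ} {Y : Finset (Site L R)}
    {φ : Site L R → E} {a : ℝ} (ha : 0 ≤ a)
    (h : ∀ n < 3, ∀ x ∈ Y, ∀ μ : Fin n → Fin 4,
      (L : ℝ) ^ (n * j) * ‖latticeDeriv (List.ofFn μ) φ x‖ ≤ a) :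
    (c2Norm j Y φ : ℝ) ≤ a := by
  have h' := fun n hn => gradSup_le ha (h n hn)
  lift a to ℝ≥0 using ha
  have : c2Norm j Y φ ≤ a := Finset.sup_le fun n hn => by
    have := h' n (Finset.mem_range.1 hn)
    exact_mod_cast this
  exact_mod_cast this

lemma le_c2Norm {E : Type*} [NormedAddCommGroup E] {j n : ℕ} (hn : n < 3) {Y : Finset (Site L R)}
    (φ : Site L R → E) {x : Site L R} (hx : x ∈ Y) (μ : Fin n → Fin 4) :
    (L : ℝ) ^ (n * j) * ‖latticeDeriv (List.ofFn μ) φ x‖ ≤ c2Norm j Y φ := by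
  refine (le_gradSup φ hx μ).trans ?_
  have : gradSup j n Y φ ≤ c2Norm j Y φ :=
    Finset.le_sup (f := fun n => gradSup j n Y φ) (Finset.mem_range.2 hn)
  exact_mod_cast this

lemma c2Norm_translate_le {E : Type*} [NormedAddCommGroup E] {j : ℕ} {d : Site L R}
    {Y Z : Finset (Site L R)} (h : ∀ x ∈ Y, x + d ∈ Z) (φ : Site L R → E) :
    c2Norm j Y (fun x => φ (x + d)) ≤ c2Norm j Z φ := by
  have : (c2Norm j Y (fun x => φ (x + d)) : ℝ) ≤ c2Norm j Z φ :=
    c2Norm_le (NNReal.coe_nonneg _) fun n hn x hx μ => by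
      rw [latticeDeriv_translate]
      exact le_c2Norm hn φ (h x hx) μ
  exact_mod_cast this

lemma latticeDeriv_ofReal {A : Type*} [Ring A] (l : List (Fin 4)) (φ : A × A → ℝ) (x : A × A) :
    latticeDeriv l (fun y => (φ y : ℂ)) x = ((latticeDeriv l φ x : ℝ) : ℂ) := by
  induction l generalizing x with
  | nil => rfl
  | cons μ l ih => simp only [latticeDeriv, ih, Complex.ofReal_sub]

lemma c2Norm_ofReal_le {j : ℕ} {Y : Finset (Site L R)} (φ : Site L R → ℝ) :
    c2Norm j Y (fun x => (φ x : ℂ)) ≤ c2Norm j Y φ := by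
  have : (c2Norm j Y (fun x => (φ x : ℂ)) : ℝ) ≤ c2Norm j Y φ :=
    c2Norm_le (NNReal.coe_nonneg _) fun n hn x hx μ => by
      rw [latticeDeriv_ofReal, Complex.norm_real]
      exact le_c2Norm hn φ hx μ
  exact_mod_cast this

/-- The propagator seen from the centre of a block of a small polymer. -/
lemma IsPropagatorBound.c2Norm_le {γ : ℕ} {C : ℕ → ℤ × ℤ → ℝ} {C₀ : ℝ}
    (hC : IsPropagatorBound γ C C₀) {M j : ℕ} (hM : 1 ≤ M) (hLM : L = γ ^ M) (hj : j < R)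
    {X : Finset (Site L R)} (hX : IsSmall j X) {y : Site L R} (hy : IsCenter j y) (hyX : y ∈ X) :
    (c2Norm j (smallNbhd j X) (fun x : Site L R =>
      ((torusCov C M j (x - y) - torusCov C M j (y - y) : ℝ) : ℂ)) : ℝ) ≤ C₀ := by
  have h := hC L M R j hM hLM hj (translate (-y) X) (hX.translate (isCenter_neg hy))
    (by simpa [mem_translate] using hyX)
  refine le_trans ?_ h
  have h1 := c2Norm_ofReal_le (j := j) (Y := smallNbhd j X)
    (fun x => torusCov C M j (x - y) - torusCov C M j (y - y))
  have h2 := c2Norm_translate_le (j := j) (d := -y) (Y := smallNbhd j X)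
    (fun x hx => add_mem_smallNbhd_translate (isCenter_neg hy) hx)
    (fun x : Site L R => torusCov C M j x - torusCov C M j (0 : Site L R))
  simp only [← sub_eq_add_neg] at h2
  rw [sub_self] at h1 ⊢
  exact_mod_cast h1.trans h2

end Translation

/-! ### Cardinalities of blocks, boundaries and small polymers -/

section Count

variable {L R : ℕ} [NeZero L]

lemma card_block_le (hL : Odd L) (j : ℕ) (c : Site L R) : (block j c).card ≤ L ^ (2 * j) := by
  classical
  obtain ⟨ρ, hρ⟩ := hL.pow (n := j)
  have : block j c ⊆ (Finset.Icc (-ρ : ℤ) ρ ×ˢ Finset.Icc (-ρ : ℤ) ρ).image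
      fun p => c + ofInt L R p.1 p.2 := by
    intro x hx
    obtain ⟨a, b, hx', ha, hb⟩ := exists_ofInt x c
    rw [mem_block_odd hL] at hx
    refine Finset.mem_image.2 ⟨(a, b), ?_, hx'.symm⟩
    simp only [Finset.mem_product, Finset.mem_Icc]
    omega
  refine (Finset.card_le_card this).trans (Finset.card_image_le.trans ?_)
  rw [Finset.card_product, Int.card_Icc, mul_comm 2, pow_mul, hρ, pow_two]
  refine le_of_eq ?_
  congr 1 <;> omega

/-- Because j ≤ R a block does not wrap around the torus, so its integer coordinates are distinct
sites. The exact volume is needed when averaging over a block. -/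
lemma le_card_block (hL : Odd L) {j : ℕ} (hj : j ≤ R) (c : Site L R) :
    L ^ (2 * j) ≤ (block j c).card := by
  classical
  obtain ⟨ρ, hρ⟩ := hL.pow (n := j)
  have hle : L ^ j ≤ L ^ R := Nat.pow_le_pow_right (NeZero.pos L) hj
  have h1 : ((Finset.Icc (-ρ : ℤ) ρ ×ˢ Finset.Icc (-ρ : ℤ) ρ).image
      fun p => c + ofInt L R p.1 p.2) ⊆ block j c := by
    intro x hx
    obtain ⟨⟨a, b⟩, hab, rfl⟩ := Finset.mem_image.1 hx
    simp only [Finset.mem_product, Finset.mem_Icc] at hab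
    rw [mem_block_odd hL, add_sub_cancel_left]
    refine (Nat.add_le_add_right (Nat.mul_le_mul_left 2 (siteAbs_ofInt_le a b)) 1).trans ?_
    omega
  refine le_trans (le_of_eq ?_) (Finset.card_le_card h1)
  rw [Finset.card_image_of_injOn, Finset.card_product, Int.card_Icc, mul_comm 2, pow_mul, hρ,
    pow_two]
  · congr 1 <;> omega
  · have hz : ∀ a a' : ℤ, a ∈ Finset.Icc (-ρ : ℤ) ρ → a' ∈ Finset.Icc (-ρ : ℤ) ρ →
        (a : ZMod (L ^ R)) = a' → a = a' := by
      intro a a' ha ha' h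
      rw [Finset.mem_Icc] at ha ha'
      rw [ZMod.intCast_eq_intCast_iff_dvd_sub] at h
      have := Int.eq_zero_of_abs_lt_dvd h (by
        have : (2 * ρ + 1 : ℤ) ≤ ((L ^ R : ℕ) : ℤ) := by exact_mod_cast hρ ▸ hle
        rw [abs_lt]; constructor <;> omega)
      omega
    rintro ⟨a, b⟩ hab ⟨a', b'⟩ hab' h
    simp only [Finset.coe_product, Set.mem_prod, Finset.mem_coe] at hab hab'
    have h' : ofInt L R a b = ofInt L R a' b' := by simpa using h
    simp only [ofInt, Prod.mk.injEq] at h'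
    rw [hz a a' hab.1 hab'.1 h'.1, hz b b' hab.2 hab'.2 h'.2]

/-- A step out of the block increases the distance from the centre by at most one, so a boundary
site has a coordinate equal to ±ρ. -/
lemma card_boundary_block_le (hL : Odd L) (j : ℕ) (c : Site L R) :
    (boundary (block j c)).card ≤ 4 * L ^ j := by
  classical
  obtain ⟨ρ, hρ⟩ := hL.pow (n := j)
  set I := Finset.Icc (-ρ : ℤ) ρ
  set E : Finset ℤ := {(ρ : ℤ), -(ρ : ℤ)}
  have hsub : boundary (block j c) ⊆ ((E ×ˢ I) ∪ (I ×ˢ E)).image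
      fun p => c + ofInt L R p.1 p.2 := by
    intro x hx
    obtain ⟨hx, μ, hμ⟩ := Finset.mem_filter.1 hx
    obtain ⟨a, b, hx', ha, hb⟩ := exists_ofInt x c
    rw [mem_block_odd hL] at hx hμ
    refine Finset.mem_image.2 ⟨(a, b), ?_, hx'.symm⟩
    simp only [Finset.mem_union, Finset.mem_product, I, E, Finset.mem_Icc, Finset.mem_insert,
      Finset.mem_singleton]
    have h1 : siteAbs (x + unitVec (ZMod (L ^ R)) μ - c) ≤ siteAbs (x - c) + 1 := by
      rw [add_sub_right_comm]
      exact (siteAbs_add_le _ _).trans (by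
        have := siteAbs_unitVec_le (L := L) (R := R) μ
        omega)
    have h2 : siteAbs (x - c) ≤ max a.natAbs b.natAbs := by
      rw [hx', add_sub_cancel_left]; exact siteAbs_ofInt_le a b
    omega
  have hE : E.card ≤ 2 := Finset.card_le_two
  have hI : I.card = L ^ j := by rw [Int.card_Icc]; omega
  calc (boundary (block j c)).card ≤ ((E ×ˢ I) ∪ (I ×ˢ E)).card :=
        (Finset.card_le_card hsub).trans Finset.card_image_le
    _ ≤ (E ×ˢ I).card + (I ×ˢ E).card := Finset.card_union_le _ _
    _ ≤ 2 * L ^ j + L ^ j * 2 := by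
        rw [Finset.card_product, Finset.card_product, hI]
        gcongr
    _ = 4 * L ^ j := by ring

lemma IsSmall.card_le (hL : Odd L) {j : ℕ} {X : Finset (Site L R)} (hX : IsSmall j X) :
    X.card ≤ 4 * L ^ (2 * j) := by
  classical
  have h : X ⊆ (blocksOf j X).biUnion id := fun x hx => by
    obtain ⟨B, hB, hxB⟩ := hX.1.1.exists_mem hx
    exact Finset.mem_biUnion.2 ⟨B, hB, hxB⟩
  refine (Finset.card_le_card h).trans ?_
  refine (Finset.card_biUnion_le_card_mul _ _ (L ^ (2 * j)) fun B hB => ?_).trans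
    (Nat.mul_le_mul_right _ hX.2)
  obtain ⟨c, _, rfl⟩ := mem_blocks.1 (mem_blocksOf.1 hB).1
  exact card_block_le hL j c

lemma IsSmall.card_boundary_le (hL : Odd L) {j : ℕ} {X : Finset (Site L R)} (hX : IsSmall j X) :
    (boundary X).card ≤ 16 * L ^ j := by
  classical
  have h : boundary X ⊆ (blocksOf j X).biUnion boundary := fun x hx => by
    obtain ⟨hx, μ, hμ⟩ := Finset.mem_filter.1 hx
    obtain ⟨B, hB, hxB⟩ := hX.1.1.exists_mem hx
    exact Finset.mem_biUnion.2 ⟨B, hB, Finset.mem_filter.2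
      ⟨hxB, μ, fun h => hμ ((mem_blocksOf.1 hB).2 h)⟩⟩
  refine (Finset.card_le_card h).trans ?_
  refine (Finset.card_biUnion_le_card_mul _ _ (4 * L ^ j) fun B hB => ?_).trans
    ((Nat.mul_le_mul_right _ hX.2).trans (le_of_eq (by ring)))
  obtain ⟨c, _, rfl⟩ := mem_blocks.1 (mem_blocksOf.1 hB).1
  exact card_boundary_block_le hL j c

/-- The `k`-block of a point of `X`, with the position of `X^*` in it. -/
lemma IsSmall.exists_reblock (hL : Odd L) (hL48 : 48 ≤ L) {j : ℕ} (hj : j + 1 ≤ R)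
    {X : Finset (Site L R)} (hX : IsSmall j X) {x₀ : Site L R} (hx₀ : x₀ ∈ X) :
    ∃ c : Site L R, IsCenter (j + 1) c ∧ block (j + 1) c ∈ blocksOf (j + 1) (reblock (j + 1) X) ∧
      (∀ x, 2 * siteAbs (x - c) + 1 ≤ 3 * L ^ (j + 1) → x ∈ smallNbhd (j + 1) (block (j + 1) c)) ∧
      ∀ x ∈ smallNbhd j X, 2 * siteAbs (x - c) + 1 ≤ 3 * L ^ (j + 1) := by
  classical
  have hLR : 3 ≤ L ^ R := by
    calc 3 ≤ L ^ 1 := by rw [pow_one]; omega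
      _ ≤ L ^ R := Nat.pow_le_pow_right (by omega) (by omega)
  obtain ⟨c, hc, hx₀c⟩ := exists_mem_blocks hL (j + 1) x₀
  have hb : block (j + 1) c ∈ blocks (j + 1) := mem_blocks.2 ⟨c, hc, rfl⟩
  refine ⟨c, hc, ?_, ?_, ?_⟩
  · rw [mem_blocksOf]
    refine ⟨hb, fun x hx => ?_⟩
    simp only [reblock, Finset.mem_biUnion, Finset.mem_filter, id]
    exact ⟨_, ⟨hb, x₀, Finset.mem_inter.2 ⟨hx₀c, hx₀⟩⟩, hx⟩
  · intro x hx
    exact IsNear.mem_smallNbhd hL hLR hj hc ((isNear_one hL hj hb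
      ⟨c, Finset.mem_inter.2 ⟨center_mem_block _ c, center_mem_block _ c⟩⟩).mono (by norm_num)) hx
  · intro x hx
    have h1 := hX.siteAbs_le hL hLR (by omega) hx hx₀
    have h2 := siteAbs_sub_le x x₀ c
    rw [mem_block_odd hL] at hx₀c
    -- The neighbourhood of a small polymer has extent at most 48L^j, no more than one block of the
    -- next scale once L ≥ 48.
    have h3 : 48 * L ^ j ≤ L ^ (j + 1) := by
      rw [pow_succ, mul_comm]; exact Nat.mul_le_mul_left _ hL48
    omega

end Count

/-! ### Positivity of the covariance on the torus -/

section TorusCovariance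
open Filter Topology

variable {γ : ℕ} {C : ℕ → ℤ × ℤ → ℝ} {L R : ℕ} [NeZero L]

lemma IsFiniteRangeDecomposition.scaleCov_even (hC : IsFiniteRangeDecomposition γ C) (M j : ℕ)
    (x : ℤ × ℤ) : scaleCov C M j (-x) = scaleCov C M j x := by
  simp only [scaleCov, hC.even]

lemma IsFiniteRangeDecomposition.scaleCov_eq_zero (hγ : 1 < γ)
    (hC : IsFiniteRangeDecomposition γ C) {M j : ℕ} {x : ℤ × ℤ}
    (hx : (γ ^ M) ^ (j + 1) ≤ 2 * max x.1.natAbs x.2.natAbs) : scaleCov C M j x = 0 := by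
  refine Finset.sum_eq_zero fun h hh => hC.finiteRange h x (le_trans ?_ hx)
  rw [← pow_mul, mul_comm]
  exact Nat.pow_le_pow_right hγ.le (Finset.mem_Ico.1 hh).2

lemma IsFiniteRangeDecomposition.sum_scaleCov_nonneg (hC : IsFiniteRangeDecomposition γ C)
    (M j : ℕ) {ι : Type*} [Fintype ι] {P : ι → ℤ × ℤ} (hP : Function.Injective P) (a : ι → ℝ) :
    0 ≤ ∑ i, ∑ i', a i * a i' * scaleCov C M j (P i - P i') := by
  classical
  have e : (∑ i, ∑ i', a i * a i' * scaleCov C M j (P i - P i')) =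
      ∑ h ∈ Finset.Ico (j * M) ((j + 1) * M), ∑ i, ∑ i', a i * a i' * C h (P i - P i') := by
    simp only [scaleCov, Finset.mul_sum]
    rw [Finset.sum_congr rfl fun i _ => Finset.sum_comm, Finset.sum_comm]
  rw [e]
  refine Finset.sum_nonneg fun h _ => ?_
  have := hC.posDef h (Finset.univ.image P) (Function.extend P a 0)
  simpa only [Finset.sum_image (fun _ _ _ _ h => hP h), hP.extend_apply] using this

/-- The number of pairs of numbers below `n` with difference `k`. -/
def pairCount (n : ℕ) (k : ℤ) : ℝ :=
  ∑ a : Fin n, ∑ b : Fin n, if (b : ℤ) = a + k then 1 else 0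

lemma pairCount_le (n : ℕ) (k : ℤ) : pairCount n k ≤ n := by
  have : ∀ a : Fin n, ∑ b : Fin n, (if (b : ℤ) = a + k then (1 : ℝ) else 0) ≤ 1 := by
    intro a
    by_cases h : ∃ b : Fin n, (b : ℤ) = a + k
    · obtain ⟨b, hb⟩ := h
      rw [Finset.sum_eq_single b]
      · simp [hb]
      · intro b' _ hne
        rw [if_neg]
        intro h
        exact hne (Fin.ext (by exact_mod_cast h.trans hb.symm))
      · simp
    · push Not at h
      simp [h]
  calc pairCount n k ≤ ∑ _a : Fin n, (1 : ℝ) := Finset.sum_le_sum fun a _ => this a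
    _ = n := by simp

lemma le_pairCount (n : ℕ) (k : ℤ) : (n : ℝ) - k.natAbs * 2 ≤ pairCount n k := by
  have h1 : ∀ a : Fin n, (if k.natAbs ≤ (a : ℕ) ∧ (a : ℕ) + k.natAbs < n then (1 : ℝ) else 0) ≤
      ∑ b : Fin n, (if (b : ℤ) = a + k then (1 : ℝ) else 0) := by
    intro a
    split_ifs with h
    · refine le_trans (le_of_eq ?_) (Finset.single_le_sum (fun b _ => by split_ifs <;> norm_num)
        (Finset.mem_univ (⟨((a : ℤ) + k).toNat, by omega⟩ : Fin n)))
      rw [if_pos]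
      simp only
      omega
    · exact Finset.sum_nonneg fun b _ => by split_ifs <;> norm_num
  refine le_trans ?_ (Finset.sum_le_sum fun a _ => h1 a)
  rw [Fin.sum_univ_eq_sum_range (fun a => if k.natAbs ≤ a ∧ a + k.natAbs < n then (1 : ℝ) else 0),
    Finset.sum_boole]
  have h2 : Finset.Ico k.natAbs (n - k.natAbs) ⊆
      (Finset.range n).filter fun a => k.natAbs ≤ a ∧ a + k.natAbs < n := by
    intro a ha
    rw [Finset.mem_Ico] at ha
    rw [Finset.mem_filter, Finset.mem_range]
    omega
  have h3 := Finset.card_le_card h2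
  rw [Nat.card_Ico] at h3
  have h4 : n ≤ ((Finset.range n).filter fun a => k.natAbs ≤ a ∧ a + k.natAbs < n).card
    + k.natAbs * 2 := by omega
  have h5 : (n : ℝ) ≤ ((Finset.range n).filter fun a => k.natAbs ≤ a ∧ a + k.natAbs < n).card
    + k.natAbs * 2 := by exact_mod_cast h4
  linarith

lemma tendsto_pairCount (k : ℤ) : Tendsto (fun n : ℕ => pairCount n k / n) atTop (𝓝 1) := by
  have h1 : Tendsto (fun n : ℕ => 1 - (k.natAbs * 2 : ℝ) / n) atTop (𝓝 1) := by
    simpa using tendsto_const_nhds.sub (tendsto_const_div_atTop_nhds_zero_nat (k.natAbs * 2 : ℝ))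
  refine tendsto_of_tendsto_of_tendsto_of_le_of_le' h1 tendsto_const_nhds ?_ ?_
  · filter_upwards [eventually_gt_atTop 0] with n hn
    have hn' : (0 : ℝ) < n := by exact_mod_cast hn
    rw [le_div_iff₀ hn', sub_mul, div_mul_cancel₀ _ hn'.ne', one_mul]
    exact le_pairCount n k
  · filter_upwards [eventually_gt_atTop 0] with n hn
    have hn' : (0 : ℝ) < n := by exact_mod_cast hn
    rw [div_le_one hn']
    exact pairCount_le n k

/-- The representative of a site closest to the origin. -/
def toInt (z : Site L R) : ℤ × ℤ := (z.1.valMinAbs, z.2.valMinAbs)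

lemma torusCov_eq (C : ℕ → ℤ × ℤ → ℝ) (M j : ℕ) (z : Site L R) :
    torusCov C M j z = scaleCov C M j (toInt z) := rfl

lemma exists_toInt_sub (z z' : Site L R) : ∃ k : ℤ × ℤ,
    toInt z - toInt z' = toInt (z - z') - ((L ^ R : ℕ) : ℤ) • k := by
  have h : ∀ a b : ZMod (L ^ R), ∃ k : ℤ, a.valMinAbs - b.valMinAbs =
      (a - b).valMinAbs - ((L ^ R : ℕ) : ℤ) * k := by
    intro a b
    have : ((a.valMinAbs - b.valMinAbs : ℤ) : ZMod (L ^ R)) = ((a - b).valMinAbs : ℤ) := by simp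
    rw [ZMod.intCast_eq_intCast_iff_dvd_sub] at this
    obtain ⟨k, hk⟩ := this
    exact ⟨k, by linarith⟩
  obtain ⟨k, hk⟩ := h z.1 z'.1
  obtain ⟨l, hl⟩ := h z.2 z'.2
  exact ⟨(k, l), Prod.ext hk hl⟩

/-- A representative other than the closest one has a coordinate of size at least L^R/2 ≥ L^{j+1}/2,
beyond the range. So the periodization of Γ_j has at most one non-zero term. -/
lemma scaleCov_wrap (hγ : 1 < γ) (hC : IsFiniteRangeDecomposition γ C) {M j : ℕ} (hL : L = γ ^ M)
    (hj : j < R) (z : Site L R) (m : ℤ × ℤ) :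
    scaleCov C M j (((L ^ R : ℕ) : ℤ) • m + toInt z) =
      if m = 0 then torusCov C M j z else 0 := by
  split_ifs with h
  · rw [h, smul_zero, zero_add, torusCov_eq]
  · refine hC.scaleCov_eq_zero hγ ?_
    rw [← hL]
    have hpow : L ^ (j + 1) ≤ L ^ R := Nat.pow_le_pow_right (NeZero.pos L) hj
    have key : ∀ (w : ZMod (L ^ R)) (m : ℤ), m ≠ 0 →
        L ^ R ≤ 2 * (((L ^ R : ℕ) : ℤ) * m + w.valMinAbs).natAbs := by
      intro w m hm
      have h1 := w.natAbs_valMinAbs_le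
      have h2 : L ^ R ≤ (((L ^ R : ℕ) : ℤ) * m).natAbs := by
        rw [Int.natAbs_mul, Int.natAbs_natCast]
        exact Nat.le_mul_of_pos_right _ (Int.natAbs_pos.2 hm)
      omega
    refine hpow.trans ?_
    by_cases h1 : m.1 = 0
    · have h2 : m.2 ≠ 0 := fun h2 => h (Prod.ext h1 h2)
      exact (key z.2 _ h2).trans (Nat.mul_le_mul_left 2 (le_max_right _ _))
    · exact (key z.1 _ h1).trans (Nat.mul_le_mul_left 2 (le_max_left _ _))

/-- The closest representatives of w and -w need not be opposite when a coordinate is half the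
period; in that case both values vanish by finite range. -/
lemma torusCov_neg (hγ : 1 < γ) (hC : IsFiniteRangeDecomposition γ C) {M j : ℕ}
    (hL : L = γ ^ M) (hj : j < R) (w : Site L R) : torusCov C M j (-w) = torusCov C M j w := by
  obtain ⟨k, hk⟩ := exists_toInt_sub 0 w
  have h0 : toInt (0 : Site L R) = 0 := by simp [toInt]
  rw [h0, zero_sub, zero_sub] at hk
  have e : toInt w = ((L ^ R : ℕ) : ℤ) • k - toInt (-w) := by rw [← neg_sub, ← hk, neg_neg]
  have h1 := scaleCov_wrap hγ hC hL hj w (-k)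
  have h2 := scaleCov_wrap hγ hC hL hj (-w) (-k)
  rw [show ((L ^ R : ℕ) : ℤ) • -k + toInt w = -toInt (-w) by
    rw [smul_neg, e]; abel, hC.scaleCov_even, ← torusCov_eq] at h1
  rw [show ((L ^ R : ℕ) : ℤ) • -k + toInt (-w) = -toInt w by
    rw [smul_neg, hk]; abel, hC.scaleCov_even, ← torusCov_eq] at h2
  split_ifs at h1 h2
  · exact h1
  · rw [h1, h2]

lemma sum_prod_sum_prod {ι κ : Type*} [Fintype ι] [Fintype κ] (G : ι → κ → ι → κ → ℝ) :
    ∑ i : ι × κ, ∑ i' : ι × κ, G i.1 i.2 i'.1 i'.2 = ∑ z, ∑ z', ∑ p, ∑ p', G p z p' z' := by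
  rw [Fintype.sum_prod_type_right]
  refine Finset.sum_congr rfl fun z _ => ?_
  rw [Finset.sum_comm' (t' := Finset.univ) (s' := fun _ => Finset.univ) (by simp),
    Fintype.sum_prod_type_right]
  refine Finset.sum_congr rfl fun z' _ => ?_
  rw [Finset.sum_comm' (t' := Finset.univ) (s' := fun _ => Finset.univ) (by simp)]

lemma pairCount_mul_pairCount (n : ℕ) (k l : ℤ) :
    pairCount n k * pairCount n l = ∑ p : Fin n × Fin n, ∑ p' : Fin n × Fin n,
      if (p'.1 : ℤ) = p.1 + k ∧ (p'.2 : ℤ) = p.2 + l then 1 else 0 := by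
  simp only [pairCount, Fintype.sum_prod_type, Finset.sum_mul_sum]
  refine Finset.sum_congr rfl fun a _ => Finset.sum_congr rfl fun b _ =>
    Finset.sum_congr rfl fun a' _ => Finset.sum_congr rfl fun b' _ => ?_
  split_ifs <;> simp_all

/-- Repeat `f` on n × n copies of the torus in ℤ² and use positivity there. By finite range a pair
of sites interacts only through its nearest copies, of which there are n² up to boundary effects.
Dividing by n² and letting n → ∞ leaves the quadratic form on the torus. -/
lemma posSemidef_torusCov (hγ : 1 < γ) (hC : IsFiniteRangeDecomposition γ C) {M j : ℕ}
    (hL : L = γ ^ M) (hj : j < R) :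
    (Matrix.of fun x y : Site L R => torusCov C M j (x - y)).PosSemidef := by
  classical
  choose k hk using exists_toInt_sub (L := L) (R := R)
  have hN : ((L ^ R : ℕ) : ℤ) ≠ 0 := by exact_mod_cast (pow_pos (NeZero.pos L) R).ne'
  refine Matrix.PosSemidef.of_dotProduct_mulVec_nonneg ?_ fun f => ?_
  · ext x y
    simp only [Matrix.conjTranspose_apply, Matrix.of_apply, star_trivial]
    rw [← neg_sub x y, torusCov_neg hγ hC hL hj]
  have key : ∀ n : ℕ, 0 ≤ ∑ z : Site L R, ∑ z', f z * f z' * torusCov C M j (z - z') *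
      (pairCount n (-(k z z').1) / n * (pairCount n (-(k z z').2) / n)) := by
    intro n
    have hinj : Function.Injective fun i : (Fin n × Fin n) × Site L R =>
        ((((L ^ R : ℕ) : ℤ) • ((i.1.1 : ℤ), (i.1.2 : ℤ)) + toInt i.2) : ℤ × ℤ) := by
      rintro ⟨⟨a, b⟩, z⟩ ⟨⟨a', b'⟩, z'⟩ h
      simp only [toInt, Prod.smul_mk, smul_eq_mul, Prod.mk_add_mk, Prod.mk.injEq] at h
      have hz : z = z' := by
        have h1 := congrArg (Int.cast : ℤ → ZMod (L ^ R)) h.1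
        have h2 := congrArg (Int.cast : ℤ → ZMod (L ^ R)) h.2
        simp only [Int.cast_add, Int.cast_mul, Int.cast_natCast, ZMod.natCast_self, zero_mul,
          zero_add, ZMod.coe_valMinAbs] at h1 h2
        exact Prod.ext h1 h2
      subst hz
      simp only [add_left_inj, mul_eq_mul_left_iff, hN, or_false, Nat.cast_inj, Fin.val_inj] at h
      rw [h.1, h.2]
    have hpos := hC.sum_scaleCov_nonneg M j hinj (fun i => f i.2)
    rw [sum_prod_sum_prod fun (p : Fin n × Fin n) z (p' : Fin n × Fin n) z' => f z * f z' * scaleCov C M j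
      (((L ^ R : ℕ) : ℤ) • ((p.1 : ℤ), (p.2 : ℤ)) + toInt z
        - (((L ^ R : ℕ) : ℤ) • ((p'.1 : ℤ), (p'.2 : ℤ)) + toInt z'))] at hpos
    have hS : ∀ z z' : Site L R, (∑ p : Fin n × Fin n, ∑ p' : Fin n × Fin n,
        f z * f z' * scaleCov C M j (((L ^ R : ℕ) : ℤ) • ((p.1 : ℤ), (p.2 : ℤ)) + toInt z
          - (((L ^ R : ℕ) : ℤ) • ((p'.1 : ℤ), (p'.2 : ℤ)) + toInt z'))) =
        f z * f z' * torusCov C M j (z - z') *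
          (pairCount n (-(k z z').1) * pairCount n (-(k z z').2)) := by
      intro z z'
      rw [pairCount_mul_pairCount, Finset.mul_sum]
      refine Finset.sum_congr rfl fun p _ => ?_
      rw [Finset.mul_sum]
      refine Finset.sum_congr rfl fun p' _ => ?_
      have e : ((L ^ R : ℕ) : ℤ) • ((p.1 : ℤ), (p.2 : ℤ)) + toInt z
          - (((L ^ R : ℕ) : ℤ) • ((p'.1 : ℤ), (p'.2 : ℤ)) + toInt z') =
          ((L ^ R : ℕ) : ℤ) • (((p.1 : ℤ), (p.2 : ℤ)) - ((p'.1 : ℤ), (p'.2 : ℤ)) - k z z')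
            + toInt (z - z') := by
        rw [smul_sub, smul_sub, add_sub_add_comm, hk z z']
        abel
      rw [e, scaleCov_wrap hγ hC hL hj, mul_assoc (f z * f z')]
      congr 1
      rw [mul_ite, mul_one, mul_zero]
      refine if_congr ?_ rfl rfl
      rw [Prod.ext_iff]
      simp only [Prod.fst_sub, Prod.snd_sub, Prod.fst_zero, Prod.snd_zero]
      constructor <;> rintro ⟨h1, h2⟩ <;> constructor <;> linarith
    simp only [hS] at hpos
    have hn : (0 : ℝ) ≤ ((n : ℝ) * n)⁻¹ := by positivity
    refine (mul_nonneg hn hpos).trans (le_of_eq ?_)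
    rw [Finset.mul_sum]
    refine Finset.sum_congr rfl fun z _ => ?_
    rw [Finset.mul_sum]
    refine Finset.sum_congr rfl fun z' _ => ?_
    rw [div_mul_div_comm, div_eq_inv_mul]
    ring
  have hlim : Tendsto (fun n : ℕ => ∑ z : Site L R, ∑ z', f z * f z' * torusCov C M j (z - z') *
      (pairCount n (-(k z z').1) / n * (pairCount n (-(k z z').2) / n))) atTop
      (𝓝 (∑ z : Site L R, ∑ z', f z * f z' * torusCov C M j (z - z') * (1 * 1))) :=
    tendsto_finsetSum _ fun z _ => tendsto_finsetSum _ fun z' _ =>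
      ((tendsto_pairCount _).mul (tendsto_pairCount _)).const_mul _
  refine (ge_of_tendsto' hlim key).trans (le_of_eq ?_)
  simp only [dotProduct, Matrix.mulVec, Matrix.of_apply, Finset.mul_sum, star_trivial]
  exact Finset.sum_congr rfl fun z _ => Finset.sum_congr rfl fun z' _ => by ring

end TorusCovariance

/-! ### Exponential moments of sums of squares -/

section ExponentialMoments
open MeasureTheory ProbabilityTheory

/-- `Q` has exponential moments of size `1 / V`. -/
structure ExpQuad {T : Type*} [MeasurableSpace T] (μ : Measure T) (Q : T → ℝ) (V : ℝ) : Prop where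
  measurable : Measurable Q
  pos : 0 < V
  bound : ∀ t, 0 ≤ t → 4 * (t * V) ≤ 1 →
    Integrable (fun ζ => Real.exp (t * Q ζ)) μ ∧ ∫ ζ, Real.exp (t * Q ζ) ∂μ ≤ 2

variable {T : Type*} [MeasurableSpace T] {μ : Measure T} {Q Q' : T → ℝ} {V V' : ℝ}

lemma expQuad_zero [IsProbabilityMeasure μ] (hV : 0 < V) : ExpQuad μ (fun _ => 0) V :=
  ⟨measurable_const, hV, fun t _ _ => ⟨by simp, by simp⟩⟩

lemma ExpQuad.mono (h : ExpQuad μ Q V) (hQ' : Measurable Q') (hQ : ∀ ζ, Q' ζ ≤ Q ζ)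
    (hV : V ≤ V') : ExpQuad μ Q' V' := by
  refine ⟨hQ', h.pos.trans_le hV, fun t ht htV => ?_⟩
  obtain ⟨h1, h2⟩ := h.bound t ht (le_trans (by gcongr) htV)
  have hle : ∀ ζ, Real.exp (t * Q' ζ) ≤ Real.exp (t * Q ζ) := fun ζ => by gcongr; exact hQ ζ
  have hi : Integrable (fun ζ => Real.exp (t * Q' ζ)) μ :=
    h1.mono' (by fun_prop) (Filter.Eventually.of_forall fun ζ => by
      rw [Real.norm_eq_abs, Real.abs_exp]; exact hle ζ)
  exact ⟨hi, (integral_mono hi h1 hle).trans h2⟩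

lemma ExpQuad.const_mul (h : ExpQuad μ Q V) {w : ℝ} (hw : 0 < w) :
    ExpQuad μ (fun ζ => w * Q ζ) (w * V) := by
  refine ⟨h.measurable.const_mul w, mul_pos hw h.pos, fun t ht htV => ?_⟩
  have := h.bound (t * w) (by positivity) (by rwa [mul_assoc])
  simpa only [mul_assoc] using this

/-- Convexity of the exponential with weights V/(V + V') and V'/(V + V'): no independence is needed,
and the bound 2 is preserved. -/
lemma ExpQuad.add (h : ExpQuad μ Q V) (h' : ExpQuad μ Q' V') :
    ExpQuad μ (fun ζ => Q ζ + Q' ζ) (V + V') := by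
  have hV := h.pos
  have hV' := h'.pos
  refine ⟨h.measurable.add h'.measurable, by positivity, fun t ht htV => ?_⟩
  set p := V / (V + V') with hp
  set q := V' / (V + V') with hq
  have hp0 : 0 < p := by positivity
  have hq0 : 0 < q := by positivity
  have hpq : p + q = 1 := by rw [hp, hq]; field_simp
  obtain ⟨a1, a2⟩ := h.bound (t / p) (by positivity) (by
    rwa [show t / p * V = t * (V + V') by rw [hp]; field_simp])
  obtain ⟨b1, b2⟩ := h'.bound (t / q) (by positivity) (by
    rwa [show t / q * V' = t * (V + V') by rw [hq]; field_simp])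
  have hle : ∀ ζ, Real.exp (t * (Q ζ + Q' ζ)) ≤
      p * Real.exp (t / p * Q ζ) + q * Real.exp (t / q * Q' ζ) := by
    intro ζ
    have := convexOn_exp.2 (Set.mem_univ (t / p * Q ζ)) (Set.mem_univ (t / q * Q' ζ)) hp0.le
      hq0.le hpq
    simp only [smul_eq_mul] at this
    refine le_trans (le_of_eq ?_) this
    congr 1
    field_simp
  have hi : Integrable (fun ζ => p * Real.exp (t / p * Q ζ) + q * Real.exp (t / q * Q' ζ)) μ :=
    (a1.const_mul p).add (b1.const_mul q)
  have hm := h.measurable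
  have hm' := h'.measurable
  have hi' : Integrable (fun ζ => Real.exp (t * (Q ζ + Q' ζ))) μ :=
    hi.mono' (by fun_prop) (Filter.Eventually.of_forall fun ζ => by
      rw [Real.norm_eq_abs, Real.abs_exp]; exact hle ζ)
  refine ⟨hi', (integral_mono hi' hi hle).trans ?_⟩
  rw [integral_add (a1.const_mul p) (b1.const_mul q), integral_const_mul, integral_const_mul]
  calc _ ≤ p * 2 + q * 2 := by gcongr
    _ = 2 := by rw [← add_mul, hpq, one_mul]

/-- The parameters add up; the extra 1 keeps the parameter positive for the empty sum. -/
lemma ExpQuad.sum [IsProbabilityMeasure μ] {ι : Type*} {s : Finset ι} {Q : ι → T → ℝ}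
    (hV : 0 < V) (h : ∀ i ∈ s, ExpQuad μ (Q i) V) {n : ℝ} (hn : s.card + 1 ≤ n) :
    ExpQuad μ (fun ζ => ∑ i ∈ s, Q i ζ) (n * V) := by
  classical
  have : ExpQuad μ (fun ζ => ∑ i ∈ s, Q i ζ) ((s.card + 1) * V) := by
    clear hn
    induction s using Finset.induction_on with
    | empty => simpa using expQuad_zero hV
    | insert a s ha ih =>
      simp only [Finset.sum_insert ha, Finset.card_insert_of_notMem ha]
      have := (h a (Finset.mem_insert_self _ _)).add
        (ih fun i hi => h i (Finset.mem_insert_of_mem hi))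
      refine this.mono this.measurable (fun _ => le_rfl) (le_of_eq ?_)
      push_cast; ring
  exact this.mono this.measurable (fun _ => le_rfl) (by gcongr)

end ExponentialMoments

/-! ### Variances of derivatives of the fluctuation field -/

section Variance
open MeasureTheory ProbabilityTheory

variable {L R : ℕ} [NeZero L]

lemma exists_latticeDeriv_eq_sum (l : List (Fin 4)) (x : Site L R) :
    ∃ a : Site L R → ℝ, ∀ φ : Site L R → ℝ, latticeDeriv l φ x = ∑ z, a z * φ z := by
  classical
  induction l generalizing x with
  | nil => exact ⟨Pi.single x 1, fun φ => by simp [latticeDeriv, Pi.single_apply]⟩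
  | cons μ l ih =>
    obtain ⟨a, ha⟩ := ih (x + unitVec (ZMod (L ^ R)) μ)
    obtain ⟨b, hb⟩ := ih x
    exact ⟨a - b, fun φ => by
      simp only [latticeDeriv, ha, hb, Pi.sub_apply, sub_mul, Finset.sum_sub_distrib]⟩

/-- The direction opposite to `μ`. -/
def opposite (μ : Fin 4) : Fin 4 := μ + 2

lemma unitVec_opposite {A : Type*} [Ring A] (μ : Fin 4) :
    unitVec A (opposite μ) = -unitVec A μ := by
  fin_cases μ <;> simp [opposite, unitVec]

lemma latticeDeriv_reflect {A E : Type*} [Ring A] [AddCommGroup E] (l : List (Fin 4))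
    (G : A × A → E) (y x : A × A) :
    latticeDeriv l (fun z => G (y - z)) x = latticeDeriv (l.map opposite) G (y - x) := by
  induction l generalizing x with
  | nil => rfl
  | cons μ l ih =>
    simp only [latticeDeriv, ih, List.map_cons, unitVec_opposite]
    rw [sub_add_eq_sub_sub, sub_eq_add_neg (y - x)]

lemma latticeDeriv_append {A E : Type*} [Ring A] [AddCommGroup E] (l l' : List (Fin 4))
    (φ : A × A → E) (x : A × A) :
    latticeDeriv (l ++ l') φ x = latticeDeriv l (latticeDeriv l' φ) x := by
  induction l generalizing x with
  | nil => rfl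
  | cons μ l ih => simp only [List.cons_append, latticeDeriv, ih]

/-- A difference in the second argument of G(y - z) is a difference of G in the opposite direction,
so covariances of derivatives are derivatives of the covariance of doubled order. -/
lemma latticeDeriv_latticeDeriv_sub (l l' : List (Fin 4)) (G : Site L R → ℝ) (x x' : Site L R) :
    latticeDeriv l (fun y => latticeDeriv l' (fun z => G (y - z)) x') x =
      latticeDeriv (l ++ l'.map opposite) G (x - x') := by
  simp only [latticeDeriv_reflect]
  simp only [sub_eq_add_neg]
  rw [latticeDeriv_translate l (latticeDeriv (l'.map opposite) G), latticeDeriv_append]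

lemma measurable_latticeDeriv (l : List (Fin 4)) (x : Site L R) :
    Measurable fun ζ : EuclideanSpace ℝ (Site L R) => latticeDeriv l (fun y => ζ y) x := by
  obtain ⟨a, ha⟩ := exists_latticeDeriv_eq_sum l x
  simp only [ha]
  fun_prop

/-- A derivative of the field at a site is a linear functional, hence a centred one-dimensional
Gaussian, whose variance is the derivative of `G` at 0. -/
lemma expQuad_latticeDeriv {G : Site L R → ℝ}
    (hS : (Matrix.of fun x y : Site L R => G (x - y)).PosSemidef) {l : List (Fin 4)} {V : ℝ}
    (hV0 : 0 < V) (hV : latticeDeriv (l ++ l.map opposite) G 0 ≤ V) (x : Site L R) :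
    ExpQuad (multivariateGaussian 0 (Matrix.of fun x y : Site L R => G (x - y)))
      (fun ζ => latticeDeriv l (fun y => ζ y) x ^ 2) V := by
  refine ⟨(measurable_latticeDeriv l x).pow_const 2, hV0, fun t ht htV => ?_⟩
  obtain ⟨a, ha⟩ := exists_latticeDeriv_eq_sum l x
  set S := Matrix.of fun x y : Site L R => G (x - y) with hSdef
  set Λ : StrongDual ℝ (EuclideanSpace ℝ (Site L R)) := innerSL ℝ (WithLp.toLp 2 a) with hΛ
  have hΛa : ∀ ζ : EuclideanSpace ℝ (Site L R), Λ ζ = latticeDeriv l (fun y => ζ y) x := by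
    intro ζ
    rw [ha, hΛ, innerSL_apply_apply, PiLp.inner_apply]
    exact Finset.sum_congr rfl fun z _ => by simp [mul_comm]
  have hvar : Var[Λ; multivariateGaussian 0 S] = latticeDeriv (l ++ l.map opposite) G 0 := by
    have h1 : Var[Λ; multivariateGaussian 0 S] =
        covarianceBilin (multivariateGaussian 0 S) (WithLp.toLp 2 a) (WithLp.toLp 2 a) := by
      rw [covarianceBilin_self IsGaussian.memLp_two_id]
      rfl
    rw [h1, covarianceBilin_multivariateGaussian hS, ← sub_self x,
      ← latticeDeriv_latticeDeriv_sub, ha]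
    simp only [ha, dotProduct, Matrix.mulVec]
    refine Finset.sum_congr rfl fun y _ => ?_
    congr 1
    exact Finset.sum_congr rfl fun z _ => by rw [hSdef, Matrix.of_apply, mul_comm]
  have hmap : (multivariateGaussian 0 S).map Λ =
      gaussianReal 0 (latticeDeriv (l ++ l.map opposite) G 0).toNNReal := by
    rw [IsGaussian.map_eq_gaussianReal, hvar, ContinuousLinearMap.integral_comp_id_comm
      IsGaussian.integrable_id, integral_id_multivariateGaussian, map_zero]
  have h0 : 0 ≤ latticeDeriv (l ++ l.map opposite) G 0 := hvar ▸ variance_nonneg _ _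
  obtain ⟨h1, h2⟩ := integrable_exp_sq_gaussianReal
    (v := (latticeDeriv (l ++ l.map opposite) G 0).toNNReal) (a := t) (by
      rw [Real.coe_toNNReal _ h0]
      exact le_trans (by gcongr) htV)
  rw [← hmap] at h1 h2
  have hm : AEMeasurable Λ (multivariateGaussian 0 S) := Λ.continuous.measurable.aemeasurable
  have hm' : AEStronglyMeasurable (fun s : ℝ => Real.exp (t * s ^ 2))
      ((multivariateGaussian 0 S).map Λ) := by fun_prop
  rw [integrable_map_measure hm' hm] at h1
  rw [integral_map hm hm'] at h2
  simp only [Function.comp_def, hΛa] at h1 h2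
  exact ⟨h1, h2⟩

end Variance

/-! ### Scaling of the derivatives of the covariance -/

section DerivativeBounds

variable {γ : ℕ} {C : ℕ → ℤ × ℤ → ℝ} {L R : ℕ} [NeZero L]

lemma latticeDeriv_scaleCov (M j : ℕ) (l : List (Fin 4)) (x : ℤ × ℤ) :
    latticeDeriv l (scaleCov C M j) x =
      ∑ h ∈ Finset.Ico (j * M) ((j + 1) * M), latticeDeriv l (C h) x := by
  induction l generalizing x with
  | nil => rfl
  | cons μ l ih => simp only [latticeDeriv, ih, Finset.sum_sub_distrib]

lemma sum_Ico_pow_le {r : ℝ} (h0 : 0 ≤ r) (h1 : r ≤ 1 / 2) (a b : ℕ) :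
    ∑ h ∈ Finset.Ico a b, r ^ h ≤ 2 * r ^ a := by
  rcases le_total a b with hab | hab
  · have key : ∑ h ∈ Finset.Ico a b, r ^ h ≤ 2 * r ^ a - 2 * r ^ b := by
      induction b, hab using Nat.le_induction with
      | base => simp
      | succ b hab ih =>
        rw [Finset.sum_Ico_succ_top hab, pow_succ]
        have : 0 ≤ r ^ b := by positivity
        nlinarith
    have : 0 ≤ r ^ b := by positivity
    linarith
  · rw [Finset.Ico_eq_empty_of_le hab]
    simp only [Finset.sum_empty]
    positivity

/-- For n ≥ 1 the bounds γ^{-nh} form a geometric series dominated by its first scale h = jM, so the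
constant is uniform in M. This fails for n = 0, where Γ_j(0) grows like log L. -/
lemma IsFiniteRangeDecomposition.exists_scaleCov_deriv_le (hγ : 1 < γ)
    (hC : IsFiniteRangeDecomposition γ C) {n : ℕ} (hn : 1 ≤ n) :
    ∃ c : ℝ, 0 ≤ c ∧ ∀ (M j : ℕ) (l : List (Fin 4)), l.length = n → ∀ x : ℤ × ℤ,
      |latticeDeriv l (scaleCov C M j) x| ≤ c * (((γ ^ M : ℕ) : ℝ) ^ (n * j))⁻¹ := by
  obtain ⟨c, hc⟩ := hC.derivBound n hn
  have hγ2 : (2 : ℝ) ≤ γ := by exact_mod_cast hγ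
  have hc0 : 0 ≤ c := by
    have := (abs_nonneg _).trans (hc 0 (fun _ => 0) 0)
    simpa using this
  refine ⟨2 * c, by positivity, ?_⟩
  rintro M j l rfl x
  rw [latticeDeriv_scaleCov]
  refine (Finset.abs_sum_le_sum_abs _ _).trans ?_
  set r : ℝ := ((γ : ℝ) ^ l.length)⁻¹ with hr
  have hr1 : r ≤ 1 / 2 := by
    rw [hr, one_div]
    refine inv_anti₀ (by norm_num) ?_
    calc (2 : ℝ) ≤ γ := hγ2
      _ = (γ : ℝ) ^ 1 := (pow_one _).symm
      _ ≤ _ := pow_le_pow_right₀ (by linarith) hn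
  calc ∑ h ∈ Finset.Ico (j * M) ((j + 1) * M), |latticeDeriv l (C h) x|
      ≤ ∑ h ∈ Finset.Ico (j * M) ((j + 1) * M), c * r ^ h := by
        refine Finset.sum_le_sum fun h _ => ?_
        have := hc h l.get x
        rw [List.ofFn_get] at this
        rwa [hr, inv_pow, ← pow_mul]
    _ ≤ c * (2 * r ^ (j * M)) := by
        rw [← Finset.mul_sum]
        gcongr
        exact sum_Ico_pow_le (by positivity) hr1 _ _
    _ = _ := by
        rw [hr, inv_pow, ← pow_mul]
        push_cast
        rw [← pow_mul, show M * (l.length * j) = l.length * (j * M) by ring]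
        ring

lemma unitVec_eq_ofInt (μ : Fin 4) :
    (unitVec (ZMod (L ^ R)) μ : Site L R) = ofInt L R (unitVec ℤ μ).1 (unitVec ℤ μ).2 := by
  fin_cases μ <;> simp [unitVec, ofInt]

lemma natAbs_unitVec_le (μ : Fin 4) :
    (unitVec ℤ μ).1.natAbs ≤ 1 ∧ (unitVec ℤ μ).2.natAbs ≤ 1 := by
  fin_cases μ <;> simp [unitVec]

lemma toInt_ofInt {a b : ℤ} (ha : 2 * a.natAbs < L ^ R) (hb : 2 * b.natAbs < L ^ R) :
    toInt (ofInt L R a b) = (a, b) := by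
  have : ∀ a : ℤ, 2 * a.natAbs < L ^ R → (a : ZMod (L ^ R)).valMinAbs = a := fun a ha =>
    (ZMod.valMinAbs_spec _ _).2 ⟨rfl, by
      zify at ha
      constructor <;> push_cast <;> cases abs_cases a <;> omega⟩
  simp [toInt, ofInt, this a ha, this b hb]

/-- As long as the sites involved stay below half the period, torus and ℤ² derivatives coincide. -/
lemma latticeDeriv_torusCov (M j : ℕ) (l : List (Fin 4)) {a b : ℤ}
    (ha : 2 * (a.natAbs + l.length) < L ^ R) (hb : 2 * (b.natAbs + l.length) < L ^ R) :
    latticeDeriv l (fun x : Site L R => torusCov C M j x) (ofInt L R a b) =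
      latticeDeriv l (scaleCov C M j) (a, b) := by
  induction l generalizing a b with
  | nil =>
    simp only [latticeDeriv, List.length_nil, add_zero] at *
    rw [torusCov_eq, toInt_ofInt ha hb]
  | cons μ l ih =>
    have := natAbs_unitVec_le μ
    simp only [latticeDeriv, List.length_cons] at *
    rw [unitVec_eq_ofInt, ofInt_add, ih (by omega) (by omega), ih (by omega) (by omega)]
    rfl

/-- The variance of the derivatives of the fluctuation field. -/
lemma IsFiniteRangeDecomposition.exists_variance_le (hγ : 1 < γ)
    (hC : IsFiniteRangeDecomposition γ C) : ∃ V : ℝ, 0 < V ∧ ∀ (L R M j : ℕ) [NeZero L],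
      L = γ ^ M → 17 ≤ L ^ R → ∀ l : List (Fin 4), 1 ≤ l.length → l.length ≤ 4 →
      latticeDeriv (l ++ l.map opposite) (fun x : Site L R => torusCov C M j x) 0 ≤
        V * ((L : ℝ) ^ (2 * l.length * j))⁻¹ := by
  -- Field derivatives of order 1 to 4 have variances given by covariance derivatives of order 2, 4,
  -- 6, 8. With order at most 8 the condition 17 ≤ L^R excludes wrapping.
  obtain ⟨c₁, h1, H1⟩ := hC.exists_scaleCov_deriv_le hγ (n := 2) (by norm_num)
  obtain ⟨c₂, h2, H2⟩ := hC.exists_scaleCov_deriv_le hγ (n := 4) (by norm_num)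
  obtain ⟨c₃, h3, H3⟩ := hC.exists_scaleCov_deriv_le hγ (n := 6) (by norm_num)
  obtain ⟨c₄, h4, H4⟩ := hC.exists_scaleCov_deriv_le hγ (n := 8) (by norm_num)
  refine ⟨c₁ + c₂ + c₃ + c₄ + 1, by positivity, ?_⟩
  intro L R M j _ hL hLR l hl1 hl4
  have e := latticeDeriv_torusCov (C := C) (L := L) (R := R) M j (l ++ l.map opposite) (a := 0)
    (b := 0) (by simp; omega) (by simp; omega)
  rw [ofInt_zero] at e
  rw [e]
  refine (le_abs_self _).trans ?_
  subst hL
  have hlen : (l ++ l.map opposite).length = 2 * l.length := by simp; ring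
  obtain hl | hl | hl | hl : l.length = 1 ∨ l.length = 2 ∨ l.length = 3 ∨ l.length = 4 := by omega
  · rw [hl]; exact (H1 M j _ (by omega) _).trans (by gcongr; linarith)
  · rw [hl]; exact (H2 M j _ (by omega) _).trans (by gcongr; linarith)
  · rw [hl]; exact (H3 M j _ (by omega) _).trans (by gcongr; linarith)
  · rw [hl]; exact (H4 M j _ (by omega) _).trans (by gcongr; linarith)

end DerivativeBounds

/-! ### A discrete Sobolev inequality on a square -/

section DiscreteSobolev

/-- Compare g(p) with every g(u), the difference being at most the total variation, and sum over u;
Cauchy–Schwarz turns the total variation into squares. -/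
lemma sq_le_sum_sq_add_sum_sq {n p : ℕ} (hp : p < n) (g : ℕ → ℝ) :
    n * g p ^ 2 ≤ 2 * ∑ u ∈ Finset.range n, g u ^ 2
      + 2 * n ^ 2 * ∑ u ∈ Finset.range n, (g (u + 1) - g u) ^ 2 := by
  set D := ∑ u ∈ Finset.range n, |g (u + 1) - g u| with hD
  have hle : ∀ u v, u ≤ v → v < n → |g v - g u| ≤ D := by
    intro u v huv hv
    have h := dist_le_Ico_sum_dist g huv
    simp only [Real.dist_eq] at h
    rw [abs_sub_comm]
    refine h.trans ?_
    rw [hD]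
    simp only [abs_sub_comm (g (_ + 1))]
    exact Finset.sum_le_sum_of_subset_of_nonneg (fun w hw => by
      rw [Finset.mem_Ico] at hw; rw [Finset.mem_range]; omega) fun _ _ _ => abs_nonneg _
  have hD2 : D ^ 2 ≤ n * ∑ u ∈ Finset.range n, (g (u + 1) - g u) ^ 2 := by
    have := sq_sum_le_card_mul_sum_sq (s := Finset.range n) (f := fun u => |g (u + 1) - g u|)
    simpa using this
  have hu : ∀ u ∈ Finset.range n, g p ^ 2 ≤ 2 * g u ^ 2 + 2 * D ^ 2 := by
    intro u hu
    have h1 : |g p - g u| ≤ D := by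
      rcases le_total u p with h | h
      · exact hle u p h hp
      · rw [abs_sub_comm]; exact hle p u h (Finset.mem_range.1 hu)
    have h2 : (g p - g u) ^ 2 ≤ D ^ 2 := sq_le_sq.2 (h1.trans (le_abs_self D))
    nlinarith [sq_nonneg (g u - (g p - g u))]
  have := Finset.sum_le_sum hu
  rw [Finset.sum_const, Finset.card_range, nsmul_eq_mul, Finset.sum_add_distrib, ← Finset.mul_sum,
    Finset.sum_const, Finset.card_range, nsmul_eq_mul] at this
  have hn : (0 : ℝ) ≤ n := by positivity
  nlinarith [mul_le_mul_of_nonneg_left hD2 hn]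

/-- The one-dimensional inequality in one variable after the other, which is the origin of the mixed
second difference. -/
lemma sq_le_sum_sum_sq {n p q : ℕ} (hp : p < n) (hq : q < n) (g : ℕ → ℕ → ℝ) :
    (n : ℝ) ^ 2 * g p q ^ 2 ≤
      4 * ∑ u ∈ Finset.range n, ∑ v ∈ Finset.range n, g u v ^ 2
      + 4 * n ^ 2 * ∑ u ∈ Finset.range n, ∑ v ∈ Finset.range n, (g u (v + 1) - g u v) ^ 2
      + 4 * n ^ 2 * ∑ u ∈ Finset.range n, ∑ v ∈ Finset.range n, (g (u + 1) v - g u v) ^ 2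
      + 4 * n ^ 4 * ∑ u ∈ Finset.range n, ∑ v ∈ Finset.range n,
        ((g (u + 1) (v + 1) - g u (v + 1)) - (g (u + 1) v - g u v)) ^ 2 := by
  have hn : (0 : ℝ) ≤ n := by positivity
  have h1 := mul_le_mul_of_nonneg_left (sq_le_sum_sq_add_sum_sq hp fun u => g u q) hn
  have h2 := Finset.sum_le_sum fun u (_ : u ∈ Finset.range n) =>
    sq_le_sum_sq_add_sum_sq hq fun v => g u v
  have h3 := Finset.sum_le_sum fun u (_ : u ∈ Finset.range n) =>
    sq_le_sum_sq_add_sum_sq hq fun v => g (u + 1) v - g u v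
  rw [← Finset.mul_sum, Finset.sum_add_distrib, ← Finset.mul_sum, ← Finset.mul_sum] at h2 h3
  nlinarith [mul_le_mul_of_nonneg_left h3 (by positivity : (0 : ℝ) ≤ 2 * n ^ 2)]

end DiscreteSobolev

/-! ### The exponent of the field regulator -/

section Regulator
open MeasureTheory ProbabilityTheory

variable {L R : ℕ} [NeZero L]

/-- The exponent of the field regulator, divided by `κ`. -/
noncomputable def regSum (c₁ c₃ : ℝ) (j : ℕ) (φ : Site L R → ℝ) (X : Finset (Site L R)) : ℝ :=
  c₁ * gradSqSum X φ + c₃ * (L ^ j * gradSqSum (boundary X) φ)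
    + c₁ * ∑ B ∈ blocksOf j X, (gradSup j 2 (smallNbhd j B) φ : ℝ) ^ 2

lemma regulator_eq (c₁ c₃ κ : ℝ) (j : ℕ) (φ : Site L R → ℝ) (X : Finset (Site L R)) :
    regulator c₁ c₃ κ j φ X = Real.exp (κ * regSum c₁ c₃ j φ X) := by
  have hL : (L : ℝ) ≠ 0 := by exact_mod_cast NeZero.ne L
  rw [regulator, regSum]
  congr 1
  field_simp
  ring

lemma gradSqSum_nonneg (X : Finset (Site L R)) (φ : Site L R → ℝ) : 0 ≤ gradSqSum X φ :=
  Finset.sum_nonneg fun x _ => by positivity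

lemma continuous_latticeDeriv (l : List (Fin 4)) (x : Site L R) :
    Continuous fun φ : Site L R → ℝ => latticeDeriv l φ x := by
  obtain ⟨a, ha⟩ := exists_latticeDeriv_eq_sum l x
  simp only [ha]
  fun_prop

lemma continuous_gradSup (j n : ℕ) (Y : Finset (Site L R)) :
    Continuous fun φ : Site L R → ℝ => gradSup j n Y φ := by
  have := continuous_latticeDeriv (L := L) (R := R)
  unfold gradSup
  refine Continuous.finset_sup_apply fun μ _ => Continuous.finset_sup_apply fun x _ => ?_
  fun_prop

lemma continuous_regSum (c₁ c₃ : ℝ) (j : ℕ) (X : Finset (Site L R)) :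
    Continuous fun φ : Site L R → ℝ => regSum c₁ c₃ j φ X := by
  have h1 := continuous_latticeDeriv (L := L) (R := R)
  have h2 : ∀ Y : Finset (Site L R), Continuous fun φ : Site L R → ℝ => gradSqSum Y φ := by
    intro Y
    unfold gradSqSum
    fun_prop
  have h3 := continuous_gradSup (L := L) (R := R) j 2
  unfold regSum
  fun_prop

end Regulator

/-! ### Exponential moments of the regulator -/

section RegulatorMoments
open MeasureTheory ProbabilityTheory

variable {L R : ℕ} [NeZero L]

/-- The bound on the square of a derivative given by the discrete Sobolev inequality. -/
noncomputable def sobolevSum (o : Site L R) (n : ℕ) (l : List (Fin 4)) (φ : Site L R → ℝ) : ℝ :=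
  4 * ((n : ℝ) ^ 2)⁻¹ * ∑ p ∈ Finset.range n ×ˢ Finset.range n,
      latticeDeriv l φ (o + ofInt L R p.1 p.2) ^ 2
    + 4 * ∑ p ∈ Finset.range n ×ˢ Finset.range n,
      latticeDeriv (1 :: l) φ (o + ofInt L R p.1 p.2) ^ 2
    + 4 * ∑ p ∈ Finset.range n ×ˢ Finset.range n,
      latticeDeriv (0 :: l) φ (o + ofInt L R p.1 p.2) ^ 2
    + 4 * (n : ℝ) ^ 2 * ∑ p ∈ Finset.range n ×ˢ Finset.range n,
      latticeDeriv (1 :: 0 :: l) φ (o + ofInt L R p.1 p.2) ^ 2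

lemma sq_latticeDeriv_le_sobolevSum (o : Site L R) {n p q : ℕ} (hp : p < n) (hq : q < n)
    (l : List (Fin 4)) (φ : Site L R → ℝ) :
    latticeDeriv l φ (o + ofInt L R p q) ^ 2 ≤ sobolevSum o n l φ := by
  have h := sq_le_sum_sum_sq hp hq fun u v => latticeDeriv l φ (o + ofInt L R u v)
  have e0 : ∀ u v : ℕ, o + ofInt L R ((u + 1 : ℕ) : ℤ) v =
      o + ofInt L R u v + unitVec (ZMod (L ^ R)) 0 := by
    intro u v; simp [ofInt, unitVec, add_assoc]
  have e1 : ∀ u v : ℕ, o + ofInt L R u ((v + 1 : ℕ) : ℤ) =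
      o + ofInt L R u v + unitVec (ZMod (L ^ R)) 1 := by
    intro u v; simp [ofInt, unitVec, add_assoc]
  simp only [e1, e0] at h
  have hn : (0 : ℝ) < n := by exact_mod_cast (by omega : 0 < n)
  refine le_of_mul_le_mul_left (h.trans (le_of_eq ?_)) (by positivity : (0 : ℝ) < (n : ℝ) ^ 2)
  simp only [sobolevSum, Finset.sum_product, latticeDeriv]
  have c : ∀ u v : ℕ, o + ofInt L R u v + unitVec (ZMod (L ^ R)) 0 + unitVec (ZMod (L ^ R)) 1 =
      o + ofInt L R u v + unitVec (ZMod (L ^ R)) 1 + unitVec (ZMod (L ^ R)) 0 :=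
    fun u v => add_right_comm _ _ _
  simp only [c]
  field_simp

/-- For n of order L^j all four terms have the same scaling L^{-4j}: each extra derivative gains
L^{-j} and its weight costs n. The constant is 8 + 16·97² + 8·97⁴ ≤ 10⁹, and 97 = 2·48 + 1 reflects
that a neighbourhood of diameter scale 48L^j fits in a square of side 2·48L^j + 1. -/
lemma expQuad_sobolevSum {μ : Measure (EuclideanSpace ℝ (Site L R))} [IsProbabilityMeasure μ]
    {V : ℝ} {j n : ℕ} (hV : 0 < V) (hn1 : 1 ≤ n) (hn : n ≤ 97 * L ^ j) {l : List (Fin 4)}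
    (h2 : ∀ x, ExpQuad μ (fun ζ => latticeDeriv l (fun y => ζ y) x ^ 2) (V * ((L : ℝ) ^ (4 * j))⁻¹))
    (h3 : ∀ ν x, ExpQuad μ (fun ζ => latticeDeriv (ν :: l) (fun y => ζ y) x ^ 2)
      (V * ((L : ℝ) ^ (6 * j))⁻¹))
    (h4 : ∀ ν ν' x, ExpQuad μ (fun ζ => latticeDeriv (ν :: ν' :: l) (fun y => ζ y) x ^ 2)
      (V * ((L : ℝ) ^ (8 * j))⁻¹)) (o : Site L R) :
    ExpQuad μ (fun ζ => sobolevSum o n l (fun y => ζ y)) (10 ^ 9 * V * ((L : ℝ) ^ (4 * j))⁻¹) := by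
  have hn0 : (0 : ℝ) < n := by exact_mod_cast hn1
  have hn' : (n : ℝ) ≤ 97 * L ^ j := by exact_mod_cast hn
  have hL : (0 : ℝ) < L := by exact_mod_cast NeZero.pos L
  have hcard : ((Finset.range n ×ˢ Finset.range n).card : ℝ) + 1 ≤ 2 * (n : ℝ) ^ 2 := by
    rw [Finset.card_product, Finset.card_range]
    have : (1 : ℝ) ≤ n := by exact_mod_cast hn1
    push_cast
    nlinarith
  have s1 := (ExpQuad.sum (s := Finset.range n ×ˢ Finset.range n) (by positivity)
    (fun p _ => h2 (o + ofInt L R p.1 p.2)) hcard).const_mul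
    (by positivity : 0 < 4 * ((n : ℝ) ^ 2)⁻¹)
  have s2 := (ExpQuad.sum (s := Finset.range n ×ˢ Finset.range n) (by positivity)
    (fun p _ => h3 1 (o + ofInt L R p.1 p.2)) hcard).const_mul (by norm_num : (0 : ℝ) < 4)
  have s3 := (ExpQuad.sum (s := Finset.range n ×ˢ Finset.range n) (by positivity)
    (fun p _ => h3 0 (o + ofInt L R p.1 p.2)) hcard).const_mul (by norm_num : (0 : ℝ) < 4)
  have s4 := (ExpQuad.sum (s := Finset.range n ×ˢ Finset.range n) (by positivity)
    (fun p _ => h4 1 0 (o + ofInt L R p.1 p.2)) hcard).const_mul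
    (by positivity : 0 < 4 * (n : ℝ) ^ 2)
  have := ((s1.add s2).add s3).add s4
  refine this.mono this.measurable (fun _ => le_rfl) ?_
  set a : ℝ := (L : ℝ) ^ j with ha
  have ha0 : 0 < a := by positivity
  have p4 : (L : ℝ) ^ (4 * j) = a ^ 4 := by rw [ha, ← pow_mul, mul_comm]
  have p6 : (L : ℝ) ^ (6 * j) = a ^ 6 := by rw [ha, ← pow_mul, mul_comm]
  have p8 : (L : ℝ) ^ (8 * j) = a ^ 8 := by rw [ha, ← pow_mul, mul_comm]
  rw [p4, p6, p8]
  obtain ⟨r, hr⟩ : ∃ r, r = (n : ℝ) / a := ⟨_, rfl⟩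
  have hna : (n : ℝ) = r * a := by rw [hr]; field_simp
  have hr0 : 0 < r := by rw [hr]; positivity
  have hr97 : r ≤ 97 := by rw [hr, div_le_iff₀ ha0]; exact hn'
  rw [hna]
  have e : 4 * ((r * a) ^ 2)⁻¹ * (2 * (r * a) ^ 2 * (V * (a ^ 4)⁻¹)) +
      4 * (2 * (r * a) ^ 2 * (V * (a ^ 6)⁻¹)) + 4 * (2 * (r * a) ^ 2 * (V * (a ^ 6)⁻¹)) +
      4 * (r * a) ^ 2 * (2 * (r * a) ^ 2 * (V * (a ^ 8)⁻¹)) =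
      (8 + 16 * r ^ 2 + 8 * r ^ 4) * V * (a ^ 4)⁻¹ := by
    field_simp
    ring
  rw [e]
  gcongr
  calc 8 + 16 * r ^ 2 + 8 * r ^ 4 ≤ 8 + 16 * 97 ^ 2 + 8 * 97 ^ 4 := by gcongr
    _ ≤ 10 ^ 9 := by norm_num

lemma expQuad_gradSqSum {μ : Measure (EuclideanSpace ℝ (Site L R))} [IsProbabilityMeasure μ]
    {V w : ℝ} {j : ℕ} (hV : 0 < V)
    (h1 : ∀ ν x, ExpQuad μ (fun ζ => latticeDeriv [ν] (fun y => ζ y) x ^ 2)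
      (V * ((L : ℝ) ^ (2 * j))⁻¹)) {X : Finset (Site L R)} (hX : (X.card : ℝ) + 1 ≤ w) :
    ExpQuad μ (fun ζ => gradSqSum X fun y => ζ y) (5 / 2 * w * (V * ((L : ℝ) ^ (2 * j))⁻¹)) := by
  have hL : (0 : ℝ) < L := by exact_mod_cast NeZero.pos L
  have s1 : ∀ x, ExpQuad μ (fun ζ => 1 / 2 * ∑ ν : Fin 4, latticeDeriv [ν] (fun y => ζ y) x ^ 2)
      (1 / 2 * (5 * (V * ((L : ℝ) ^ (2 * j))⁻¹))) := fun x =>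
    (ExpQuad.sum (s := Finset.univ) (by positivity) (fun ν _ => h1 ν x)
      (by simp; norm_num)).const_mul (by norm_num)
  have s2 := ExpQuad.sum (s := X) (by positivity) (fun x _ => s1 x) hX
  refine s2.mono ?_ (fun ζ => le_of_eq ?_) (le_of_eq (by ring))
  · have := s2.measurable
    simpa only [gradSqSum, sq_abs] using this
  · simp only [gradSqSum, sq_abs]

/-- The exponential moments of the exponent of the regulator of a small polymer. -/
lemma expQuad_regSum {μ : Measure (EuclideanSpace ℝ (Site L R))} [IsProbabilityMeasure μ]
    {V c₁ c₃ : ℝ} {j : ℕ} (hV : 0 < V) (hc₁ : 0 < c₁) (hc₃ : 0 < c₃) (hL : Odd L)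
    (hLR : 3 ≤ L ^ R) (hj : j ≤ R)
    (h : ∀ l : List (Fin 4), 1 ≤ l.length → l.length ≤ 4 → ∀ x,
      ExpQuad μ (fun ζ => latticeDeriv l (fun y => ζ y) x ^ 2)
      (V * ((L : ℝ) ^ (2 * l.length * j))⁻¹)) {X : Finset (Site L R)} (hX : IsSmall j X) :
    ExpQuad μ (fun ζ => regSum c₁ c₃ j (fun y => ζ y) X)
      (c₁ * (25 / 2 * V) + c₃ * (85 / 2 * V) + c₁ * (10 ^ 11 * V)) := by
  have hL0 : (0 : ℝ) < L := by exact_mod_cast NeZero.pos L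
  have hL1 : (1 : ℝ) ≤ L := by exact_mod_cast NeZero.pos L
  have hpow : ∀ k : ℕ, (1 : ℝ) ≤ (L : ℝ) ^ k := fun k => one_le_pow₀ hL1
  have h1 : ∀ ν x, ExpQuad μ (fun ζ => latticeDeriv [ν] (fun y => ζ y) x ^ 2)
      (V * ((L : ℝ) ^ (2 * j))⁻¹) := fun ν x => by simpa using h [ν] (by simp) (by simp) x
  -- the bulk and the boundary terms
  have t1 := (expQuad_gradSqSum (w := 5 * (L : ℝ) ^ (2 * j)) hV h1 (X := X) (by
    have : (X.card : ℝ) ≤ 4 * (L : ℝ) ^ (2 * j) := by exact_mod_cast hX.card_le hL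
    linarith [hpow (2 * j)])).const_mul hc₁
  have t2 := ((expQuad_gradSqSum (w := 17 * (L : ℝ) ^ j) hV h1 (X := boundary X) (by
    have : ((boundary X).card : ℝ) ≤ 16 * (L : ℝ) ^ j := by exact_mod_cast hX.card_boundary_le hL
    linarith [hpow j])).const_mul (by positivity : 0 < (L : ℝ) ^ j)).const_mul hc₃
  -- the term with the second derivatives
  have t3 : ExpQuad μ (fun ζ => ∑ B ∈ blocksOf j X,
      (gradSup j 2 (smallNbhd j B) (fun y => ζ y) : ℝ) ^ 2) (5 * (17 * (10 ^ 9 * V))) := by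
    refine ExpQuad.sum (by positivity) (fun B hB => ?_) (by
      have : ((blocksOf j X).card : ℝ) ≤ 4 := by exact_mod_cast hX.2
      linarith)
    obtain ⟨c, hc, rfl⟩ := mem_blocks.1 (mem_blocksOf.1 hB).1
    set ρ := 48 * L ^ j with hρ
    -- The lower corner of the square of radius 48L^j around the centre, which contains B*.
    set o := c - ofInt L R ρ ρ with ho
    have hLj : 1 ≤ L ^ j := Nat.one_le_pow _ _ (NeZero.pos L)
    have hsmall : IsSmall j (block j c) := by
      have hb := mem_blocks.2 ⟨c, hc, rfl⟩
      have hbb := blocksOf_block hL hj hb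
      refine ⟨⟨isPolymer_of_mem_blocks hb, nonempty_of_mem_blocks hb, ?_⟩, by rw [hbb]; simp⟩
      rw [hbb]
      intro D hD E hE
      rw [Finset.mem_singleton] at hD hE
      rw [hD, hE]
    have key : ∀ μ' : Fin 2 → Fin 4, ExpQuad μ (fun ζ => (L : ℝ) ^ (4 * j) *
        sobolevSum o (2 * ρ + 1) (List.ofFn μ') (fun y => ζ y)) (10 ^ 9 * V) := by
      intro μ'
      have s := (expQuad_sobolevSum (j := j) (n := 2 * ρ + 1) (l := List.ofFn μ') hV (by omega)
        (by omega)
        (fun x => by simpa using h (List.ofFn μ') (by simp) (by simp) x)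
        (fun ν x => by simpa using h (ν :: List.ofFn μ') (by simp) (by simp) x)
        (fun ν ν' x => by simpa using h (ν :: ν' :: List.ofFn μ') (by simp) (by simp) x)
        o).const_mul (by positivity : 0 < (L : ℝ) ^ (4 * j))
      refine s.mono s.measurable (fun _ => le_rfl) (le_of_eq ?_)
      field_simp
    have s := ExpQuad.sum (s := (Finset.univ : Finset (Fin 2 → Fin 4))) (by positivity)
      (fun μ' _ => key μ') (n := 17) (by simp; norm_num)
    refine s.mono ?_ (fun ζ => ?_) le_rfl
    · have hcont := continuous_gradSup j 2 (smallNbhd j (block j c))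
      have hc' := hcont.comp (PiLp.continuous_ofLp 2 fun _ : Site L R => ℝ)
      have : Continuous fun ζ : EuclideanSpace ℝ (Site L R) =>
          (gradSup j 2 (smallNbhd j (block j c)) (fun y => ζ y) : ℝ) ^ 2 :=
        (NNReal.continuous_coe.comp hc').pow 2
      exact this.measurable
    · have hsob : ∀ μ' : Fin 2 → Fin 4,
          0 ≤ (L : ℝ) ^ (4 * j) * sobolevSum o (2 * ρ + 1) (List.ofFn μ') (fun y => ζ y) := by
        intro μ'
        have := sq_latticeDeriv_le_sobolevSum o (n := 2 * ρ + 1) (p := 0) (q := 0) (by omega)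
          (by omega) (List.ofFn μ') (fun y => ζ y)
        exact mul_nonneg (by positivity) ((sq_nonneg _).trans this)
      have hT : 0 ≤ ∑ μ' : Fin 2 → Fin 4, (L : ℝ) ^ (4 * j) *
          sobolevSum o (2 * ρ + 1) (List.ofFn μ') (fun y => ζ y) :=
        Finset.sum_nonneg fun μ' _ => hsob μ'
      refine (Real.le_sqrt (NNReal.coe_nonneg _) hT).1 ?_
      refine gradSup_le (Real.sqrt_nonneg _) fun x hx μ' => ?_
      refine Real.le_sqrt_of_sq_le ?_
      refine le_trans ?_ (Finset.single_le_sum (fun μ' _ => hsob μ') (Finset.mem_univ μ'))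
      have hd := hsmall.siteAbs_le hL hLR hj hx (center_mem_block j c)
      obtain ⟨a, b, hxab, ha, hb⟩ := exists_ofInt x c
      have hx' : x = o + ofInt L R ((a + ρ).toNat : ℤ) ((b + ρ).toNat : ℤ) := by
        rw [hxab, ho, sub_add_eq_add_sub, add_sub_assoc, ofInt_sub]
        congr 2 <;> omega
      have := sq_latticeDeriv_le_sobolevSum o (n := 2 * ρ + 1) (p := (a + ρ).toNat)
        (q := (b + ρ).toNat) (by omega) (by omega) (List.ofFn μ') (fun y => ζ y)
      rw [← hx'] at this
      rw [mul_pow, Real.norm_eq_abs, sq_abs, ← pow_mul, show 2 * j * 2 = 4 * j by ring]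
      gcongr
  have s := (t1.add t2).add (t3.const_mul hc₁)
  refine s.mono s.measurable (fun _ => le_rfl) ?_
  rw [two_mul, pow_add]
  have e1 : 5 / 2 * (5 * ((L : ℝ) ^ j * (L : ℝ) ^ j)) * (V * ((L : ℝ) ^ j * (L : ℝ) ^ j)⁻¹) =
      25 / 2 * V := by field_simp; ring
  have e2 : (L : ℝ) ^ j * (5 / 2 * (17 * (L : ℝ) ^ j) * (V * ((L : ℝ) ^ j * (L : ℝ) ^ j)⁻¹)) =
      85 / 2 * V := by field_simp; ring
  rw [e1, e2]
  exact add_le_add le_rfl (mul_le_mul_of_nonneg_left (by linarith) hc₁.le)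

end RegulatorMoments

/-! ### Change of scale for test functions and fields -/

section FieldBounds

variable {L R : ℕ} [NeZero L]

lemma latticeDeriv_add {A E : Type*} [Ring A] [AddCommGroup E] (l : List (Fin 4))
    (f g : A × A → E) (x : A × A) :
    latticeDeriv l (fun y => f y + g y) x = latticeDeriv l f x + latticeDeriv l g x := by
  induction l generalizing x with
  | nil => rfl
  | cons μ l ih => simp only [latticeDeriv, ih]; abel

lemma latticeDeriv_add_const {A E : Type*} [Ring A] [AddCommGroup E] {l : List (Fin 4)}
    (hl : l ≠ []) (f : A × A → E) (a : E) (x : A × A) :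
    latticeDeriv l (fun y => f y + a) x = latticeDeriv l f x := by
  have : ∀ (l : List (Fin 4)) (μ : Fin 4) (x : A × A),
      latticeDeriv (μ :: l) (fun _ => a) x = 0 := by
    intro l
    induction l with
    | nil => intro μ x; simp [latticeDeriv]
    | cons ν l ih =>
      intro μ x
      change latticeDeriv (ν :: l) (fun _ => a) _ - latticeDeriv (ν :: l) (fun _ => a) x = 0
      rw [ih, ih, sub_zero]
  obtain ⟨μ, l, rfl⟩ := List.exists_cons_of_ne_nil hl
  rw [latticeDeriv_add, this, add_zero]

lemma latticeDeriv_sub_const {A E : Type*} [Ring A] [AddCommGroup E] {l : List (Fin 4)}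
    (hl : l ≠ []) (f : A × A → E) (a : E) (x : A × A) :
    latticeDeriv l (fun y => f y - a) x = latticeDeriv l f x := by
  simpa only [sub_eq_add_neg] using latticeDeriv_add_const hl f (-a) x

lemma latticeDeriv_mul (t : ℝ) {A : Type*} [Ring A] (l : List (Fin 4)) (f : A × A → ℝ) (x : A × A) :
    latticeDeriv l (fun y => t * f y) x = t * latticeDeriv l f x :=
  congrFun (latticeDeriv_smul t l f) x

/-- The differences of a function with small derivatives are small in the norm on scale `j`. -/
lemma IsSmall.c2Norm_sub_le (hL : Odd L) (hLR : 3 ≤ L ^ R) {j : ℕ} (hj : j ≤ R)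
    {X : Finset (Site L R)} (hX : IsSmall j X) {x₀ : Site L R} (hx₀ : x₀ ∈ X) {E : Type*}
    [NormedAddCommGroup E] {f : Site L R → E} {m : ℝ} (hm : 0 ≤ m)
    (h1 : ∀ x ∈ smallNbhd j X, ∀ μ, (L : ℝ) ^ j * ‖latticeDeriv [μ] f x‖ ≤ m)
    (h2 : ∀ x ∈ smallNbhd j X, ∀ μ : Fin 2 → Fin 4,
      (L : ℝ) ^ (2 * j) * ‖latticeDeriv (List.ofFn μ) f x‖ ≤ 48 * m) :
    (c2Norm j (smallNbhd j X) (fun x => f x - f x₀) : ℝ) ≤ 48 * m := by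
  have hL0 : (0 : ℝ) < L := by exact_mod_cast NeZero.pos L
  refine c2Norm_le (by positivity) fun n hn x hx μ => ?_
  interval_cases n
  · have := hX.norm_sub_le hL hLR hj (g := f) (m := m / L ^ j) (fun y hy ν => by
      rw [le_div_iff₀' (by positivity)]
      exact h1 y hy ν) hx hx₀
    simp only [zero_mul, pow_zero, one_mul, List.ofFn_zero, latticeDeriv]
    refine this.trans (le_of_eq ?_)
    field_simp
  · rw [latticeDeriv_sub_const (by simp)]
    have := h1 x hx (μ 0)
    simp only [one_mul, List.ofFn_succ, List.ofFn_zero]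
    linarith
  · rw [latticeDeriv_sub_const (by simp)]
    exact h2 x hx μ

/-- Measured on scale j instead of j + 1, every derivative gains L⁻¹; only the function itself gains
nothing, and subtracting its value at `x₀` reduces it to its gradient. -/
lemma IsSmall.c2Norm_sub_le_of_c2Norm_succ (hL : Odd L) (hLR : 3 ≤ L ^ R) {j : ℕ} (hj : j ≤ R)
    {X : Finset (Site L R)} (hX : IsSmall j X) {x₀ : Site L R} (hx₀ : x₀ ∈ X)
    {f : Site L R → ℂ} (hf : c2Norm (j + 1) (smallNbhd j X) f ≤ 1) :
    ‖f x₀‖ ≤ 1 ∧ (c2Norm j (smallNbhd j X) (fun x => f x - f x₀) : ℝ) ≤ 48 * (L : ℝ)⁻¹ := by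
  have hL0 : (0 : ℝ) < L := by exact_mod_cast NeZero.pos L
  have hL1 : (1 : ℝ) ≤ L := by exact_mod_cast NeZero.pos L
  have hf' : (c2Norm (j + 1) (smallNbhd j X) f : ℝ) ≤ 1 := by exact_mod_cast hf
  constructor
  · have := le_c2Norm (j := j + 1) (n := 0) (by norm_num) f
      (hX.1.1.subset_smallNbhd hL hj hx₀) (fun i => i.elim0)
    simp only [zero_mul, pow_zero, one_mul, List.ofFn_zero, latticeDeriv] at this
    exact this.trans hf'
  · refine hX.c2Norm_sub_le hL hLR hj hx₀ (by positivity) (fun x hx μ => ?_) fun x hx μ => ?_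
    · have := (le_c2Norm (j := j + 1) (n := 1) (by norm_num) f hx (fun _ => μ)).trans hf'
      simp only [one_mul, List.ofFn_succ, List.ofFn_zero] at this
      rw [← one_div, le_div_iff₀ hL0]
      refine (le_of_eq ?_).trans this
      ring
    · have := (le_c2Norm (j := j + 1) (n := 2) (by norm_num) f hx μ).trans hf'
      rw [← div_eq_mul_inv, le_div_iff₀ hL0]
      have h0 := norm_nonneg (latticeDeriv (List.ofFn μ) f x)
      calc (L : ℝ) ^ (2 * j) * ‖latticeDeriv (List.ofFn μ) f x‖ * L
          ≤ (L : ℝ) ^ (2 * j) * ‖latticeDeriv (List.ofFn μ) f x‖ * L * L :=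
            le_mul_of_one_le_right (by positivity) hL1
        _ = (L : ℝ) ^ (2 * (j + 1)) * ‖latticeDeriv (List.ofFn μ) f x‖ := by ring
        _ ≤ 48 := this.trans (by norm_num)

lemma gradSup_add_le (j n : ℕ) (Y : Finset (Site L R)) (φ ψ : Site L R → ℝ) :
    (gradSup j n Y (fun x => φ x + ψ x) : ℝ) ≤ gradSup j n Y φ + gradSup j n Y ψ := by
  refine gradSup_le (by positivity) fun x hx μ => ?_
  rw [latticeDeriv_add]
  calc _ ≤ (L : ℝ) ^ (n * j) * (‖latticeDeriv (List.ofFn μ) φ x‖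
        + ‖latticeDeriv (List.ofFn μ) ψ x‖) := by gcongr; exact norm_add_le _ _
    _ ≤ _ := by
      rw [mul_add]
      exact add_le_add (le_gradSup φ hx μ) (le_gradSup ψ hx μ)

lemma gradSup_mul_le (t : ℝ) (ht : |t| ≤ 1) (j n : ℕ) (Y : Finset (Site L R))
    (φ : Site L R → ℝ) : (gradSup j n Y (fun x => t * φ x) : ℝ) ≤ gradSup j n Y φ := by
  refine gradSup_le (by positivity) fun x hx μ => le_trans ?_ (le_gradSup φ hx μ)
  rw [latticeDeriv_mul, norm_mul, Real.norm_eq_abs t]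
  gcongr
  exact mul_le_of_le_one_left (norm_nonneg _) ht

lemma gradSqSum_add_le (Y : Finset (Site L R)) (φ ψ : Site L R → ℝ) :
    gradSqSum Y (fun x => φ x + ψ x) ≤ 2 * gradSqSum Y φ + 2 * gradSqSum Y ψ := by
  simp only [gradSqSum, Finset.mul_sum, ← Finset.sum_add_distrib, latticeDeriv_add, sq_abs]
  refine Finset.sum_le_sum fun x _ => Finset.sum_le_sum fun μ _ => ?_
  nlinarith [sq_nonneg (latticeDeriv [μ] φ x - latticeDeriv [μ] ψ x)]

lemma gradSqSum_mul_le (t : ℝ) (ht : |t| ≤ 1) (Y : Finset (Site L R)) (φ : Site L R → ℝ) :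
    gradSqSum Y (fun x => t * φ x) ≤ gradSqSum Y φ := by
  unfold gradSqSum
  refine Finset.sum_le_sum fun x _ => mul_le_mul_of_nonneg_left
    (Finset.sum_le_sum fun μ _ => pow_le_pow_left₀ (abs_nonneg _) ?_ 2) (by norm_num)
  rw [latticeDeriv_mul, abs_mul]
  exact mul_le_of_le_one_left (abs_nonneg _) ht

lemma gradSup_add_const {j n : ℕ} (hn : n ≠ 0) (Y : Finset (Site L R)) (φ : Site L R → ℝ) (a : ℝ) :
    gradSup j n Y (fun x => φ x + a) = gradSup j n Y φ := by
  unfold gradSup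
  congr 1; ext μ : 1; congr 1; ext x : 1
  rw [latticeDeriv_add_const]
  intro h
  exact hn (by simpa using h)

lemma regSum_add_const (c₁ c₃ : ℝ) (j : ℕ) (φ : Site L R → ℝ) (a : ℝ) (X : Finset (Site L R)) :
    regSum c₁ c₃ j (fun x => φ x + a) X = regSum c₁ c₃ j φ X := by
  have h1 : ∀ Y : Finset (Site L R), gradSqSum Y (fun x => φ x + a) = gradSqSum Y φ := by
    intro Y
    unfold gradSqSum
    refine Finset.sum_congr rfl fun x _ => ?_
    congr 1
    exact Finset.sum_congr rfl fun μ _ => by rw [latticeDeriv_add_const (by simp)]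
  simp only [regSum, h1, gradSup_add_const (two_ne_zero)]

/-- The exponent is a quadratic expression, so (a + b)² ≤ 2a² + 2b² separates the background field
from the fluctuation. -/
lemma regSum_add_le {c₁ c₃ : ℝ} (h₁ : 0 ≤ c₁) (h₃ : 0 ≤ c₃) (j : ℕ) (φ ψ : Site L R → ℝ)
    (X : Finset (Site L R)) : regSum c₁ c₃ j (fun x => φ x + ψ x) X ≤
      2 * regSum c₁ c₃ j φ X + 2 * regSum c₁ c₃ j ψ X := by
  have a1 := mul_le_mul_of_nonneg_left (gradSqSum_add_le X φ ψ) h₁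
  have a2 := mul_le_mul_of_nonneg_left (mul_le_mul_of_nonneg_left
    (gradSqSum_add_le (boundary X) φ ψ) (by positivity : (0 : ℝ) ≤ (L : ℝ) ^ j)) h₃
  have a3 : ∑ B ∈ blocksOf j X, (gradSup j 2 (smallNbhd j B) (fun x => φ x + ψ x) : ℝ) ^ 2 ≤
      2 * ∑ B ∈ blocksOf j X, (gradSup j 2 (smallNbhd j B) φ : ℝ) ^ 2 +
      2 * ∑ B ∈ blocksOf j X, (gradSup j 2 (smallNbhd j B) ψ : ℝ) ^ 2 := by
    rw [Finset.mul_sum, Finset.mul_sum, ← Finset.sum_add_distrib]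
    refine Finset.sum_le_sum fun B _ => ?_
    have h := gradSup_add_le j 2 (smallNbhd j B) φ ψ
    have h' := pow_le_pow_left₀ (NNReal.coe_nonneg _) h 2
    nlinarith [sq_nonneg ((gradSup j 2 (smallNbhd j B) φ : ℝ) - gradSup j 2 (smallNbhd j B) ψ)]
  have a3' := mul_le_mul_of_nonneg_left a3 h₁
  unfold regSum
  linarith

lemma regSum_mul_le {c₁ c₃ : ℝ} (h₁ : 0 ≤ c₁) (h₃ : 0 ≤ c₃) (t : ℝ) (ht : |t| ≤ 1) (j : ℕ)
    (φ : Site L R → ℝ) (X : Finset (Site L R)) :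
    regSum c₁ c₃ j (fun x => t * φ x) X ≤ regSum c₁ c₃ j φ X := by
  have := gradSup_mul_le (L := L) (R := R) t ht
  have := gradSqSum_mul_le (L := L) (R := R) t ht
  unfold regSum
  gcongr <;> apply_assumption

/-- The size of the field on scale `j + 1` around a small polymer `X` on scale `j`. -/
lemma IsSmall.exists_fieldSize (hL : Odd L) (hL48 : 48 ≤ L) {j : ℕ} (hj : j < R)
    {X : Finset (Site L R)} (hX : IsSmall j X) {c₁ c₃ : ℝ} (h₁ : 0 ≤ c₁) (h₃ : 0 ≤ c₃)
    (φ : Site L R → ℝ) : ∃ N : ℝ, 0 ≤ N ∧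
      c₁ * N ^ 2 ≤ regSum c₁ c₃ (j + 1) φ (reblock (j + 1) X) ∧
      (∀ x ∈ smallNbhd j X, ∀ μ, (L : ℝ) ^ (j + 1) * ‖latticeDeriv [μ] φ x‖ ≤ 9 * N) ∧
      ∀ x ∈ smallNbhd j X, ∀ μ : Fin 2 → Fin 4,
        (L : ℝ) ^ (2 * (j + 1)) * ‖latticeDeriv (List.ofFn μ) φ x‖ ≤ N := by
  obtain ⟨x₀, hx₀⟩ := hX.1.2.1
  obtain ⟨c, hc, hD, hD1, hD2⟩ := hX.exists_reblock hL hL48 hj hx₀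
  have hkR : j + 1 ≤ R := hj
  obtain ⟨k, hk⟩ : ∃ k, k = j + 1 := ⟨_, rfl⟩
  obtain ⟨D, hDdef⟩ : ∃ D, D = block k c := ⟨_, rfl⟩
  rw [← hk] at hD hD1 hD2 hc hkR ⊢
  rw [← hDdef] at hD hD1
  obtain ⟨S, hS⟩ : ∃ S : ℝ, S = NNReal.toReal (gradSup k 2 (smallNbhd k D) φ) := ⟨_, rfl⟩
  have hS0 : 0 ≤ S := hS ▸ NNReal.coe_nonneg _
  have hG0 := gradSqSum_nonneg D φ
  have hL0 : (0 : ℝ) < L := by exact_mod_cast NeZero.pos L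
  -- The regulator contains the gradient only in L², and the second derivatives in supremum norm. On
  -- the block `D` of `x₀` this suffices: the gradient differs from its values on `D` by at most
  -- 6S/a, and averaging over the a² sites of `D` gives 4‖∇φ‖² + 72S² ≤ 81N².
  set N := Real.sqrt (gradSqSum D φ + S ^ 2) with hN
  have hN2 : N ^ 2 = gradSqSum D φ + S ^ 2 := Real.sq_sqrt (by positivity)
  have hSN : S ≤ N := Real.le_sqrt_of_sq_le (by linarith)
  refine ⟨N, Real.sqrt_nonneg _, ?_, fun x hx μ => ?_, fun x hx μ => ?_⟩
  · rw [hN2, mul_add, regSum]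
    have a1 : gradSqSum D φ ≤ gradSqSum (reblock k X) φ :=
      Finset.sum_le_sum_of_subset_of_nonneg (mem_blocksOf.1 hD).2 fun _ _ _ => by positivity
    have a2 : S ^ 2 ≤ ∑ B ∈ blocksOf k (reblock k X), (gradSup k 2 (smallNbhd k B) φ : ℝ) ^ 2 := by
      rw [hS]
      exact Finset.single_le_sum (f := fun B => (gradSup k 2 (smallNbhd k B) φ : ℝ) ^ 2)
        (fun _ _ => sq_nonneg _) hD
    have a3 := gradSqSum_nonneg (boundary (reblock k X)) φ
    have a4 : 0 ≤ c₃ * (L ^ k * gradSqSum (boundary (reblock k X)) φ) := by positivity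
    have a5 := mul_le_mul_of_nonneg_left a1 h₁
    have a6 := mul_le_mul_of_nonneg_left a2 h₁
    linarith
  · set g : Site L R → ℝ := latticeDeriv [μ] φ with hg
    set a : ℝ := (L : ℝ) ^ k with ha
    have ha0 : 0 < a := by positivity
    have hstep : ∀ y, 2 * siteAbs (y - c) + 1 ≤ 3 * L ^ k → ∀ ν,
        ‖g (y + unitVec (ZMod (L ^ R)) ν) - g y‖ ≤ S * (a ^ 2)⁻¹ := by
      intro y hy ν
      have := le_gradSup (j := k) φ (hD1 y hy) ![ν, μ]
      rw [← hS] at this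
      rw [← div_eq_mul_inv, le_div_iff₀' (by positivity), ha, ← pow_mul, mul_comm k]
      rw [show List.ofFn ![ν, μ] = [ν, μ] by simp [List.ofFn_succ]] at this
      exact this
    have hvar : ∀ y ∈ D, ‖g x - g y‖ ≤ 6 * S * a⁻¹ := by
      intro y hy
      rw [hDdef, mem_block_odd hL] at hy
      have hx' := hD2 x hx
      have := norm_sub_le_of_step (c := c) (ρ := (3 * L ^ k - 1) / 2)
        (fun z hz ν => hstep z (by omega) ν) (x := x) (y := y) (by omega) (by omega)
      refine this.trans ?_
      have h : 4 * ((3 * L ^ k - 1) / 2) ≤ 6 * L ^ k := by omega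
      have h' : 4 * (((3 * L ^ k - 1) / 2 : ℕ) : ℝ) ≤ 6 * a := by rw [ha]; exact_mod_cast h
      refine (mul_le_mul_of_nonneg_right h' (by positivity)).trans (le_of_eq ?_)
      field_simp
    have hsq : ∀ y ∈ D, g x ^ 2 ≤ 2 * g y ^ 2 + 72 * S ^ 2 * (a ^ 2)⁻¹ := by
      intro y hy
      have h1 := hvar y hy
      have h2 : (g x - g y) ^ 2 ≤ (6 * S * a⁻¹) ^ 2 :=
        sq_le_sq.2 (by rw [← Real.norm_eq_abs]; exact h1.trans (le_abs_self _))
      have h3 : (6 * S * a⁻¹) ^ 2 = 36 * S ^ 2 * (a ^ 2)⁻¹ := by rw [mul_pow, mul_pow, inv_pow]; ring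
      nlinarith [sq_nonneg (g y - (g x - g y))]
    have hsum : (D.card : ℝ) * g x ^ 2 ≤ 4 * gradSqSum D φ + D.card * (72 * S ^ 2 * (a ^ 2)⁻¹) := by
      have := Finset.sum_le_sum hsq
      rw [Finset.sum_const, nsmul_eq_mul, Finset.sum_add_distrib, Finset.sum_const,
        nsmul_eq_mul] at this
      refine this.trans (add_le_add ?_ le_rfl)
      rw [gradSqSum, Finset.mul_sum]
      refine Finset.sum_le_sum fun y _ => ?_
      have := Finset.single_le_sum (f := fun ν => |latticeDeriv [ν] φ y| ^ 2)
        (fun _ _ => by positivity) (Finset.mem_univ μ)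
      simp only [sq_abs] at this ⊢
      rw [hg]
      linarith
    have hcard : (D.card : ℝ) = a ^ 2 := by
      have : D.card = L ^ (2 * k) := by
        rw [hDdef]
        exact le_antisymm (card_block_le hL k c) (le_card_block hL hkR c)
      rw [this, ha, ← pow_mul, mul_comm 2]
      push_cast
      rfl
    rw [hcard] at hsum
    have h81 : (a * ‖g x‖) ^ 2 ≤ (9 * N) ^ 2 := by
      rw [mul_pow, Real.norm_eq_abs, sq_abs, mul_pow, hN2]
      have : a ^ 2 * (72 * S ^ 2 * (a ^ 2)⁻¹) = 72 * S ^ 2 := by field_simp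
      rw [this] at hsum
      nlinarith [sq_nonneg S]
    exact le_of_sq_le_sq h81 (by positivity)
  · exact (le_gradSup φ (hD1 x (hD2 x hx)) μ).trans (hS ▸ hSN)

/-- The regulator on scale `j` of a field on scale `j + 1`. -/
lemma IsSmall.regSum_le (hL : Odd L) {j : ℕ} (hj : j ≤ R)
    {X : Finset (Site L R)} (hX : IsSmall j X) {c₁ c₃ : ℝ} (h₁ : 0 ≤ c₁) (h₃ : 0 ≤ c₃)
    {φ : Site L R → ℝ} {N : ℝ} (hN : 0 ≤ N)
    (hd1 : ∀ x ∈ smallNbhd j X, ∀ μ, (L : ℝ) ^ (j + 1) * ‖latticeDeriv [μ] φ x‖ ≤ 9 * N)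
    (hd2 : ∀ x ∈ smallNbhd j X, ∀ μ : Fin 2 → Fin 4,
        (L : ℝ) ^ (2 * (j + 1)) * ‖latticeDeriv (List.ofFn μ) φ x‖ ≤ N) :
    regSum c₁ c₃ j φ X ≤ (652 * c₁ + 2592 * c₃) * (N ^ 2 * ((L : ℝ) ^ 2)⁻¹) := by
  have hL0 : (0 : ℝ) < L := by exact_mod_cast NeZero.pos L
  have hL1 : (1 : ℝ) ≤ L := by exact_mod_cast NeZero.pos L
  have hXs := hX.1.1.subset_smallNbhd hL hj
  -- Four directions with weight 1/2 and 9² = 81 give 162; the volume bounds 4L^{2j} and 16L^j turn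
  -- it into 648 and 2592, and the four blocks of the second-derivative term raise 648 to 652. The
  -- overall factor L⁻² is the gain from the change of scale.
  have hgrad : ∀ Y ⊆ X, ∀ w : ℝ, (Y.card : ℝ) ≤ w →
      gradSqSum Y φ ≤ w * (162 * (N ^ 2 * ((L : ℝ) ^ (2 * (j + 1)))⁻¹)) := by
    intro Y hY w hw
    have : ∀ x ∈ Y, (1 / 2) * ∑ μ : Fin 4, |latticeDeriv [μ] φ x| ^ 2 ≤
        162 * (N ^ 2 * ((L : ℝ) ^ (2 * (j + 1)))⁻¹) := by
      intro x hx
      have hμ : ∀ μ, |latticeDeriv [μ] φ x| ^ 2 ≤ 81 * (N ^ 2 * ((L : ℝ) ^ (2 * (j + 1)))⁻¹) := by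
        intro μ
        have h := hd1 x (hXs (hY hx)) μ
        rw [Real.norm_eq_abs] at h
        have h' := pow_le_pow_left₀ (by positivity) h 2
        rw [mul_pow, ← pow_mul, mul_comm (j + 1), mul_pow] at h'
        rw [← div_eq_mul_inv, ← mul_div_assoc, le_div_iff₀' (by positivity)]
        linarith
      calc (1 / 2) * ∑ μ : Fin 4, |latticeDeriv [μ] φ x| ^ 2
          ≤ (1 / 2) * ∑ μ : Fin 4, 81 * (N ^ 2 * ((L : ℝ) ^ (2 * (j + 1)))⁻¹) := by
            gcongr with μ _
            exact hμ μ
        _ = _ := by simp; ring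
    calc gradSqSum Y φ ≤ ∑ x ∈ Y, 162 * (N ^ 2 * ((L : ℝ) ^ (2 * (j + 1)))⁻¹) :=
          Finset.sum_le_sum this
      _ ≤ _ := by
          rw [Finset.sum_const, nsmul_eq_mul]
          gcongr
  have b1 := hgrad X subset_rfl (4 * (L : ℝ) ^ (2 * j)) (by exact_mod_cast hX.card_le hL)
  have b2 := hgrad (boundary X) (Finset.filter_subset _ _) (16 * (L : ℝ) ^ j)
    (by exact_mod_cast hX.card_boundary_le hL)
  have b3 : ∑ B ∈ blocksOf j X, (gradSup j 2 (smallNbhd j B) φ : ℝ) ^ 2 ≤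
      4 * (N ^ 2 * ((L : ℝ) ^ 2)⁻¹) := by
    have hB : ∀ B ∈ blocksOf j X, (gradSup j 2 (smallNbhd j B) φ : ℝ) ^ 2 ≤
        N ^ 2 * ((L : ℝ) ^ 2)⁻¹ := by
      intro B hB
      have : (gradSup j 2 (smallNbhd j B) φ : ℝ) ≤ N * (L : ℝ)⁻¹ := by
        refine gradSup_le (by positivity) fun x hx μ => ?_
        have h := hd2 x (smallNbhd_mono (mem_blocksOf.1 hB).2 hx) μ
        rw [← div_eq_mul_inv, le_div_iff₀' hL0]
        refine le_trans ?_ h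
        rw [← mul_assoc, ← pow_succ']
        refine mul_le_mul_of_nonneg_right (pow_le_pow_right₀ hL1 (by omega)) (norm_nonneg _)
      have := pow_le_pow_left₀ (NNReal.coe_nonneg _) this 2
      rwa [mul_pow, inv_pow] at this
    calc _ ≤ ∑ B ∈ blocksOf j X, N ^ 2 * ((L : ℝ) ^ 2)⁻¹ := Finset.sum_le_sum hB
      _ ≤ _ := by
        rw [Finset.sum_const, nsmul_eq_mul]
        gcongr
        exact_mod_cast hX.2
  have e1 : 4 * (L : ℝ) ^ (2 * j) * (162 * (N ^ 2 * ((L : ℝ) ^ (2 * (j + 1)))⁻¹)) =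
      648 * (N ^ 2 * ((L : ℝ) ^ 2)⁻¹) := by
    rw [mul_add 2 j 1, pow_add]
    field_simp
    ring
  have e2 : (L : ℝ) ^ j * (16 * (L : ℝ) ^ j * (162 * (N ^ 2 * ((L : ℝ) ^ (2 * (j + 1)))⁻¹))) =
      2592 * (N ^ 2 * ((L : ℝ) ^ 2)⁻¹) := by
    rw [mul_add 2 j 1, pow_add, two_mul j, pow_add]
    field_simp
    ring
  rw [e1] at b1
  have b2' := (mul_le_mul_of_nonneg_left b2 (by positivity : (0 : ℝ) ≤ (L : ℝ) ^ j)).trans_eq e2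
  have d1 := mul_le_mul_of_nonneg_left b1 h₁
  have d2 := mul_le_mul_of_nonneg_left b2' h₃
  have d3 := mul_le_mul_of_nonneg_left b3 h₁
  unfold regSum
  linarith

end FieldBounds

/-! ### The regulator under Gaussian shifts -/

section RegulatorShift
open MeasureTheory ProbabilityTheory

lemma exists_le_of_continuous {ι : Type*} [Fintype ι] {g : (ι → ℝ) → ℝ} (hg : Continuous g)
    (φ : ι → ℝ) : ∃ C, ∀ ψ ∈ Metric.ball φ 1, g ψ ≤ C := by
  obtain ⟨C, hC⟩ := (isCompact_closedBall φ (1 : ℝ)).bddAbove_image hg.continuousOn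
  exact ⟨C, fun ψ hψ => hC ⟨ψ, Metric.ball_subset_closedBall hψ, rfl⟩⟩

/-- Bound the product by the sum of the squares, and e^{2a|s|} by e^{2as} + e^{-2as}, which has a
finite Gaussian integral. -/
lemma hasExpMoments_of_integrable_sq {ι : Type*} [Fintype ι] [DecidableEq ι]
    {S : Matrix ι ι ℝ} (hS : S.PosSemidef) (y : ι) {W : EuclideanSpace ℝ ι → ℝ}
    (hW : Measurable W) (hW0 : ∀ ζ, 0 ≤ W ζ)
    (hW2 : Integrable (fun ζ => W ζ ^ 2) (multivariateGaussian 0 S)) : HasExpMoments S y W := by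
  intro a
  have hmp := measurePreserving_eval_multivariateGaussian (μ := 0) hS (i := y)
  have hexp : ∀ b : ℝ, Integrable (fun ζ : EuclideanSpace ℝ ι => Real.exp (b * ζ y))
      (multivariateGaussian 0 S) := fun b =>
    hmp.integrable_comp_of_integrable (g := fun s => Real.exp (b * s))
      (integrable_exp_mul_gaussianReal b)
  have hdom := ((hexp (2 * a)).add (hexp (-(2 * a)))).add hW2
  have hm : Measurable fun ζ : EuclideanSpace ℝ ι => ζ y := by fun_prop
  refine hdom.mono' (by fun_prop) (Filter.Eventually.of_forall fun ζ => ?_)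
  have h1 : Real.exp (a * |ζ y|) ^ 2 ≤ Real.exp (2 * a * ζ y) + Real.exp (-(2 * a) * ζ y) := by
    rw [← Real.exp_nat_mul]
    rcases abs_cases (ζ y) with h | h <;> rw [h.1] <;> push_cast
    · rw [← mul_assoc]; linarith [Real.exp_pos (-(2 * a) * ζ y)]
    · rw [show 2 * (a * -ζ y) = -(2 * a) * ζ y by ring]
      linarith [Real.exp_pos (2 * a * ζ y)]
  rw [Real.norm_of_nonneg (by have := hW0 ζ; positivity)]
  simp only [Pi.add_apply]
  nlinarith [sq_nonneg (Real.exp (a * |ζ y|) - W ζ), sq_nonneg (Real.exp (a * |ζ y|)),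
    sq_nonneg (W ζ)]

variable {L R : ℕ} [NeZero L]

/-- The action of the fluctuation field on functions dominated by the regulator. -/
lemma isShiftBound_regulator {S : Matrix (Site L R) (Site L R) ℝ} (hS : S.PosSemidef)
    {c₁ c₃ κ V : ℝ} (h₁ : 0 ≤ c₁) (h₃ : 0 ≤ c₃) (hκ : 0 ≤ κ) {j : ℕ} {X : Finset (Site L R)}
    (hQ : ExpQuad (multivariateGaussian 0 S) (fun ζ => regSum c₁ c₃ j (fun y => ζ y) X) V)
    (hκV : 16 * (κ * V) ≤ 1) :
    IsShiftBound (multivariateGaussian 0 S) (fun _ => 1) (fun ζ x => ζ x)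
      (fun φ => regulator c₁ c₃ κ j φ X) (fun φ => Real.exp (2 * κ * regSum c₁ c₃ j φ X))
      (fun ζ => Real.exp (2 * κ * regSum c₁ c₃ j (fun y => ζ y) X)) ∧
    (∀ y, HasExpMoments S y fun ζ => Real.exp (2 * κ * regSum c₁ c₃ j (fun y => ζ y) X)) ∧
    ∫ ζ : EuclideanSpace ℝ (Site L R), Real.exp (2 * κ * regSum c₁ c₃ j (fun y => ζ y) X)
      ∂(multivariateGaussian 0 S) ≤ 2 := by
  have hκV0 : 0 ≤ κ * V := mul_nonneg hκ hQ.pos.le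
  -- The rate 2κ is that of the weight; the rate 4κ of its square, needed for the tilted
  -- expectations, accounts for the constant 16.
  obtain ⟨i1, i2⟩ := hQ.bound (2 * κ) (by positivity) (by linarith)
  obtain ⟨i3, -⟩ := hQ.bound (4 * κ) (by positivity) (by linarith)
  have hm := hQ.measurable
  refine ⟨⟨aestronglyMeasurable_const, by simp, by fun_prop, i1, fun _ => (Real.exp_pos _).le,
    fun φ ζ => ?_, exists_le_of_continuous ?_⟩, fun y => ?_, i2⟩
  · rw [regulator_eq, ← Real.exp_add]
    refine Real.exp_le_exp.2 ?_
    have := mul_le_mul_of_nonneg_left (regSum_add_le h₁ h₃ j φ (fun y => ζ y) X) hκ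
    linarith
  · have := continuous_regSum (L := L) (R := R) c₁ c₃ j X
    fun_prop
  · refine hasExpMoments_of_integrable_sq hS y (by fun_prop) (fun _ => (Real.exp_pos _).le) ?_
    refine i3.congr (Filter.Eventually.of_forall fun ζ => ?_)
    simp only
    rw [← Real.exp_nat_mul]
    congr 1
    push_cast
    ring

end RegulatorShift

/-! ### Charge components -/

section Charge
open MeasureTheory

variable {L R : ℕ} [NeZero L] {α : ℝ} {q : ℤ} {F : (Site L R → ℝ) → ℂ}

/-- The normalized Lebesgue measure on a period. -/
noncomputable def periodMeasure (α : ℝ) : Measure ℝ :=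
  ENNReal.ofReal (α / (2 * Real.pi)) • volume.restrict (Set.Ioc 0 (2 * Real.pi / α))

lemma isProbabilityMeasure_periodMeasure (hα : 0 < α) :
    IsProbabilityMeasure (periodMeasure α) := by
  constructor
  rw [periodMeasure, Measure.smul_apply, Measure.restrict_apply_univ, Real.volume_Ioc, sub_zero,
    smul_eq_mul, ← ENNReal.ofReal_mul (by positivity)]
  rw [show α / (2 * Real.pi) * (2 * Real.pi / α) = 1 by field_simp]
  exact ENNReal.ofReal_one

/-- A charge component is an average over constant shifts with unimodular coefficients, so the
estimates for averages apply to it. -/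
lemma chargeComponent_eq_shiftAvg (hα : 0 < α) (q : ℤ) (F : (Site L R → ℝ) → ℂ) :
    chargeComponent α q F = shiftAvg (periodMeasure α)
      (fun s => Complex.exp (-(Complex.I * q * α * s))) (fun s _ => s) F := by
  ext φ
  rw [chargeComponent, shiftAvg, periodMeasure, integral_smul_measure,
    intervalIntegral.integral_of_le (by positivity), ENNReal.toReal_ofReal (by positivity),
    Complex.real_smul]
  simp only [mul_comm]

lemma norm_exp_neg_I_mul (q : ℤ) (α s : ℝ) :
    ‖Complex.exp (-(Complex.I * q * α * s))‖ = 1 := by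
  rw [show -(Complex.I * q * α * s) = ((-(q * α * s) : ℝ) : ℂ) * Complex.I by push_cast; ring,
    Complex.norm_exp_ofReal_mul_I]

/-- Change variables by s; the integrand has period 2π/α because q is an integer, so moving the
interval of integration changes nothing. -/
lemma hasCharge_chargeComponent (hα : 0 < α)
    (hF : ∀ (φ : Site L R → ℝ) (m : ℤ), F (fun x => φ x + 2 * m * Real.pi / α) = F φ) :
    HasCharge (q * α) (chargeComponent α q F) := by
  intro φ s
  simp only [chargeComponent]
  set p : ℝ → ℂ := fun t => F (fun x => φ x + t) * Complex.exp (-(Complex.I * q * α * t)) with hp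
  have hper : Function.Periodic p (2 * Real.pi / α) := by
    intro t
    simp only [hp]
    congr 1
    · have := hF (fun x => φ x + t) 1
      rw [← this]
      congr 1; ext x; push_cast; ring
    · rw [show -(Complex.I * q * α * ((t + 2 * Real.pi / α : ℝ) : ℂ)) =
        -(Complex.I * q * α * t) + ((-q : ℤ) : ℂ) * (2 * Real.pi * Complex.I) by
          have : (α : ℂ) ≠ 0 := by exact_mod_cast hα.ne'
          push_cast
          field_simp
          ring, Complex.exp_add, Complex.exp_int_mul_two_pi_mul_I, mul_one]
  have h1 : ∀ t : ℝ, F (fun x => φ x + s + t) * Complex.exp (-(Complex.I * q * α * t)) =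
      Complex.exp (Complex.I * (q * α : ℝ) * s) * p (t + s) := by
    intro t
    simp only [hp]
    rw [mul_left_comm, ← Complex.exp_add]
    congr 1
    · congr 1; ext x; ring
    · congr 1; push_cast; ring
  simp only [h1]
  rw [intervalIntegral.integral_const_mul, intervalIntegral.integral_comp_add_right, zero_add,
    add_comm (2 * Real.pi / α) s, hper.intervalIntegral_add_eq s 0, zero_add]
  ring

lemma isShiftBound_periodMeasure (hα : 0 < α) (q : ℤ) {g : (Site L R → ℝ) → ℝ}
    (hg : Continuous g) (hgs : ∀ φ s, g (fun x => φ x + s) = g φ) :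
    IsShiftBound (periodMeasure α) (fun s => Complex.exp (-(Complex.I * q * α * s)))
      (fun s (_ : Site L R) => s) g g (fun _ => 1) := by
  have := isProbabilityMeasure_periodMeasure hα
  refine ⟨Continuous.aestronglyMeasurable (by fun_prop), fun s => (norm_exp_neg_I_mul q α s).le,
    by fun_prop, integrable_const _, fun _ => zero_le_one, fun φ s => ?_,
    exists_le_of_continuous hg⟩
  rw [hgs, mul_one]

/-- The charge components of a function dominated by `g`. -/
lemma chargeComponent_bounds (hα : 0 < α) (q : ℤ) {g : (Site L R → ℝ) → ℝ}
    (hg : Continuous g) (hg0 : ∀ φ, 0 ≤ g φ) (hgs : ∀ φ s, g (fun x => φ x + s) = g φ)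
    {Y : Finset (Site L R)} (hF : ContDiff ℝ ∞ F) (hs : SupportedOn Y F) {h M : ℝ} (hh : 0 < h)
    (hM : 0 ≤ M) {k : ℕ} (hbd : ∀ φ, tNorm h k Y F φ ≤ ENNReal.ofReal (M * g φ)) :
    IsDominated Y g (chargeComponent α q F) ∧
    ∀ φ, tNorm h k Y (chargeComponent α q F) φ ≤ ENNReal.ofReal (M * g φ) := by
  have hprob := isProbabilityMeasure_periodMeasure hα
  have hT := isShiftBound_periodMeasure (L := L) (R := R) hα q hg hgs
  have hFd := isDominated_of_tNorm_le hF hs hh hM hg0 hbd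
  rw [chargeComponent_eq_shiftAvg hα]
  have hbd' : ∀ φ, tNorm h k Y (shiftAvg (periodMeasure α)
      (fun s => Complex.exp (-(Complex.I * q * α * s))) (fun s _ => s) F) φ ≤
      ENNReal.ofReal (M * g φ) := by
    intro φ
    refine (tNorm_shiftAvg_le hT hFd h k φ).trans ?_
    refine (lintegral_mono fun s => hbd _).trans ?_
    simp only [hgs, lintegral_const, measure_univ, mul_one, le_refl]
  exact ⟨isDominated_of_tNorm_le (hT.contDiff hFd) (IsShiftBound.supportedOn hs) hh hM hg0 hbd',
    hbd'⟩

end Charge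

/-! ### The zeroth-order Taylor remainder -/

section Remainder

variable {L R : ℕ} [NeZero L] {Y : Finset (Site L R)} {Φ : (Site L R → ℝ) → ℂ}

/-- The zeroth-order Taylor remainder of a function of charge `β`. -/
noncomputable def chargeRemainder (β : ℝ) (x₀ : Site L R) (Φ : (Site L R → ℝ) → ℂ)
    (φ : Site L R → ℝ) : ℂ :=
  Φ φ - Complex.exp (Complex.I * β * φ x₀) * Φ 0

lemma contDiff_exp_coord (β : ℝ) (x₀ : Site L R) (a : ℂ) :
    ContDiff ℝ ∞ fun φ : Site L R → ℝ => Complex.exp (Complex.I * β * φ x₀) * a := by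
  have h : ContDiff ℝ ∞ fun φ : Site L R → ℝ => ((φ x₀ : ℝ) : ℂ) :=
    Complex.ofRealCLM.contDiff.comp (contDiff_apply ℝ ℝ x₀)
  exact ((contDiff_const.mul h).cexp).mul contDiff_const

lemma cdir_exp_coord (β : ℝ) {x₀ : Site L R} (a : ℂ) {f : Site L R → ℂ} (hf : f x₀ = 0) :
    cdir Y f (fun φ : Site L R → ℝ => Complex.exp (Complex.I * β * φ x₀) * a) = 0 := by
  ext φ
  have hs : SupportedOn {x₀} (fun φ : Site L R → ℝ => Complex.exp (Complex.I * β * φ x₀) * a) :=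
    fun φ ψ h => by simp only [h x₀ (Finset.mem_singleton_self _)]
  refine Finset.sum_eq_zero fun x _ => ?_
  by_cases hx : x = x₀
  · rw [hx, hf, zero_mul]
  · rw [hs.fderiv_eq_zero ((contDiff_exp_coord β x₀ a).differentiable (by simp)) φ
      (by simpa using hx), mul_zero]

lemma contDiff_chargeRemainder (hΦ : ContDiff ℝ ∞ Φ) (β : ℝ) (x₀ : Site L R) :
    ContDiff ℝ ∞ (chargeRemainder β x₀ Φ) := hΦ.sub (contDiff_exp_coord β x₀ _)

lemma supportedOn_chargeRemainder (hs : SupportedOn Y Φ) (β : ℝ) {x₀ : Site L R} (hx₀ : x₀ ∈ Y) :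
    SupportedOn Y (chargeRemainder β x₀ Φ) := fun φ ψ h => by
  simp only [chargeRemainder, hs φ ψ h, h x₀ hx₀]

lemma hasCharge_chargeRemainder {β : ℝ} (hβ : HasCharge β Φ) (x₀ : Site L R) :
    HasCharge β (chargeRemainder β x₀ Φ) := fun φ s => by
  simp only [chargeRemainder]
  rw [hβ φ s, mul_sub, ← mul_assoc, ← Complex.exp_add]
  congr 4
  push_cast
  ring

/-- The subtracted term depends on the field at `x₀` only, so one direction that vanishes there
already kills it. -/
lemma cdirs_chargeRemainder (hΦ : ContDiff ℝ ∞ Φ) (β : ℝ) {x₀ : Site L R}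
    {l : List (Site L R → ℂ)} (hl : l ≠ []) (hf : ∀ f ∈ l, f x₀ = 0) :
    cdirs Y l (chargeRemainder β x₀ Φ) = cdirs Y l Φ := by
  obtain ⟨f, l, rfl⟩ := List.exists_cons_of_ne_nil hl
  set G : (Site L R → ℝ) → ℂ := fun φ => Complex.exp (Complex.I * β * φ x₀) * (-Φ 0) with hG
  have hGs : ContDiff ℝ ∞ G := contDiff_exp_coord β x₀ _
  have e : chargeRemainder β x₀ Φ = Φ + G := by
    ext φ; simp only [chargeRemainder, hG, Pi.add_apply]; ring
  have h0 : cdirs Y l (0 : (Site L R → ℝ) → ℂ) = 0 := by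
    have := cdirs_smul (Y := Y) hΦ 0 l
    simpa using this
  rw [e, cdirs_add hΦ hGs, cdirs_cons, cdirs_cons, ← cdirs_cdir hGs,
    cdir_exp_coord β _ (hf f (by simp)), h0, add_zero]

/-- The increment of a function along the segment from the origin. -/
lemma norm_sub_zero_le (hΦ : ContDiff ℝ ∞ Φ) (hs : SupportedOn Y Φ) {k : ℕ} {h d T : ℝ}
    (hh : 0 < h) (hd : 0 < d) (hT : 0 ≤ T) {ξ : Site L R → ℝ}
    (hξ : (c2Norm k Y (fun x => (ξ x : ℂ)) : ℝ) ≤ d)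
    (hB : ∀ t ∈ Set.Icc (0 : ℝ) 1, tNorm h k Y Φ (fun x => t * ξ x) ≤ ENNReal.ofReal T) :
    ‖Φ ξ - Φ 0‖ ≤ d / h * T := by
  have hdiff := hΦ.differentiable (by simp)
  have hder : ∀ t : ℝ, HasDerivAt (fun t : ℝ => Φ (t • ξ)) (fderiv ℝ Φ (t • ξ) ξ) t := by
    intro t
    have h1 : HasDerivAt (fun t : ℝ => t • ξ) ξ t := by
      simpa using (hasDerivAt_id t).smul_const ξ
    exact (hdiff (t • ξ)).hasFDerivAt.comp_hasDerivAt t h1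
  lift d to ℝ≥0 using hd.le
  have hd0 : d ≠ 0 := by
    rintro rfl; simp at hd
  have hbound : ∀ t ∈ Set.Icc (0 : ℝ) 1, ‖fderiv ℝ Φ (t • ξ) ξ‖ ≤ d / h * T := by
    intro t ht
    rw [hs.fderiv_apply hdiff]
    have h1 := tnNorm_cdir_le (Y := Y) (n := 0) (φ := t • ξ) hΦ hd0 (by exact_mod_cast hξ)
    rw [tnNorm_zero _ _ (contDiff_cdir hΦ _)] at h1
    have h2 : ENNReal.ofReal h * tnNorm k Y 1 Φ (t • ξ) ≤ ENNReal.ofReal T := by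
      refine le_trans ?_ (hB t ht)
      refine le_trans (le_of_eq ?_) (ENNReal.le_tsum 1)
      simp only [pow_one, Nat.factorial_one, Nat.cast_one, div_one]
      rfl
    have h3 : ENNReal.ofReal h * ‖cdir Y (fun x => (ξ x : ℂ)) Φ (t • ξ)‖ₑ ≤
        ENNReal.ofReal (d * T) := by
      calc _ ≤ ENNReal.ofReal h * (d * tnNorm k Y 1 Φ (t • ξ)) := by gcongr
        _ = d * (ENNReal.ofReal h * tnNorm k Y 1 Φ (t • ξ)) := by ring
        _ ≤ d * ENNReal.ofReal T := by gcongr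
        _ = ENNReal.ofReal (d * T) := by
          rw [ENNReal.ofReal_mul (NNReal.coe_nonneg _), ENNReal.ofReal_coe_nnreal]
    rw [← ofReal_norm, ← ENNReal.ofReal_mul hh.le, ENNReal.ofReal_le_ofReal_iff (by positivity)] at h3
    rw [div_mul_eq_mul_div, le_div_iff₀' hh]
    exact h3
  have := norm_image_sub_le_of_norm_deriv_le_segment_01' (f := fun t : ℝ => Φ (t • ξ))
    (fun t _ => (hder t).hasDerivWithinAt) fun t ht => hbound t ⟨ht.1, ht.2.le⟩
  simpa using this

/-- After the test functions are split at `x₀`, the term of order 0 is the value of the remainder,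
bounded by the mean value inequality along the segment to δφ. For m ≥ 1 the remainder has the
derivatives of `Φ`, and (hε)^m ≤ 2ε(h/2)^m, so a single factor ε is gained and the norm of radius
h/2 suffices. -/
lemma tNorm_chargeRemainder_le (hΦ : ContDiff ℝ ∞ Φ) (hs : SupportedOn Y Φ) {β : ℝ}
    (hβ : HasCharge β Φ) {k k' : ℕ} {x₀ : Site L R} (hx₀ : x₀ ∈ Y) {ε : ℝ≥0} (hε : ε ≠ 0)
    (hε2 : 2 * ε ≤ 1)
    (hδ : ∀ f : Site L R → ℂ, c2Norm k' Y f ≤ 1 →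
      ‖f x₀‖ ≤ 1 ∧ c2Norm k Y (fun x => f x - f x₀) ≤ ε)
    {h d T : ℝ} (hh : 0 < h) (hd : 0 < d) (hT : 0 ≤ T) {φ : Site L R → ℝ}
    (hφ : (c2Norm k Y (fun x => ((φ x - φ x₀ : ℝ) : ℂ)) : ℝ) ≤ d)
    (hB : ∀ t ∈ Set.Icc (0 : ℝ) 1,
      tNorm (h / 2) k Y Φ (fun x => t * (φ x - φ x₀)) ≤ ENNReal.ofReal T)
    (hB' : tNorm (h / 2) k Y Φ φ ≤ ENNReal.ofReal T) :
    tNorm h k' Y (chargeRemainder β x₀ Φ) φ ≤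
      ENNReal.ofReal (Real.exp (|β| * h) * ((d / (h / 2) + 2 * ε) * T)) := by
  set P := chargeRemainder β x₀ Φ with hP
  have hPφ : ‖P φ‖ ≤ d / (h / 2) * T := by
    have h1 : P φ = Complex.exp (Complex.I * β * φ x₀) * (Φ (fun x => φ x - φ x₀) - Φ 0) := by
      have := hβ (fun x => φ x - φ x₀) (φ x₀)
      simp only [sub_add_cancel] at this
      rw [hP, chargeRemainder, this, mul_sub]
    rw [h1, norm_mul, show Complex.I * β * φ x₀ = ((β * φ x₀ : ℝ) : ℂ) * Complex.I by
      push_cast; ring, Complex.norm_exp_ofReal_mul_I, one_mul]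
    exact norm_sub_zero_le hΦ hs (by positivity) hd hT hφ hB
  set t : ℕ → ℝ≥0∞ := fun m => if m = 0 then ‖P φ‖ₑ else tnNorm k Y m Φ φ with ht
  refine (tNorm_le_of_hasCharge (contDiff_chargeRemainder hΦ β x₀)
    (supportedOn_chargeRemainder hs β hx₀) (hasCharge_chargeRemainder hβ x₀) hε hδ hh.le φ t
    fun l hl => ?_).trans ?_
  · by_cases hl0 : l = []
    · subst hl0; simp [ht, hP]
    · simp only [ht, List.length_eq_zero_iff, hl0, if_false]
      rw [cdirs_chargeRemainder hΦ β hl0 fun f hf => (hl f hf).2]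
      exact enorm_cdirs_le_tnNorm hΦ fun f hf => (hl f hf).1
  rw [ENNReal.ofReal_mul (Real.exp_pos _).le]
  gcongr
  have hsum : ∀ m, ENNReal.ofReal ((h * ε) ^ m / m.factorial) * t m ≤
      (if m = 0 then ‖P φ‖ₑ else 0) + ENNReal.ofReal (2 * ε) *
        (ENNReal.ofReal ((h / 2) ^ m / m.factorial) * tnNorm k Y m Φ φ) := by
    intro m
    by_cases hm : m = 0
    · subst hm; simp [ht]
    · simp only [ht, hm, if_false, zero_add]
      rw [← mul_assoc, ← ENNReal.ofReal_mul (by positivity)]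
      gcongr
      have hε2' : 2 * (ε : ℝ) ≤ 1 := by exact_mod_cast hε2
      have : (h * ε) ^ m = (2 * ε : ℝ) ^ m * (h / 2) ^ m := by rw [← mul_pow]; congr 1; ring
      rw [this, mul_div_assoc]
      gcongr
      exact pow_le_of_le_one (by positivity) hε2' hm
  refine (ENNReal.tsum_le_tsum hsum).trans ?_
  rw [ENNReal.tsum_add, tsum_ite_eq, ENNReal.tsum_mul_left, add_mul,
    ENNReal.ofReal_add (by positivity) (by positivity)]
  refine add_le_add ?_ ?_
  · rw [← ofReal_norm]; exact ENNReal.ofReal_le_ofReal hPφ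
  · rw [ENNReal.ofReal_mul (p := 2 * ε) (q := T) (by positivity)]
    exact mul_le_mul_right hB' _

/-- The Taylor polynomial of order 0 is the value at the zero field, and the phase at `x₀`
reconstructs the expectation at φ' from that at δφ'. -/
lemma remExp_eq_chargeRemainder (C : ℕ → ℤ × ℤ → ℝ) (M j : ℕ) (Y : Finset (Site L R)) (α : ℝ)
    (q : ℤ) (x₀ : Site L R) {F : (Site L R → ℝ) → ℂ}
    (hβ : HasCharge (q * α) (fluctuationExp C M j F)) :
    remExp C M j Y 0 α q x₀ F = chargeRemainder (q * α) x₀ (fluctuationExp C M j F) := by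
  ext φ
  have h1 := hβ (fun x => φ x - φ x₀) (φ x₀)
  simp only [sub_add_cancel] at h1
  rw [remExp, taylorRem, taylorPoly, chargeRemainder, h1]
  have : Complex.I * ((q * α : ℝ) : ℂ) * φ x₀ = Complex.I * q * α * φ x₀ := by push_cast; ring
  rw [this]
  simp [dirDeriv]
  ring

end Remainder

/-! ### The expectation of a charged activity -/

section Expectation
open MeasureTheory ProbabilityTheory

variable {L R : ℕ} [NeZero L]

lemma tNorm_le_of_activityNorm {c₁ c₃ κ h A : ℝ} {j : ℕ} (hA : 0 < A)
    {K : Finset (Site L R) → (Site L R → ℝ) → ℂ} (hK : activityNorm c₁ c₃ κ h A j K ≠ ⊤)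
    {X : Finset (Site L R)} (hX : IsConnectedPolymer j X) (φ : Site L R → ℝ) :
    tNorm h j (smallNbhd j X) (K X) φ ≤
      ENNReal.ofReal ((activityNorm c₁ c₃ κ h A j K).toReal * (A ^ (blocksOf j X).card)⁻¹ *
        regulator c₁ c₃ κ j φ X) := by
  set a := activityNorm c₁ c₃ κ h A j K with ha
  set n := (blocksOf j X).card with hn
  have hreg : 0 < regulator c₁ c₃ κ j φ X := Real.exp_pos _
  have hAn : 0 < A ^ n := by positivity
  have h1 : ENNReal.ofReal (A ^ n) * (tNorm h j (smallNbhd j X) (K X) φ /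
      ENNReal.ofReal (regulator c₁ c₃ κ j φ X)) ≤ a := by
    rw [ha, activityNorm]
    refine le_trans ?_ (le_iSup₂_of_le X hX le_rfl)
    gcongr
    exact le_iSup (fun φ => tNorm h j (smallNbhd j X) (K X) φ /
      ENNReal.ofReal (regulator c₁ c₃ κ j φ X)) φ
  have hAn' : ENNReal.ofReal (A ^ n) ≠ 0 := by simpa using hAn
  have hreg' : ENNReal.ofReal (regulator c₁ c₃ κ j φ X) ≠ 0 := by simpa using hreg
  rw [mul_comm, ← ENNReal.le_div_iff_mul_le (Or.inl hAn') (Or.inl ENNReal.ofReal_ne_top),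
    ENNReal.div_le_iff hreg' ENNReal.ofReal_ne_top] at h1
  refine h1.trans (le_of_eq ?_)
  rw [ENNReal.ofReal_mul (by positivity), ENNReal.ofReal_mul (by positivity),
    ENNReal.ofReal_toReal hK, ENNReal.ofReal_inv_of_pos hAn, div_eq_mul_inv]

lemma continuous_regulator (c₁ c₃ κ : ℝ) (j : ℕ) (X : Finset (Site L R)) :
    Continuous fun φ : Site L R → ℝ => regulator c₁ c₃ κ j φ X := by
  have := continuous_regSum (L := L) (R := R) c₁ c₃ j X
  simp only [regulator_eq]
  fun_prop

/-- The expectation of a charged polymer activity of finite norm. -/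
lemma fluctuationExp_bounds {γ M₀ j : ℕ} {C : ℕ → ℤ × ℤ → ℝ} (hγ : 1 < γ) (hγo : Odd γ)
    (hC : IsFiniteRangeDecomposition γ C) (hM₀ : 1 ≤ M₀) (hL : L = γ ^ M₀) (hj : j < R)
    (hΓ : 0 < scaleCov C M₀ j 0) {c₁ c₃ κ V : ℝ} (h₁ : 0 ≤ c₁) (h₃ : 0 ≤ c₃) (hκ : 0 ≤ κ)
    (hκV : 16 * (κ * V) ≤ 1) {X : Finset (Site L R)} (hX : IsSmall j X)
    (hQ : ExpQuad (fluctuationMeasure L R C M₀ j)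
      (fun ζ => regSum c₁ c₃ j (fun y => ζ y) X) V)
    {α : ℝ} (hα : 0 < α) {C₀ h : ℝ} (hC₀ : IsPropagatorBound γ C C₀) (hh : 1 < h)
    (hh₀ : 2 * α * C₀ ≤ h) {F : (Site L R → ℝ) → ℂ} (hF : ContDiff ℝ ∞ F)
    (hs : SupportedOn (smallNbhd j X) F)
    (hper : ∀ (φ : Site L R → ℝ) (m : ℤ), F (fun x => φ x + 2 * m * Real.pi / α) = F φ)
    {q : ℤ} (hq : q = 1 ∨ q = -1) {M : ℝ} (hM : 0 ≤ M)
    (hbd : ∀ φ, tNorm h j (smallNbhd j X) F φ ≤ ENNReal.ofReal (M * regulator c₁ c₃ κ j φ X)) :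
    (∀ φ' : Site L R → ℝ, Integrable (fun ζ : EuclideanSpace ℝ (Site L R) =>
      chargeComponent α q F (fun x => φ' x + ζ x)) (fluctuationMeasure L R C M₀ j)) ∧
    ContDiff ℝ ∞ (fluctuationExp C M₀ j (chargeComponent α q F)) ∧
    SupportedOn (smallNbhd j X) (fluctuationExp C M₀ j (chargeComponent α q F)) ∧
    HasCharge (q * α) (fluctuationExp C M₀ j (chargeComponent α q F)) ∧
    ∀ φ, tNorm (h / 2) j (smallNbhd j X) (fluctuationExp C M₀ j (chargeComponent α q F)) φ ≤
      ENNReal.ofReal (Real.exp (-(α ^ 2 * scaleCov C M₀ j 0 / 2)) *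
        (2 * M * Real.exp (2 * κ * regSum c₁ c₃ j φ X))) := by
  have hLo : Odd L := hL ▸ hγo.pow
  have hS := posSemidef_torusCov hγ hC hL hj
  obtain ⟨S, hSdef⟩ : ∃ S : Matrix (Site L R) (Site L R) ℝ,
      S = Matrix.of fun x y : Site L R => torusCov C M₀ j (x - y) := ⟨_, rfl⟩
  have hμ : fluctuationMeasure L R C M₀ j = multivariateGaussian 0 S := by
    rw [fluctuationMeasure, hSdef]
  rw [← hSdef] at hS
  have hfl : ∀ G : (Site L R → ℝ) → ℂ, fluctuationExp C M₀ j G = fun φ =>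
      ∫ ζ : EuclideanSpace ℝ (Site L R), G (fun x => φ x + ζ x) ∂(multivariateGaussian 0 S) := by
    intro G; ext φ; rw [fluctuationExp, hμ]
  rw [hμ] at hQ ⊢
  have hSy : ∀ y : Site L R, S y y = scaleCov C M₀ j 0 := by
    intro y
    rw [hSdef, Matrix.of_apply, sub_self, torusCov_eq]
    simp only [toInt, Prod.fst_zero, Prod.snd_zero, ZMod.valMinAbs_zero]
    rfl
  obtain ⟨hT, hW, hW2⟩ := isShiftBound_regulator hS h₁ h₃ hκ hQ hκV
  have hreg0 : ∀ φ, 0 ≤ regulator c₁ c₃ κ j φ X := fun φ => (Real.exp_pos _).le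
  obtain ⟨hFd, hFb⟩ := chargeComponent_bounds hα q (continuous_regulator c₁ c₃ κ j X) hreg0
    (fun φ s => by rw [regulator_eq, regulator_eq, regSum_add_const]) hF hs (by linarith) hM hbd
  have hch := hasCharge_chargeComponent (q := q) hα hper
  set G := chargeComponent α q F with hG
  have havg : fluctuationExp C M₀ j G =
      shiftAvg (multivariateGaussian 0 S) (fun _ => 1) (fun ζ x => ζ x) G := by
    rw [hfl]; ext φ; simp only [shiftAvg, one_mul]
  refine ⟨fun φ => ?_, ?_, ?_, ?_, fun φ => ?_⟩
  · simpa only [one_mul] using hT.integrable hFd φ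
  · rw [havg]; exact hT.contDiff hFd
  · rw [havg]; exact IsShiftBound.supportedOn hFd.supported
  · intro φ s
    rw [hfl]
    simp only
    rw [← integral_const_mul]
    congr 1; ext ζ
    rw [← hch]
    congr 1; ext x; ring
  -- The translation is centred at a block centre y in `X`, since only translations by such points
  -- carry polymers to polymers and so allow the bound `C₀`, stated at the origin, to be used.
  · obtain ⟨x, hx⟩ := hX.1.2.1
    obtain ⟨B, hB, hxB⟩ := hX.1.1.exists_mem hx
    obtain ⟨y, hy, rfl⟩ := mem_blocks.1 (mem_blocksOf.1 hB).1
    have hyX : y ∈ X := (mem_blocksOf.1 hB).2 (center_mem_block j y)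
    have hprop := hC₀.c2Norm_le hM₀ hL hj hX hy hyX
    -- The largest shift the halved radius can pay for: αb = h/2. It is positive, and it dominates
    -- `C₀` by hypothesis.
    obtain ⟨b, hb⟩ : ∃ b : ℝ≥0, (b : ℝ) = h / (2 * α) := ⟨⟨h / (2 * α), by positivity⟩, rfl⟩
    have hb0 : b ≠ 0 := by
      rintro rfl
      have : 0 < h / (2 * α) := by positivity
      rw [← hb] at this
      simp at this
    have hCb : C₀ ≤ b := by
      rw [hb, le_div_iff₀ (by positivity)]; linarith
    have hqα : |(q : ℝ) * α| = α := by
      rcases hq with rfl | rfl <;> simp [abs_of_pos hα]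
    have key := tNorm_expectation_le hS (y := y) (by rw [hSy]; exact hΓ) hT (hW y) hFd hch
      (k := j) hb0 (by
        have : (c2Norm j (smallNbhd j X) (fun x => ((S x y - S y y : ℝ) : ℂ)) : ℝ) ≤ b := by
          refine le_trans ?_ (hprop.trans hCb)
          rw [hSdef]
          exact le_rfl
        exact_mod_cast this) (h := h) (by linarith) (by
        rw [hqα, hb]
        refine le_of_eq ?_
        field_simp) φ
    rw [hfl]
    refine key.trans ?_
    have hq2 : ((q : ℝ) * α) ^ 2 = α ^ 2 := by rw [← sq_abs, hqα]
    rw [hSy, hq2, ENNReal.ofReal_mul (Real.exp_pos _).le]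
    gcongr
    calc ∫⁻ ζ : EuclideanSpace ℝ (Site L R), tNorm h j (smallNbhd j X) G (fun x => φ x + ζ x)
          ∂(multivariateGaussian 0 S)
        ≤ ∫⁻ ζ : EuclideanSpace ℝ (Site L R), ENNReal.ofReal
          (M * Real.exp (2 * κ * regSum c₁ c₃ j φ X) *
            Real.exp (2 * κ * regSum c₁ c₃ j (fun y => ζ y) X)) ∂(multivariateGaussian 0 S) := by
          refine lintegral_mono fun ζ => (hFb _).trans (ENNReal.ofReal_le_ofReal ?_)
          rw [mul_assoc]
          exact mul_le_mul_of_nonneg_left (hT.bound φ ζ) hM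
      _ = ENNReal.ofReal (∫ ζ : EuclideanSpace ℝ (Site L R),
          M * Real.exp (2 * κ * regSum c₁ c₃ j φ X) *
            Real.exp (2 * κ * regSum c₁ c₃ j (fun y => ζ y) X) ∂(multivariateGaussian 0 S)) :=
          (ofReal_integral_eq_lintegral_ofReal (hT.integrable_weight.const_mul _)
            (Filter.Eventually.of_forall fun ζ => by positivity)).symm
      _ ≤ _ := by
          refine ENNReal.ofReal_le_ofReal ?_
          rw [integral_const_mul]
          have h0 : 0 ≤ M * Real.exp (2 * κ * regSum c₁ c₃ j φ X) := by positivity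
          nlinarith [mul_le_mul_of_nonneg_left hW2 h0]

end Expectation

/-! ### Choice of the scale factor and collection of powers -/

section Numerics
open Filter

/-- The conditions on the scale factor under which the contraction holds. -/
structure IsLargeScale (c₁ c₃ c α h B V : ℝ) (L : ℕ) : Prop where
  hundred_le : 100 ≤ L
  kappa_le : 16 * (c / Real.log L * V) ≤ 1
  cov_pos : 0 < 1 / (2 * Real.pi) * Real.log L - B
  quadratic : 4 * (652 * c₁ + 2592 * c₃) ≤ c₁ * (L : ℝ) ^ 2
  power : 1920 * Real.exp (α * h) * Real.exp (4 * Real.pi * B) *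
    (1 + Real.sqrt (Real.log L / (c * c₁))) ≤ (L : ℝ) ^ (1 / 2 : ℝ)

/-- All conditions compare constants with growing functions of L; for the last one, log L ≤ 2L^{1/2}
gives √(log L) ≤ √2 L^{1/4}, which leaves L^{1/4} for the constants. -/
lemma exists_isLargeScale {c₁ c : ℝ} (h₁ : 0 < c₁) (hc : 0 < c) (c₃ α h B V : ℝ) :
    ∃ L₀ : ℕ, ∀ L, L₀ ≤ L → IsLargeScale c₁ c₃ c α h B V L := by
  have hlog : Tendsto (fun L : ℕ => Real.log L) atTop atTop :=
    Real.tendsto_log_atTop.comp tendsto_natCast_atTop_atTop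
  have hpow : Tendsto (fun L : ℕ => (L : ℝ) ^ (1 / 4 : ℝ)) atTop atTop :=
    (tendsto_rpow_atTop (by norm_num)).comp tendsto_natCast_atTop_atTop
  set K := 1920 * Real.exp (α * h) * Real.exp (4 * Real.pi * B) with hK
  have hK0 : 0 ≤ K := by positivity
  rw [← eventually_atTop]
  filter_upwards [eventually_ge_atTop 100, hlog.eventually_ge_atTop (16 * c * V),
    hlog.eventually_gt_atTop (2 * Real.pi * B), hlog.eventually_gt_atTop 0,
    (tendsto_natCast_atTop_atTop (R := ℝ)).eventually_ge_atTop
      (4 * (652 * c₁ + 2592 * c₃) / c₁),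
    hpow.eventually_ge_atTop (K * (1 + Real.sqrt (2 / (c * c₁))))] with L h100 hV hB h0 hL2 hL4
  have hL1 : (1 : ℝ) ≤ L := by exact_mod_cast (by omega : 1 ≤ L)
  refine ⟨h100, ?_, ?_, ?_, ?_⟩
  · rw [div_mul_eq_mul_div, mul_div_assoc', div_le_one h0]; linarith
  · rw [sub_pos, one_div, inv_mul_eq_div, lt_div_iff₀ (by positivity)]; linarith
  · rw [div_le_iff₀' h₁] at hL2
    refine hL2.trans ?_
    gcongr
    nlinarith
  · have hsq : (L : ℝ) ^ (1 / 2 : ℝ) = (L : ℝ) ^ (1 / 4 : ℝ) * (L : ℝ) ^ (1 / 4 : ℝ) := by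
      rw [← Real.rpow_add (by linarith)]; norm_num
    have hp1 : 1 ≤ (L : ℝ) ^ (1 / 4 : ℝ) := Real.one_le_rpow hL1 (by norm_num)
    have hlogle : Real.log L ≤ 2 * (L : ℝ) ^ (1 / 2 : ℝ) := by
      have := Real.log_le_rpow_div (x := (L : ℝ)) (by linarith) (by norm_num : (0 : ℝ) < 1 / 2)
      linarith
    have hs : Real.sqrt (Real.log L / (c * c₁)) ≤
        Real.sqrt (2 / (c * c₁)) * (L : ℝ) ^ (1 / 4 : ℝ) := by
      rw [Real.sqrt_le_left (by positivity), mul_pow, Real.sq_sqrt (by positivity), sq, ← hsq,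
        div_mul_eq_mul_div]
      gcongr
    calc K * (1 + Real.sqrt (Real.log L / (c * c₁)))
        ≤ K * ((L : ℝ) ^ (1 / 4 : ℝ) + Real.sqrt (2 / (c * c₁)) * (L : ℝ) ^ (1 / 4 : ℝ)) := by
          gcongr
      _ = K * (1 + Real.sqrt (2 / (c * c₁))) * (L : ℝ) ^ (1 / 4 : ℝ) := by ring
      _ ≤ (L : ℝ) ^ (1 / 4 : ℝ) * (L : ℝ) ^ (1 / 4 : ℝ) := by gcongr
      _ = _ := hsq.symm

/-- The gain `L^{-5/2}`. -/
lemma IsLargeScale.contraction {c₁ c₃ c α h B V : ℝ} {L : ℕ}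
    (hL : IsLargeScale c₁ c₃ c α h B V L) (h₁ : 0 < c₁) (hc : 0 < c)
    (hα : 8 * Real.pi ≤ α ^ 2) (hh : 1 < h) {Γ : ℝ}
    (hΓ : 1 / (2 * Real.pi) * Real.log L - B ≤ Γ) {N M : ℝ} (hN : 0 ≤ N) (hM : 0 ≤ M) :
    Real.exp (α * h) * ((48 * (9 * (N + 1) * (L : ℝ)⁻¹) / (h / 2) + 2 * (48 * (L : ℝ)⁻¹)) *
      (Real.exp (-(α ^ 2 * Γ / 2)) * (2 * M * Real.exp (2 * (c / Real.log L) *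
        ((652 * c₁ + 2592 * c₃) * (N ^ 2 * ((L : ℝ) ^ 2)⁻¹)))))) ≤
      (L : ℝ) ^ (-(2 + 1 / 2 : ℝ)) * (M * Real.exp (c / Real.log L * (c₁ * N ^ 2))) := by
  have hL100 : (100 : ℝ) ≤ L := by exact_mod_cast hL.hundred_le
  have hL0 : (0 : ℝ) < L := by linarith
  have hlog : 0 < Real.log L := Real.log_pos (by linarith)
  set κ := c / Real.log L with hκ
  have hκ0 : 0 < κ := by positivity
  have hpi := Real.pi_pos
  -- The threshold α² ≥ 8π enters here: half of 8π times (2π)⁻¹ log L is exactly 2 log L.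
  have e1 : Real.exp (-(α ^ 2 * Γ / 2)) ≤ Real.exp (4 * Real.pi * B) * ((L : ℝ) ^ 2)⁻¹ := by
    have hx : ((L : ℝ) ^ 2)⁻¹ = Real.exp (-(2 * Real.log L)) := by
      rw [Real.exp_neg, ← Real.log_rpow hL0, Real.exp_log (by positivity)]
      norm_num
    rw [hx, ← Real.exp_add]
    refine Real.exp_le_exp.2 ?_
    have hΓ0 : 0 < Γ := hL.cov_pos.trans_le hΓ
    have a1 : 8 * Real.pi * Γ ≤ α ^ 2 * Γ := by gcongr
    have a2 : 4 * Real.pi * (1 / (2 * Real.pi) * Real.log L - B) ≤ 4 * Real.pi * Γ := by gcongr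
    have a3 : 4 * Real.pi * (1 / (2 * Real.pi) * Real.log L - B) =
        2 * Real.log L - 4 * Real.pi * B := by field_simp; ring
    linarith
  have e2 : 48 * (9 * (N + 1) * (L : ℝ)⁻¹) / (h / 2) + 2 * (48 * (L : ℝ)⁻¹) ≤
      960 * (N + 1) * (L : ℝ)⁻¹ := by
    have : 48 * (9 * (N + 1) * (L : ℝ)⁻¹) / (h / 2) ≤ 864 * (N + 1) * (L : ℝ)⁻¹ := by
      rw [div_le_iff₀ (by positivity)]
      have h0 : 0 ≤ 432 * (N + 1) * (L : ℝ)⁻¹ := by positivity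
      nlinarith
    have h0 : 0 ≤ N * (L : ℝ)⁻¹ := by positivity
    linarith
  -- From x ≤ e^{x²/2} with x = N√(cc₁/log L). Half of the new regulator absorbs the field size, at
  -- the cost of √(log L).
  have e3 : N + 1 ≤ (1 + Real.sqrt (Real.log L / (c * c₁))) * Real.exp (κ * (c₁ * N ^ 2) / 2) := by
    set u := Real.sqrt (Real.log L / (c * c₁)) with hu
    have hu0 : 0 < u := by positivity
    have hu2 : u ^ 2 = Real.log L / (c * c₁) := Real.sq_sqrt (by positivity)
    have hκu : κ * (c₁ * N ^ 2) = (N / u) ^ 2 := by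
      rw [div_pow, hu2, hκ]; field_simp
    have h1 : N / u ≤ Real.exp (κ * (c₁ * N ^ 2) / 2) := by
      rw [hκu]
      have := Real.add_one_le_exp ((N / u) ^ 2 / 2)
      nlinarith [sq_nonneg (N / u - 1)]
    rw [div_le_iff₀ hu0] at h1
    have h2 : 1 ≤ Real.exp (κ * (c₁ * N ^ 2) / 2) := Real.one_le_exp (by positivity)
    linarith
  -- The other half pays for the old regulator, whose exponent has shrunk by L⁻².
  have e4 : Real.exp (2 * κ * ((652 * c₁ + 2592 * c₃) * (N ^ 2 * ((L : ℝ) ^ 2)⁻¹))) ≤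
      Real.exp (κ * (c₁ * N ^ 2) / 2) := by
    refine Real.exp_le_exp.2 ?_
    have h1 : (652 * c₁ + 2592 * c₃) * ((L : ℝ) ^ 2)⁻¹ ≤ c₁ / 4 := by
      rw [← div_eq_mul_inv, div_le_iff₀ (by positivity)]
      linarith [hL.quadratic]
    have h2 := mul_le_mul_of_nonneg_left h1 (by positivity : 0 ≤ 2 * κ * N ^ 2)
    linarith
  set E := Real.exp (κ * (c₁ * N ^ 2) / 2) with hE
  have hEE : Real.exp (κ * (c₁ * N ^ 2)) = E * E := by rw [hE, ← Real.exp_add]; ring_nf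
  have hLpow : (L : ℝ) ^ (-(2 + 1 / 2 : ℝ)) =
      (L : ℝ) ^ (1 / 2 : ℝ) * ((L : ℝ)⁻¹ * ((L : ℝ) ^ 2)⁻¹) := by
    rw [show (-(2 + 1 / 2 : ℝ)) = 1 / 2 + (-3 : ℝ) by norm_num, Real.rpow_add hL0,
      Real.rpow_neg hL0.le]
    congr 1
    rw [← mul_inv, ← pow_succ']
    norm_cast
  rw [hLpow, hEE]
  calc _ ≤ Real.exp (α * h) * ((960 * (N + 1) * (L : ℝ)⁻¹) *
        ((Real.exp (4 * Real.pi * B) * ((L : ℝ) ^ 2)⁻¹) * (2 * M * E))) := by gcongr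
    _ ≤ Real.exp (α * h) * ((960 * ((1 + Real.sqrt (Real.log L / (c * c₁))) * E) * (L : ℝ)⁻¹) *
        ((Real.exp (4 * Real.pi * B) * ((L : ℝ) ^ 2)⁻¹) * (2 * M * E))) := by gcongr
    _ = (1920 * Real.exp (α * h) * Real.exp (4 * Real.pi * B) *
        (1 + Real.sqrt (Real.log L / (c * c₁)))) * ((L : ℝ)⁻¹ * ((L : ℝ) ^ 2)⁻¹) *
        (M * (E * E)) := by ring
    _ ≤ (L : ℝ) ^ (1 / 2 : ℝ) * ((L : ℝ)⁻¹ * ((L : ℝ) ^ 2)⁻¹) * (M * (E * E)) := by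
        gcongr
        exact hL.power

end Numerics

/-! ### The bound at one reference point -/

section Contraction
open MeasureTheory

variable {L R : ℕ} [NeZero L]

/-- The bound on the remainder at one reference point. -/
lemma tNorm_chargeRemainder_le_regulator {c₁ c₃ c α h B V : ℝ} (hLs : IsLargeScale c₁ c₃ c α h B V L)
    (hL : Odd L) (h₁ : 0 < c₁) (h₃ : 0 < c₃) (hc : 0 < c) (hα : 0 < α)
    (hα8 : 8 * Real.pi ≤ α ^ 2) (hh : 1 < h) {Γ : ℝ}
    (hΓ : 1 / (2 * Real.pi) * Real.log L - B ≤ Γ) {M : ℝ} (hM : 0 ≤ M) {j : ℕ} (hj : j < R)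
    {X : Finset (Site L R)} (hX : IsSmall j X) {q : ℤ} (hq : q = 1 ∨ q = -1)
    {Φ : (Site L R → ℝ) → ℂ} (hΦ : ContDiff ℝ ∞ Φ) (hs : SupportedOn (smallNbhd j X) Φ)
    (hβ : HasCharge (q * α) Φ)
    (hbd : ∀ φ, tNorm (h / 2) j (smallNbhd j X) Φ φ ≤
      ENNReal.ofReal (Real.exp (-(α ^ 2 * Γ / 2)) *
        (2 * M * Real.exp (2 * (c / Real.log L) * regSum c₁ c₃ j φ X))))
    {x₀ : Site L R} (hx₀ : x₀ ∈ X) (φ : Site L R → ℝ) :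
    tNorm h (j + 1) (smallNbhd j X) (chargeRemainder (q * α) x₀ Φ) φ ≤
      ENNReal.ofReal ((L : ℝ) ^ (-(2 + 1 / 2 : ℝ)) *
        (M * regulator c₁ c₃ (c / Real.log L) (j + 1) φ (reblock (j + 1) X))) := by
  have h100 := hLs.hundred_le
  have hL100 : (100 : ℝ) ≤ L := by exact_mod_cast h100
  have hL0 : (0 : ℝ) < L := by linarith
  have hlog : 0 < Real.log L := Real.log_pos (by linarith)
  have hκ : 0 < c / Real.log L := by positivity
  have hLR : 3 ≤ L ^ R := by
    calc 3 ≤ L ^ 1 := by rw [pow_one]; omega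
      _ ≤ L ^ R := Nat.pow_le_pow_right (by omega) (by omega)
  have hXs := hX.1.1.subset_smallNbhd hL hj.le
  obtain ⟨N, hN, hreg, hd1, hd2⟩ := hX.exists_fieldSize hL (by omega) hj h₁.le h₃.le φ
  have hreg' := hX.regSum_le hL hj.le h₁.le h₃.le hN hd1 hd2
  have hqα : |(q : ℝ) * α| = α := by
    rcases hq with rfl | rfl <;> simp [abs_of_pos hα]
  obtain ⟨ε, hε⟩ : ∃ ε : ℝ≥0, (ε : ℝ) = 48 * (L : ℝ)⁻¹ := ⟨⟨48 * (L : ℝ)⁻¹, by positivity⟩, rfl⟩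
  have hLinv : (L : ℝ)⁻¹ ≤ 1 / 100 := by
    rw [one_div]; exact inv_anti₀ (by norm_num) hL100
  have hε0 : ε ≠ 0 := by
    rintro rfl
    have : 0 < 48 * (L : ℝ)⁻¹ := by positivity
    rw [← hε] at this
    simp at this
  have hε2 : 2 * ε ≤ 1 := by
    have : 2 * (ε : ℝ) ≤ 1 := by rw [hε]; linarith
    exact_mod_cast this
  -- N + 1 instead of N keeps the bound positive when the field is constant, as the mean value
  -- estimate requires.
  have hδφ : (c2Norm j (smallNbhd j X) (fun x => ((φ x - φ x₀ : ℝ) : ℂ)) : ℝ) ≤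
      48 * (9 * (N + 1) * (L : ℝ)⁻¹) := by
    refine le_trans (by exact_mod_cast c2Norm_ofReal_le fun x => φ x - φ x₀) ?_
    refine hX.c2Norm_sub_le hL hLR hj.le hx₀ (by positivity) (fun x hx μ => ?_) fun x hx μ => ?_
    · rw [← div_eq_mul_inv, le_div_iff₀ hL0]
      have := hd1 x hx μ
      rw [pow_succ] at this
      linarith
    · rw [← mul_assoc, ← div_eq_mul_inv, le_div_iff₀ hL0]
      have h0 := norm_nonneg (latticeDeriv (List.ofFn μ) φ x)
      calc (L : ℝ) ^ (2 * j) * ‖latticeDeriv (List.ofFn μ) φ x‖ * L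
          ≤ (L : ℝ) ^ (2 * j) * ‖latticeDeriv (List.ofFn μ) φ x‖ * L * L :=
            le_mul_of_one_le_right (by positivity) (by linarith)
        _ = (L : ℝ) ^ (2 * (j + 1)) * ‖latticeDeriv (List.ofFn μ) φ x‖ := by ring
        _ ≤ N := hd2 x hx μ
        _ ≤ _ := by linarith
  -- One bound serves both φ and the fields tδφ with 0 ≤ t ≤ 1: constants do not change the exponent
  -- of the regulator, and contracting the field does not increase it.
  have hT : ∀ ψ : Site L R → ℝ, regSum c₁ c₃ j ψ X ≤ regSum c₁ c₃ j φ X →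
      tNorm (h / 2) j (smallNbhd j X) Φ ψ ≤ ENNReal.ofReal (Real.exp (-(α ^ 2 * Γ / 2)) *
        (2 * M * Real.exp (2 * (c / Real.log L) *
          ((652 * c₁ + 2592 * c₃) * (N ^ 2 * ((L : ℝ) ^ 2)⁻¹))))) := by
    intro ψ hψ
    refine (hbd ψ).trans (ENNReal.ofReal_le_ofReal ?_)
    gcongr
    exact hψ.trans hreg'
  have key := tNorm_chargeRemainder_le (k := j) (k' := j + 1) hΦ hs hβ (hXs hx₀) hε0 hε2
    (fun f hf => by
      obtain ⟨a1, a2⟩ := hX.c2Norm_sub_le_of_c2Norm_succ hL hLR hj.le hx₀ hf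
      rw [← hε] at a2
      exact ⟨a1, by exact_mod_cast a2⟩)
    (h := h) (by linarith) (by positivity) (by positivity) hδφ
    (fun t ht => hT _ (by
      refine (regSum_mul_le h₁.le h₃.le t (by rw [abs_le]; constructor <;> linarith [ht.1, ht.2]) j
        (fun x => φ x - φ x₀) X).trans (le_of_eq ?_)
      simpa only [sub_eq_add_neg] using regSum_add_const c₁ c₃ j φ (-φ x₀) X))
    (hT φ le_rfl)
  refine key.trans (ENNReal.ofReal_le_ofReal ?_)
  rw [hqα, hε]
  refine (hLs.contraction h₁ hc hα8 hh hΓ hN hM).trans ?_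
  rw [regulator_eq]
  gcongr

end Contraction
end CoulombGas

/-! ### Proof of the theorem -/

theorem mainTheorem5 :
    ∃ ϑ : ℝ, 0 < ϑ ∧
    -- the base of the scales, and the decomposition of the covariance
    ∀ (γ : ℕ) (C : ℕ → ℤ × ℤ → ℝ), Odd γ → 1 < γ → IsFiniteRangeDecomposition γ C →
    -- the constants of the field regulator, with `κ = c / log L`
    ∀ c₁ c₃ c : ℝ, 0 < c₁ → 0 < c₃ → 0 < c →
    -- the parameter `α` and the radius `h`
    ∀ α : ℝ, 0 < α → 8 * Real.pi ≤ α ^ 2 →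
    ∀ C₀ h : ℝ, IsPropagatorBound γ C C₀ → 1 < h → 2 * α * C₀ ≤ h →
    ∃ L₀ : ℕ, ∀ (L M : ℕ) [NeZero L], L = γ ^ M → L₀ ≤ L →
    ∀ (R j : ℕ), j < R → ∀ A : ℝ, 1 < A →
    ∀ K : Finset (Site L R) → (Site L R → ℝ) → ℂ, IsActivity α j K →
    ∀ q : ℤ, q = 1 ∨ q = -1 →
    ∀ X : Finset (Site L R), IsSmall j X →
      -- if `K` has finite norm, the expectation is well defined and smooth
      (activityNorm c₁ c₃ (c / Real.log L) h A j K ≠ ⊤ →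
        (∀ φ' : Site L R → ℝ, MeasureTheory.Integrable
          (fun ζ : EuclideanSpace ℝ (Site L R) =>
            chargeComponent α q (K X) (fun x => φ' x + ζ x))
          (fluctuationMeasure L R C M j)) ∧
        ContDiff ℝ ∞ (fluctuationExp C M j (chargeComponent α q (K X)))) ∧
      -- the bound, for every choice of the reference point `x₀`
      (∀ x₀ ∈ X, ∀ φ' : Site L R → ℝ,
        tNorm h (j + 1) (smallNbhd j X)
            (remExp C M j (smallNbhd j X) 0 α q x₀ (chargeComponent α q (K X))) φ' ≤
          ENNReal.ofReal ((L : ℝ) ^ (-(2 + ϑ)))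
            * activityNorm c₁ c₃ (c / Real.log L) h A j K
            * ENNReal.ofReal (((A / 2) ^ (blocksOf j X).card)⁻¹)
            * ENNReal.ofReal
                (regulator c₁ c₃ (c / Real.log L) (j + 1) φ' (reblock (j + 1) X))) ∧
      -- the bound, for the average over the reference point
      (∀ φ' : Site L R → ℝ,
        tNorm h (j + 1) (smallNbhd j X)
            (fun ψ => (1 / (X.card : ℂ)) * ∑ x₀ ∈ X,
              remExp C M j (smallNbhd j X) 0 α q x₀ (chargeComponent α q (K X)) ψ) φ' ≤
          ENNReal.ofReal ((L : ℝ) ^ (-(2 + ϑ)))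
            * activityNorm c₁ c₃ (c / Real.log L) h A j K
            * ENNReal.ofReal (((A / 2) ^ (blocksOf j X).card)⁻¹)
            * ENNReal.ofReal
                (regulator c₁ c₃ (c / Real.log L) (j + 1) φ' (reblock (j + 1) X))) := by
  -- The estimates give L⁻³ up to constants and √(log L); half a power is spent on these.
  refine ⟨1 / 2, by norm_num, ?_⟩
  intro γ C hγo hγ hC c₁ c₃ c h₁ h₃ hc α hα hα8 C₀ h hC₀ hh hh₀
  obtain ⟨B, hB⟩ := hC.exists_scaleCov_zero_ge hγ
  obtain ⟨V₀, hV₀, hvar⟩ := hC.exists_variance_le hγ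
  obtain ⟨L₀, hL₀⟩ := exists_isLargeScale h₁ hc c₃ α h B
    (c₁ * (25 / 2 * V₀) + c₃ * (85 / 2 * V₀) + c₁ * (10 ^ 11 * V₀))
  refine ⟨L₀, ?_⟩
  intro L M _ hL hLL R j hj A hA K hK q hq X hX
  have hLs := hL₀ L hLL
  have h100 := hLs.hundred_le
  have hL100 : (100 : ℝ) ≤ L := by exact_mod_cast h100
  have hlog : 0 < Real.log L := Real.log_pos (by linarith)
  have hLo : Odd L := hL ▸ hγo.pow
  have hM : 1 ≤ M := by
    rcases Nat.eq_zero_or_pos M with h0 | h0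
    · rw [h0, pow_zero] at hL; omega
    · exact h0
  have hLR : 100 ≤ L ^ R := by
    calc 100 ≤ L ^ 1 := by rw [pow_one]; exact h100
      _ ≤ L ^ R := Nat.pow_le_pow_right (by omega) (by omega)
  have hΓ : 1 / (2 * Real.pi) * Real.log L - B ≤ scaleCov C M j 0 := by
    have := hB M j
    rw [hL]
    push_cast
    rwa [Real.log_pow]
  have hXc := hX.1
  have hXs := hXc.1.subset_smallNbhd hLo hj.le
  have hA0 : 0 < A := by linarith
  set κ := c / Real.log L with hκ
  have hκ0 : 0 < κ := by positivity
  have hS := posSemidef_torusCov (L := L) (R := R) hγ hC hL hj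
  have hprob : MeasureTheory.IsProbabilityMeasure (fluctuationMeasure L R C M j) := by
    unfold fluctuationMeasure; infer_instance
  have hQ : ExpQuad (fluctuationMeasure L R C M j)
      (fun ζ => regSum c₁ c₃ j (fun y => ζ y) X) _ :=
    expQuad_regSum hV₀ h₁ h₃ hLo (by omega) hj.le (fun l hl1 hl4 x =>
      expQuad_latticeDeriv hS (by have := NeZero.pos L; positivity)
        (hvar L R M j hL (by omega) l hl1 hl4) x) hX
  have main : activityNorm c₁ c₃ κ h A j K ≠ ⊤ → _ := fun hKtop =>
    fluctuationExp_bounds hγ hγo hC hM hL hj (hLs.cov_pos.trans_le hΓ) h₁.le h₃.le hκ0.le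
      hLs.kappa_le hX hQ hα hC₀ hh hh₀ (hK.smooth X hXc) (hK.support X hXc) (hK.periodic X hXc) hq
      (M := (activityNorm c₁ c₃ κ h A j K).toReal * (A ^ (blocksOf j X).card)⁻¹) (by positivity)
      (tNorm_le_of_activityNorm hA0 hKtop hXc)
  have bound : activityNorm c₁ c₃ κ h A j K ≠ ⊤ → ∀ x₀ ∈ X, ∀ φ' : Site L R → ℝ,
      ContDiff ℝ ∞ (remExp C M j (smallNbhd j X) 0 α q x₀ (chargeComponent α q (K X))) ∧
      tNorm h (j + 1) (smallNbhd j X)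
        (remExp C M j (smallNbhd j X) 0 α q x₀ (chargeComponent α q (K X))) φ' ≤
      ENNReal.ofReal ((L : ℝ) ^ (-(2 + 1 / 2 : ℝ)))
        * activityNorm c₁ c₃ κ h A j K
        * ENNReal.ofReal (((A / 2) ^ (blocksOf j X).card)⁻¹)
        * ENNReal.ofReal (regulator c₁ c₃ κ (j + 1) φ' (reblock (j + 1) X)) := by
    intro hKtop x₀ hx₀ φ'
    obtain ⟨-, m2, m3, m4, m5⟩ := main hKtop
    rw [remExp_eq_chargeRemainder C M j _ α q x₀ m4]
    refine ⟨contDiff_chargeRemainder m2 _ x₀, ?_⟩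
    refine (tNorm_chargeRemainder_le_regulator hLs hLo h₁ h₃ hc hα hα8 hh hΓ (by positivity) hj hX
      hq m2 m3 m4 m5 hx₀ φ').trans ?_
    have hreg : 0 < regulator c₁ c₃ κ (j + 1) φ' (reblock (j + 1) X) := Real.exp_pos _
    rw [← ENNReal.ofReal_toReal hKtop, ENNReal.toReal_ofReal ENNReal.toReal_nonneg,
      ← ENNReal.ofReal_mul (by positivity), ← ENNReal.ofReal_mul (by positivity),
      ← ENNReal.ofReal_mul (by positivity)]
    refine ENNReal.ofReal_le_ofReal ?_
    rw [← mul_assoc, ← mul_assoc]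
    -- The weight A itself is available: the factor 2 from the moments of the regulator is a single
    -- constant for a small polymer and is absorbed by L.
    have hAn : (A ^ (blocksOf j X).card)⁻¹ ≤ ((A / 2) ^ (blocksOf j X).card)⁻¹ := by
      gcongr
      linarith
    gcongr
  -- For infinite norm the bound is trivial, because the other factors on the right are positive.
  have htop : activityNorm c₁ c₃ κ h A j K = ⊤ → ∀ φ' : Site L R → ℝ,
      ENNReal.ofReal ((L : ℝ) ^ (-(2 + 1 / 2 : ℝ)))
        * activityNorm c₁ c₃ κ h A j K
        * ENNReal.ofReal (((A / 2) ^ (blocksOf j X).card)⁻¹)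
        * ENNReal.ofReal (regulator c₁ c₃ κ (j + 1) φ' (reblock (j + 1) X)) = ⊤ := by
    intro hKtop φ'
    have p1 : 0 < (L : ℝ) ^ (-(2 + 1 / 2 : ℝ)) := Real.rpow_pos_of_pos (by linarith) _
    have p2 : 0 < ((A / 2) ^ (blocksOf j X).card)⁻¹ := by positivity
    have p3 : 0 < regulator c₁ c₃ κ (j + 1) φ' (reblock (j + 1) X) := Real.exp_pos _
    rw [hKtop, ENNReal.mul_top (by simpa using p1), ENNReal.top_mul (by simpa using p2),
      ENNReal.top_mul (by simpa using p3)]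
  refine ⟨fun hKtop => ⟨(main hKtop).1, (main hKtop).2.1⟩, fun x₀ hx₀ φ' => ?_, fun φ' => ?_⟩
  · by_cases hKtop : activityNorm c₁ c₃ κ h A j K = ⊤
    · rw [htop hKtop φ']; exact le_top
    · exact (bound hKtop x₀ hx₀ φ').2
  · by_cases hKtop : activityNorm c₁ c₃ κ h A j K = ⊤
    · rw [htop hKtop φ']; exact le_top
    set T := ENNReal.ofReal ((L : ℝ) ^ (-(2 + 1 / 2 : ℝ)))
        * activityNorm c₁ c₃ κ h A j K
        * ENNReal.ofReal (((A / 2) ^ (blocksOf j X).card)⁻¹)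
        * ENNReal.ofReal (regulator c₁ c₃ κ (j + 1) φ' (reblock (j + 1) X)) with hT
    have hcard : (X.card : ℝ) ≠ 0 := by exact_mod_cast (Finset.card_pos.2 hXc.2.1).ne'
    have hcard0 : (0 : ℝ) < X.card := by exact_mod_cast Finset.card_pos.2 hXc.2.1
    set r : Site L R → (Site L R → ℝ) → ℂ := fun x₀ =>
      remExp C M j (smallNbhd j X) 0 α q x₀ (chargeComponent α q (K X)) with hr
    have hsm : ∀ x₀ ∈ X, ContDiff ℝ ∞ (r x₀) := fun x₀ hx₀ => (bound hKtop x₀ hx₀ φ').1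
    have hsum : ContDiff ℝ ∞ (∑ x₀ ∈ X, r x₀) := by
      have : (∑ x₀ ∈ X, r x₀) = fun φ => ∑ x₀ ∈ X, r x₀ φ := by ext φ; simp
      rw [this]
      exact ContDiff.sum hsm
    have e : (fun ψ => (1 / (X.card : ℂ)) * ∑ x₀ ∈ X,
        remExp C M j (smallNbhd j X) 0 α q x₀ (chargeComponent α q (K X)) ψ) =
        (1 / (X.card : ℂ)) • ∑ x₀ ∈ X, r x₀ := by
      ext ψ; simp [hr]
    rw [e]
    calc _ ≤ ‖(1 / (X.card : ℂ))‖ₑ * tNorm h (j + 1) (smallNbhd j X) (∑ x₀ ∈ X, r x₀) φ' :=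
          tNorm_smul_le hsum _ _ _ _
      _ ≤ ‖(1 / (X.card : ℂ))‖ₑ * ∑ x₀ ∈ X, tNorm h (j + 1) (smallNbhd j X) (r x₀) φ' := by
          gcongr
          exact tNorm_sum_le X hsm _ _ _
      _ ≤ ‖(1 / (X.card : ℂ))‖ₑ * ∑ x₀ ∈ X, T := by
          gcongr with x₀ hx₀
          exact (bound hKtop x₀ hx₀ φ').2
      _ = T := by
          rw [Finset.sum_const, nsmul_eq_mul, ← mul_assoc, ← ofReal_norm, ← ENNReal.ofReal_natCast,
            ← ENNReal.ofReal_mul (norm_nonneg _)]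
          rw [show ‖(1 / (X.card : ℂ))‖ * (X.card : ℝ) = 1 by
            rw [norm_div, norm_one, Complex.norm_natCast]; field_simp]
          rw [ENNReal.ofReal_one, one_mul]
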